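/- Let $X$ be a compact connected smooth manifold of dimension $m+n$ and $\mathcal F$ a smooth foliation of rank $m$ on $X$. Let $g$ be a Riemannian metric on $X$ which is bundle-like for $\mathcal F$ (the metric it induces on the normal bundle $TX/\mathcal F\simeq\mathcal F^\perp$ is basic, i.e. its Lie derivatives along vector fields tangent to $\mathcal F$ vanish) and tense (the mean curvature vector field $\tau_g=\sum_{i\le m}(\nabla^g_{e_i}e_i)^\perp$ of the leaves is foliated: $[v,\tau_g]$ is tangent to $\mathcal F$ for every vector field $v$ tangent to $\mathcal F$). Let $\widetilde X\to X$ be the universal cover, equipped with the lifts $\widetilde{\mathcal F},\widetilde g$ of $\mathcal F,g$. Let $(Y,h)$ be a Riemannian manifold and $\rho:\pi_1(X)\to\mathrm{Isom}(Y)$ a representation, $\pi_1(X)$ being seen as the group of deck transformations of $\widetilde X$. Let $t_0>0$, $I=[0,t_0]$, and let $F:I\times\widetilde X\to Y$ be a smooth map such that every $f_t=F(t,\cdot)$ is $\rho$-equivariant and $$\frac{\partial f_t}{\partial t}=\tau(f_t),$$ where $\tau(f_t)=\mathrm{Trace}(\nabla df_t)$ is the tension field. Let $$e_T(x,t)=\tfrac12\sum_{i\le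 m}|{f_t}_*e_i|_h^2,$$ where $(e_i)_{i\le m}$ is any orthonormal basis of $\widetilde{\mathcal F}_x$, be the tangential energy density, and let $\Delta^g=-\mathrm{div}\,\mathrm{grad}$. Then $e_T$ is smooth on $I\times\widetilde X$ and: 1. There is a constant $C>0$ such that on all of $I\times\widetilde X$ $$\Big(\frac{\partial}{\partial t}+\Delta^g\Big)e_T\le C\,e_T .$$ 2. On $I\times\widetilde X$ one has $$\Big(\frac{\partial}{\partial t}+\Delta^g\Big)e_T=-\mathrm{Ric}_{\widetilde X}({f_t}_*^T,{f_t}_*^T)+\mathrm{Riem}_Y({f_t}_*^T,{f_t}_*,{f_t}_*,{f_t}_*^T)-\big|\nabla^{\mathcal F,\mathcal F^\perp}{f_t}_*^T+\nabla^{\mathcal F^\perp,\mathcal F}{f_t}_*^T\big|^2-\big|\nabla^{\mathcal F,\mathcal F}{f_t}_*^T\big|^2+\big|\nabla^{\mathcal F^\perp,\mathcal F^\perp}{f_t}_*^T\big|^2+2\big|\nabla^{\mathcal F^\perp,\mathcal F}{f_t}_*^T\big|^2 .$$ Here ${f_t}_*^T$ is the restriction of ${f_t}_*$ to $\widetilde{\mathcal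 F}$, extended by $0$ to $\widetilde{\mathcal F}^\perp$. Let $\widetilde\nabla$ be the connection on $f_t^*TY\otimes T^*\widetilde X$ induced by $f_t^*\nabla^h$ and $\nabla^{\widetilde g}$, and $B(v,w)=(\widetilde\nabla_w{f_t}_*^T)(v)$. For $A,A'\in\{\mathcal F,\mathcal F^\perp\}$, $\nabla^{A,A'}{f_t}_*^T$ is the component of $B$ with $v$ in $A$ and $w$ in $A'$; in the sum, $\nabla^{\mathcal F,\mathcal F^\perp}{f_t}_*^T$ is regarded as a section of $f_t^*TY\otimes\widetilde{\mathcal F}^{\perp*}\otimes\widetilde{\mathcal F}^*$ by exchanging the two arguments. With an orthonormal frame $(e_i)_{i\le m+n}$ whose first $m$ vectors span $\widetilde{\mathcal F}$, $R(u,v)=\nabla_u\nabla_v-\nabla_v\nabla_u-\nabla_{[u,v]}$ and $\mathrm{Ric}(u,v)=\sum_{l}\langle R(e_l,u)v,e_l\rangle$, $$\mathrm{Ric}_{\widetilde X}({f_t}_*^T,{f_t}_*^T)=\sum_{i,k\le m}\mathrm{Ric}_{\widetilde X}(e_k,e_i)\langle{f_t}_*e_k,{f_t}_*e_i\rangle_h,$$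 $$\mathrm{Riem}_Y({f_t}_*^T,{f_t}_*,{f_t}_*,{f_t}_*^T)=\sum_{i\le m,\ k\le m+n}\langle R_Y({f_t}_*e_i,{f_t}_*e_k){f_t}_*e_k,{f_t}_*e_i\rangle_h .$$ -/

import Mathlib

open scoped Manifold ContDiff

noncomputable section

namespace TangentialEnergy

/-! ### Linear algebra of an inner product `b` on `ℝ^d` -/

/-- Gram matrix of a bilinear form in the standard basis. -/
def gramMatrix {d : ℕ}
    (b : EuclideanSpace ℝ (Fin d) →L[ℝ] EuclideanSpace ℝ (Fin d) →L[ℝ] ℝ) :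
    Matrix (Fin d) (Fin d) ℝ :=
  Matrix.of fun i j => b (EuclideanSpace.single i 1) (EuclideanSpace.single j 1)

/-- The metric trace `∑ᵢⱼ bⁱʲ B(∂ᵢ, ∂ⱼ)` of a bilinear map `B` with respect to the inner product
`b`; it equals `∑ᵢ B(eᵢ, eᵢ)` for any `b`-orthonormal basis `(eᵢ)`. -/
def metricTrace {d : ℕ} {V : Type*} [AddCommGroup V] [Module ℝ V]
    (b : EuclideanSpace ℝ (Fin d) →L[ℝ] EuclideanSpace ℝ (Fin d) →L[ℝ] ℝ)
    (B : EuclideanSpace ℝ (Fin d) → EuclideanSpace ℝ (Fin d) → V) : V :=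
  ∑ i, ∑ j, (gramMatrix b)⁻¹ i j • B (EuclideanSpace.single i 1) (EuclideanSpace.single j 1)

/-- The vector dual to the linear form `l`, that is `b (sharp b l) w = l w` for all `w`. -/
def sharp {d : ℕ} (b : EuclideanSpace ℝ (Fin d) →L[ℝ] EuclideanSpace ℝ (Fin d) →L[ℝ] ℝ)
    (l : EuclideanSpace ℝ (Fin d) → ℝ) : EuclideanSpace ℝ (Fin d) :=
  metricTrace b fun v w => l w • v

/-- The `b`-orthogonal complement of `S`. -/
def orthCompl {d : ℕ} (b : EuclideanSpace ℝ (Fin d) →L[ℝ] EuclideanSpace ℝ (Fin d) →L[ℝ] ℝ)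
    (S : Submodule ℝ (EuclideanSpace ℝ (Fin d))) : Submodule ℝ (EuclideanSpace ℝ (Fin d)) where
  carrier := {v | ∀ w ∈ S, b w v = 0}
  add_mem' := by
    intro v v' hv hv' w hw
    rw [map_add, hv w hw, hv' w hw, add_zero]
  zero_mem' := by
    intro w _
    exact map_zero _
  smul_mem' := by
    intro c v hv w hw
    rw [map_smul, hv w hw, smul_zero]

open Classical in
/-- The `b`-orthogonal projection onto `S`. (For an inner product `b` the two subspaces are
always complementary, so that the second case does not occur.) -/
def orthProj {d : ℕ} (b : EuclideanSpace ℝ (Fin d) →L[ℝ] EuclideanSpace ℝ (Fin d) →L[ℝ] ℝ)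
    (S : Submodule ℝ (EuclideanSpace ℝ (Fin d))) :
    EuclideanSpace ℝ (Fin d) →ₗ[ℝ] EuclideanSpace ℝ (Fin d) :=
  if hS : IsCompl S (orthCompl b S) then S.projection (orthCompl b S) hS else 0

/-- The squared norm `∑ₐₖ |S(eₐ, eₖ)|²` of a bilinear map with values in a space with inner
product `c`, the sum being over a `b`-orthonormal basis. -/
def normSq₂ {d q : ℕ} (b : EuclideanSpace ℝ (Fin d) →L[ℝ] EuclideanSpace ℝ (Fin d) →L[ℝ] ℝ)
    (c : EuclideanSpace ℝ (Fin q) →L[ℝ] EuclideanSpace ℝ (Fin q) →L[ℝ] ℝ)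
    (S : EuclideanSpace ℝ (Fin d) → EuclideanSpace ℝ (Fin d) → EuclideanSpace ℝ (Fin q)) : ℝ :=
  metricTrace b fun v v' => metricTrace b fun w w' => c (S v w) (S v' w')

/-! ### Riemannian geometry in coordinates

`G` is a metric on (an open part of) `ℝ^d`, `H` a metric on `ℝ^q`, `u` a map from `ℝ^d` to
`ℝ^q`. -/

namespace Coord

variable {d q : ℕ}
  (G : EuclideanSpace ℝ (Fin d) → EuclideanSpace ℝ (Fin d) →L[ℝ] EuclideanSpace ℝ (Fin d) →L[ℝ] ℝ)
  (H : EuclideanSpace ℝ (Fin q) → EuclideanSpace ℝ (Fin q) →L[ℝ] EuclideanSpace ℝ (Fin q) →L[ℝ] ℝ)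
  (u : EuclideanSpace ℝ (Fin d) → EuclideanSpace ℝ (Fin q))

/-- The Christoffel symbols `Γ_z(v, w)` of the Levi-Civita connection of `G`. -/
def christoffel (z v w : EuclideanSpace ℝ (Fin d)) : EuclideanSpace ℝ (Fin d) :=
  sharp (G z) fun a =>
    (1 / 2 : ℝ) * (fderiv ℝ (fun y => G y w a) z v + fderiv ℝ (fun y => G y v a) z w
      - fderiv ℝ (fun y => G y v w) z a)

/-- The Levi-Civita covariant derivative `(∇_w V)(z)`. -/
def covDeriv (V : EuclideanSpace ℝ (Fin d) → EuclideanSpace ℝ (Fin d))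
    (z w : EuclideanSpace ℝ (Fin d)) : EuclideanSpace ℝ (Fin d) :=
  fderiv ℝ V z w + christoffel G z w (V z)

/-- The curvature tensor `R(v, w)a = ∇_v ∇_w a - ∇_w ∇_v a - ∇_[v,w] a`. -/
def curvature (z v w a : EuclideanSpace ℝ (Fin d)) : EuclideanSpace ℝ (Fin d) :=
  fderiv ℝ (fun y => christoffel G y w a) z v - fderiv ℝ (fun y => christoffel G y v a) z w
    + christoffel G z v (christoffel G z w a) - christoffel G z w (christoffel G z v a)

/-- The Ricci tensor `Ric(v, w) = ∑ₗ ⟨R(eₗ, v)w, eₗ⟩`. -/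
def ricci (z v w : EuclideanSpace ℝ (Fin d)) : ℝ :=
  metricTrace (G z) fun a b => G z (curvature G z a v w) b

/-- The gradient of a function. -/
def gradient (φ : EuclideanSpace ℝ (Fin d) → ℝ) (z : EuclideanSpace ℝ (Fin d)) :
    EuclideanSpace ℝ (Fin d) :=
  sharp (G z) fun w => fderiv ℝ φ z w

/-- The divergence of a vector field, that is the trace of `w ↦ ∇_w V`. -/
def divergence (V : EuclideanSpace ℝ (Fin d) → EuclideanSpace ℝ (Fin d))
    (z : EuclideanSpace ℝ (Fin d)) : ℝ :=
  metricTrace (G z) fun a b => G z (covDeriv G V z a) b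

/-- The Laplace–Beltrami operator with the sign `Δφ = -div(grad φ)`. -/
def laplacian (φ : EuclideanSpace ℝ (Fin d) → ℝ) (z : EuclideanSpace ℝ (Fin d)) : ℝ :=
  -divergence G (gradient G φ) z

/-- For a section `s` of `u^*(Tℝ^q)`, the derivative `(∇_w s)(z)` for the pull-back by `u` of the
Levi-Civita connection of `H`. -/
def pullbackCovDeriv (s : EuclideanSpace ℝ (Fin d) → EuclideanSpace ℝ (Fin q))
    (z w : EuclideanSpace ℝ (Fin d)) : EuclideanSpace ℝ (Fin q) :=
  fderiv ℝ s z w + christoffel H (u z) (fderiv ℝ u z w) (s z)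

/-- For a section `α` of `u^*(Tℝ^q) ⊗ T^*ℝ^d`, the value `(∇̃_w α)(v)` at `z` of the tensor product
connection: the first argument `v` is the one of `α`, the second one `w` is the direction of
differentiation. -/
def covDerivOneForm
    (α : EuclideanSpace ℝ (Fin d) → EuclideanSpace ℝ (Fin d) → EuclideanSpace ℝ (Fin q))
    (z v w : EuclideanSpace ℝ (Fin d)) : EuclideanSpace ℝ (Fin q) :=
  pullbackCovDeriv H u (fun y => α y v) z w - α z (christoffel G z w v)

/-- The tension field `Trace (∇ du)`. -/
def tension (z : EuclideanSpace ℝ (Fin d)) : EuclideanSpace ℝ (Fin q) :=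
  metricTrace (G z) fun v w => covDerivOneForm G H u (fun y a => fderiv ℝ u y a) z v w

/-- The covariant derivative of the restriction of `du` to the distribution `D`, seen as
a one-form on the whole tangent space through the orthogonal projection onto `D`. -/
def covDerivTangential
    (D : EuclideanSpace ℝ (Fin d) → Submodule ℝ (EuclideanSpace ℝ (Fin d)))
    (z v w : EuclideanSpace ℝ (Fin d)) : EuclideanSpace ℝ (Fin q) :=
  covDerivOneForm G H u (fun y a => fderiv ℝ u y (orthProj (G y) (D y) a)) z v w

/-- The mean curvature vector `∑ᵢ (∇_{eᵢ} eᵢ)^⊥` of the distribution `D`, the sum being over an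
orthonormal frame of `D`: the trace of the second fundamental form. -/
def meanCurvature (D : EuclideanSpace ℝ (Fin d) → Submodule ℝ (EuclideanSpace ℝ (Fin d)))
    (z : EuclideanSpace ℝ (Fin d)) : EuclideanSpace ℝ (Fin d) :=
  metricTrace (G z) fun v w =>
    covDeriv G (fun y => orthProj (G y) (D y) w) z (orthProj (G z) (D z) v)
      - orthProj (G z) (D z)
          (covDeriv G (fun y => orthProj (G y) (D y) w) z (orthProj (G z) (D z) v))

end Coord

/-! ### Tensors on manifolds

The tensors and operators at a point `x` are computed in the preferred chart at `x`. In Mathlib the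
tangent space at `x` is, by definition, the model space `ℝ^d`, the identification being the
differential at `x` of that chart. -/

/-- Fields of bilinear forms on the tangent spaces. -/
abbrev FormField (d : ℕ) (M : Type*) [TopologicalSpace M]
    [ChartedSpace (EuclideanSpace ℝ (Fin d)) M] : Type _ :=
  ∀ x : M, TangentSpace (𝓡 d) x →L[ℝ] TangentSpace (𝓡 d) x →L[ℝ] ℝ

/-- Fields of subspaces of the tangent spaces. -/
abbrev Distribution (d : ℕ) (M : Type*) [TopologicalSpace M]
    [ChartedSpace (EuclideanSpace ℝ (Fin d)) M] : Type _ :=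
  ∀ x : M, Submodule ℝ (TangentSpace (𝓡 d) x)

/-- Smooth Riemannian metrics on a manifold of dimension `d`. -/
abbrev Metric (d : ℕ) (M : Type*) [TopologicalSpace M]
    [ChartedSpace (EuclideanSpace ℝ (Fin d)) M] [IsManifold (𝓡 d) ∞ M] : Type _ :=
  Bundle.ContMDiffRiemannianMetric (𝓡 d) ∞ (EuclideanSpace ℝ (Fin d))
    (fun x : M => TangentSpace (𝓡 d) x)

section Manifolds

variable {d q : ℕ}
  {M : Type*} [TopologicalSpace M] [ChartedSpace (EuclideanSpace ℝ (Fin d)) M]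
  {N : Type*} [TopologicalSpace N] [ChartedSpace (EuclideanSpace ℝ (Fin q)) N]

/-- Pull-back `(θ^*g)(v, w) = g(θ_* v, θ_* w)`. -/
def pullbackForm (θ : M → N) (g : FormField q N) : FormField d M :=
  fun x => ContinuousLinearMap.bilinearComp (E := EuclideanSpace ℝ (Fin q))
    (F := EuclideanSpace ℝ (Fin q)) (E' := EuclideanSpace ℝ (Fin d))
    (F' := EuclideanSpace ℝ (Fin d)) (g (θ x))
    (mfderiv (𝓡 d) (𝓡 q) θ x) (mfderiv (𝓡 d) (𝓡 q) θ x)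

/-- Pull-back of a distribution: the vectors whose image by `θ_*` is in `D`. -/
def pullbackDistribution (θ : M → N) (D : Distribution q N) : Distribution d M :=
  fun x => (D (θ x)).comap (mfderiv (𝓡 d) (𝓡 q) θ x).toLinearMap

/-- The coordinate expression of `g` in the preferred chart at `x`. -/
def chartForm (g : FormField d M) (x : M) :
    EuclideanSpace ℝ (Fin d) → EuclideanSpace ℝ (Fin d) →L[ℝ] EuclideanSpace ℝ (Fin d) →L[ℝ] ℝ :=
  pullbackForm (M := EuclideanSpace ℝ (Fin d)) (extChartAt (𝓡 d) x).symm g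

/-- The coordinate expression of `D` in the preferred chart at `x`. -/
def chartDistribution (D : Distribution d M) (x : M) :
    EuclideanSpace ℝ (Fin d) → Submodule ℝ (EuclideanSpace ℝ (Fin d)) :=
  pullbackDistribution (M := EuclideanSpace ℝ (Fin d)) (extChartAt (𝓡 d) x).symm D

/-- The orthogonal projection of `T_xM` onto `D_x`. -/
def tangentProj (g : FormField d M) (D : Distribution d M) (x : M) :
    TangentSpace (𝓡 d) x →ₗ[ℝ] TangentSpace (𝓡 d) x :=
  orthProj (g x) (D x)

/-- The orthogonal projection of `T_xM` onto the orthogonal complement of `D_x`. -/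
def normalProj (g : FormField d M) (D : Distribution d M) (x : M) :
    TangentSpace (𝓡 d) x →ₗ[ℝ] TangentSpace (𝓡 d) x :=
  LinearMap.id - tangentProj g D x

/-- The curvature tensor `R(v, w)a`. -/
def curvature (g : FormField d M) (x : M) (v w a : TangentSpace (𝓡 d) x) :
    TangentSpace (𝓡 d) x :=
  Coord.curvature (chartForm g x) (extChartAt (𝓡 d) x x) v w a

/-- The Ricci tensor. -/
def ricci (g : FormField d M) (x : M) (v w : TangentSpace (𝓡 d) x) : ℝ :=
  Coord.ricci (chartForm g x) (extChartAt (𝓡 d) x x) v w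

/-- The Laplace–Beltrami operator `Δφ = -div(grad φ)`. -/
def laplaceBeltrami (g : FormField d M) (φ : M → ℝ) (x : M) : ℝ :=
  Coord.laplacian (chartForm g x) (φ ∘ (extChartAt (𝓡 d) x).symm) (extChartAt (𝓡 d) x x)

/-- The mean curvature vector field of (the leaves of) `D`. -/
def meanCurvature (g : FormField d M) (D : Distribution d M) (x : M) : TangentSpace (𝓡 d) x :=
  Coord.meanCurvature (chartForm g x) (chartDistribution D x) (extChartAt (𝓡 d) x x)

/-- The tension field of a map `f : (M, g) → (N, h)`. -/
def tensionField (g : FormField d M) (h : FormField q N) (f : M → N) (x : M) :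
    TangentSpace (𝓡 q) (f x) :=
  Coord.tension (chartForm g x) (chartForm h (f x)) (writtenInExtChartAt (𝓡 d) (𝓡 q) x f)
    (extChartAt (𝓡 d) x x)

/-- The tangential differential `f_*^T`, extended by zero to the orthogonal complement of `D`. -/
def tangentialDifferential (g : FormField d M) (D : Distribution d M) (f : M → N) (x : M)
    (v : TangentSpace (𝓡 d) x) : TangentSpace (𝓡 q) (f x) :=
  mfderiv (𝓡 d) (𝓡 q) f x (tangentProj g D x v)

/-- The tangential energy density `e_T(f) = ½ ‖f_*^T‖² = ½ ∑ᵢ |f_* eᵢ|²`, the sum being over an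
orthonormal basis of `D_x`. -/
def tangentialEnergy (g : FormField d M) (D : Distribution d M) (h : FormField q N) (f : M → N)
    (x : M) : ℝ :=
  (1 / 2 : ℝ) * metricTrace (d := d) (g x) fun v w =>
    h (f x) (tangentialDifferential g D f x v) (tangentialDifferential g D f x w)

/-- The value `(∇̃_w f_*^T)(v)` of the covariant derivative of the tangential differential. -/
def covDerivTangential (g : FormField d M) (D : Distribution d M) (h : FormField q N) (f : M → N)
    (x : M) (v w : TangentSpace (𝓡 d) x) : TangentSpace (𝓡 q) (f x) :=
  Coord.covDerivTangential (chartForm g x) (chartForm h (f x))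
    (writtenInExtChartAt (𝓡 d) (𝓡 q) x f) (chartDistribution D x) (extChartAt (𝓡 d) x x) v w

/-- The extension of the Ricci tensor to `T_yN ⊗ T_x^*M`:
`Ric(s₁ ⊗ t₁, s₂ ⊗ t₂) = ⟨s₁, s₂⟩ Ric(t₁, t₂)`, that is `∑ₐₖ Ric(eₐ, eₖ) ⟨α eₐ, β eₖ⟩`. -/
def ricciPairing (g : FormField d M) (h : FormField q N) (x : M) (y : N)
    (α β : TangentSpace (𝓡 d) x → TangentSpace (𝓡 q) y) : ℝ :=
  metricTrace (d := d) (g x) fun v v' => metricTrace (d := d) (g x) fun w w' =>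
    ricci g x v w * h y (α v') (β w')

/-- The extension of the curvature tensor to `T_yN ⊗ T_x^*M`:
`Riem(α₁, α₂, α₃, α₄) = ∑ₐₖ ⟨R(α₁ eₐ, α₂ eₖ) α₃ eₖ, α₄ eₐ⟩`. -/
def riemPairing (g : FormField d M) (h : FormField q N) (x : M) (y : N)
    (α₁ α₂ α₃ α₄ : TangentSpace (𝓡 d) x → TangentSpace (𝓡 q) y) : ℝ :=
  metricTrace (d := d) (g x) fun v v' => metricTrace (d := d) (g x) fun w w' =>
    h y (curvature h y (α₁ v) (α₂ w) (α₃ w')) (α₄ v')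

/-- The right-hand side of the Eells–Sampson type formula. With `B(v, w) = (∇̃_w f_*^T)(v)`, `P` and
`Q` the orthogonal projections onto `D` and its orthogonal complement, the components of `B` are
`∇^{D,D} = B(P·, P·)`, `∇^{D^⊥,D^⊥} = B(Q·, Q·)`, `∇^{D^⊥,D} = B(Q·, P·)` and
`∇^{D,D^⊥} = B(P·, Q·)`; the last one is added to the third one after exchanging its
arguments. -/
def eellsSampsonTerm (g : FormField d M) (D : Distribution d M) (h : FormField q N) (f : M → N)
    (x : M) : ℝ :=
  let P := tangentProj g D x
  let Q := normalProj g D x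
  let B := covDerivTangential g D h f x
  let df := fun v : TangentSpace (𝓡 d) x => mfderiv (𝓡 d) (𝓡 q) f x v
  let dT := tangentialDifferential g D f x
  riemPairing g h x (f x) dT df df dT - ricciPairing g h x (f x) dT dT
    - normSq₂ (d := d) (q := q) (g x) (h (f x)) (fun v w => B (P w) (Q v) + B (Q v) (P w))
    - normSq₂ (d := d) (q := q) (g x) (h (f x)) (fun v w => B (P v) (P w))
    + normSq₂ (d := d) (q := q) (g x) (h (f x)) (fun v w => B (Q v) (Q w))
    + 2 * normSq₂ (d := d) (q := q) (g x) (h (f x)) (fun v w => B (Q v) (P w))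

/-! ### Foliations -/

/-- Smooth vector fields. -/
def IsSmoothField [IsManifold (𝓡 d) ∞ M] (V : ∀ x : M, TangentSpace (𝓡 d) x) : Prop :=
  ContMDiff (𝓡 d) (𝓡 d).tangent ∞ fun x => (⟨x, V x⟩ : TangentBundle (𝓡 d) M)

/-- `D` is the tangent distribution of a smooth foliation of rank `m` and codimension `n`: around
every point there is a chart `(x₁, …, xₘ, y₁, …, yₙ)` in which `D` is `dy₁ = ⋯ = dyₙ = 0`. -/
def IsFoliation (m n : ℕ) {X : Type*} [TopologicalSpace X]
    [ChartedSpace (EuclideanSpace ℝ (Fin (m + n))) X] (D : Distribution (m + n) X) : Prop :=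
  ∀ x : X, ∃ φ ∈ IsManifold.maximalAtlas (𝓡 (m + n)) ∞ X, x ∈ φ.source ∧
    ∀ y ∈ φ.source, ∀ v : TangentSpace (𝓡 (m + n)) y, v ∈ D y ↔
      ∀ j : Fin n, (EuclideanSpace.proj (Fin.natAdd m j) : EuclideanSpace ℝ (Fin (m + n)) →L[ℝ] ℝ)
        (mfderiv (𝓡 (m + n)) (𝓡 (m + n)) φ y v) = 0

/-- The vector field `W` is foliated: `[V, W]` is tangent to `D` for all `V` tangent to `D`. -/
def IsFoliatedField [IsManifold (𝓡 d) ∞ M] (D : Distribution d M) (W : ∀ x : M, TangentSpace (𝓡 d) x) : Prop :=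
  ∀ V : ∀ x : M, TangentSpace (𝓡 d) x, IsSmoothField V → (∀ x, V x ∈ D x) →
    ∀ x, VectorField.mlieBracket (𝓡 d) V W x ∈ D x

/-- The symmetric form `g(v^⊥, w^⊥)`, that is the metric induced by `g` on the normal bundle
`TM / D`. -/
def transverseForm (g : FormField d M) (D : Distribution d M) (x : M)
    (v w : TangentSpace (𝓡 d) x) : ℝ :=
  g x (normalProj g D x v) (normalProj g D x w)

/-- `g` is bundle-like for the foliation `D`: the transverse metric that it induces is basic, i.e.
its Lie derivatives in the directions tangent to `D` vanish. -/
def IsBundleLike [IsManifold (𝓡 d) ∞ M] (g : FormField d M) (D : Distribution d M) : Prop :=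
  ∀ V U W : ∀ x : M, TangentSpace (𝓡 d) x,
    IsSmoothField V → IsSmoothField U → IsSmoothField W → (∀ x, V x ∈ D x) → ∀ x,
      (mfderiv (𝓡 d) 𝓘(ℝ, ℝ) (fun y => transverseForm g D y (U y) (W y)) x (V x) : ℝ)
        = transverseForm g D x (VectorField.mlieBracket (𝓡 d) V U x) (W x)
          + transverseForm g D x (U x) (VectorField.mlieBracket (𝓡 d) V W x)

end Manifolds

/-! ### Deck transformations and isometries -/

/-- The group of deck transformations of `p`. -/
def deckGroup {E X : Type*} [TopologicalSpace E] (p : E → X) : Subgroup (E ≃ₜ E) where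
  carrier := {γ | ∀ x, p (γ x) = p x}
  mul_mem' := by
    intro γ γ' h h' x
    exact (h (γ' x)).trans (h' x)
  one_mem' := fun _ => rfl
  inv_mem' := by
    intro γ h x
    have := h (γ.symm x)
    rw [Homeomorph.apply_symm_apply] at this
    exact this.symm

/-- The isometry group of a Riemannian manifold: the diffeomorphisms that preserve the metric. -/
def isometryGroup {q : ℕ} {Y : Type*} [TopologicalSpace Y]
    [ChartedSpace (EuclideanSpace ℝ (Fin q)) Y] (h : FormField q Y) : Subgroup (Y ≃ₜ Y) where
  carrier := {φ | ContMDiff (𝓡 q) (𝓡 q) ∞ φ ∧ ContMDiff (𝓡 q) (𝓡 q) ∞ φ.symm ∧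
    ∀ (y : Y) (v w : TangentSpace (𝓡 q) y),
      h (φ y) (mfderiv (𝓡 q) (𝓡 q) φ y v) (mfderiv (𝓡 q) (𝓡 q) φ y w) = h y v w}
  mul_mem' := by
    rintro φ φ' ⟨a, b, c⟩ ⟨a', b', c'⟩
    refine ⟨a.comp a', b'.comp b, fun y v w => ?_⟩
    have e : mfderiv (𝓡 q) (𝓡 q) (φ ∘ φ') y
        = (mfderiv (𝓡 q) (𝓡 q) φ (φ' y)).comp (mfderiv (𝓡 q) (𝓡 q) φ' y) :=
      mfderiv_comp y ((a (φ' y)).mdifferentiableAt (by simp))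
        ((a' y).mdifferentiableAt (by simp))
    change h (φ (φ' y)) (mfderiv (𝓡 q) (𝓡 q) (φ ∘ φ') y v)
      (mfderiv (𝓡 q) (𝓡 q) (φ ∘ φ') y w) = _
    rw [e]
    exact (c (φ' y) _ _).trans (c' y v w)
  one_mem' := by
    refine ⟨contMDiff_id, contMDiff_id, fun y v w => ?_⟩
    change h y (mfderiv (𝓡 q) (𝓡 q) id y v) (mfderiv (𝓡 q) (𝓡 q) id y w) = _
    rw [mfderiv_id]
    rfl
  inv_mem' := by
    rintro φ ⟨a, b, c⟩
    refine ⟨b, a, fun y v w => ?_⟩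
    have e : (mfderiv (𝓡 q) (𝓡 q) φ (φ.symm y)).comp (mfderiv (𝓡 q) (𝓡 q) φ.symm y)
        = ContinuousLinearMap.id ℝ (TangentSpace (𝓡 q) y) := by
      rw [← mfderiv_comp y ((a _).mdifferentiableAt (by simp))
        ((b y).mdifferentiableAt (by simp))]
      have : (φ ∘ φ.symm : Y → Y) = id := by
        funext z
        simp
      rw [this, mfderiv_id]
    have k := c (φ.symm y) (mfderiv (𝓡 q) (𝓡 q) φ.symm y v) (mfderiv (𝓡 q) (𝓡 q) φ.symm y w)
    have ev : ∀ v, mfderiv (𝓡 q) (𝓡 q) φ (φ.symm y) (mfderiv (𝓡 q) (𝓡 q) φ.symm y v) = v :=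
      fun v => congrArg (fun L => L v) e
    rw [ev, ev, φ.apply_symm_apply] at k
    exact k.symm

end TangentialEnergy

end

noncomputable section

set_option maxSynthPendingDepth 5

namespace TangentialEnergy

/-! Write P for the orthogonal projection onto the distribution, A = df and α = A ∘ P, so that e_T =
½|α|². The geometry of the foliation is carried by ∇P (`covP`). Differentiating P² = P shows that ∇P
exchanges the distribution and its complement: (∇_w P)v is the normal part of ∇_w v for a tangential
field v, and minus its tangential part for a normal one. Thus integrability means that ∇P is
symmetric on tangential vectors, and being bundle-like that it is skew on normal vectors. Being
tense is a condition on the derivative of the trace of the tangential block of ∇P, which is the mean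
curvature. These are the fields of `IsTenseOn`.

The formula. Time and space derivatives commute and the Levi-Civita connections are torsion free, so
∂_t e_T = ⟨∇τ(f) ∘ P, α⟩, while −Δe_T = ⟨tr ∇²α, α⟩ + |∇α|². For e_i tangential, the Leibniz rule
`cov2_comp` gives tr ∇²α (e_i) = Σ_a (∇²_{a,a}A)(e_i) + 2 Σ_a (∇_a A)((∇_a P)e_i) + A((tr ∇²P) e_i).
The symmetry of ∇A and the Ricci identity `cov2_comm` turn the first sum into ∇_{e_i}τ(f) plus
curvature, as in the argument of Eells and Sampson. The new ingredient is tr ∇²P. Its tangential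
part is −2 Σ_a (∇_a P)², from P² = P differentiated twice. Its normal part is governed by
`IsTenseOn.mixed`: the sum of ⟨(tr ∇²P)e_i, e_j⟩ and of the mixed Ricci curvature Ric(e_i, e_j) is
merely quadratic in ∇P. Integrability and tenseness give this for the leafwise half of the trace,
and the bundle-like condition gives it for the transverse half. In `bochner_algebra` the mixed Ricci
terms then cancel, the products of two factors ∇P cancel against part of the middle sum, and the
remaining squares assemble into the stated right-hand side.

The inequality. The negative squares are dropped. For v normal, (∇_w α)(v) = A((∇_w P)v) = α((∇_w
P)v), so the two positive squares are quadratic in α, as are the curvature terms. A continuous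
family of quadratic forms is locally bounded by a multiple of a positive definite one
(`IsQuad.exists_bound`), which yields a locally uniform constant. The density and the heat operator
applied to it are invariant under deck transformations, these act transitively on the fibres, and
the time interval and X are compact; hence one constant serves everywhere
(`exists_forall_of_deckGroup`).

From coordinates to manifolds. Every tensor is computed in the preferred chart at its own point,
whereas differentiating requires one chart on a whole neighbourhood. The two are reconciled by
naturality under local isometries, which rests on the vanishing of their second fundamental form
(`IsIsom.cov1_fderiv`). A chart of the cover followed by the projection is a parametrization of X,
so the hypotheses on X apply directly through `IsParam.isTenseOn`. -/

/-- The model space `ℝ^d`. -/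
abbrev Euc (d : ℕ) : Type := EuclideanSpace ℝ (Fin d)

/-- A symmetric positive definite bilinear form. -/
def IsInner {d : ℕ} (b : Euc d →L[ℝ] Euc d →L[ℝ] ℝ) : Prop :=
  (∀ v w, b v w = b w v) ∧ ∀ v, v ≠ 0 → 0 < b v v

/-- Bilinearity of a function of two variables. -/
structure Bilin {E V : Type*} [AddCommGroup E] [Module ℝ E] [AddCommGroup V] [Module ℝ V]
    (B : E → E → V) : Prop where
  add_left : ∀ v v' w, B (v + v') w = B v w + B v' w
  smul_left : ∀ (c : ℝ) v w, B (c • v) w = c • B v w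
  add_right : ∀ v w w', B v (w + w') = B v w + B v w'
  smul_right : ∀ (c : ℝ) v w, B v (c • w) = c • B v w

namespace Bilin

variable {E V : Type*} [AddCommGroup E] [Module ℝ E] [AddCommGroup V] [Module ℝ V]
  {B : E → E → V}

/-- The bundled bilinear map. -/
def toLin (hB : Bilin B) : E →ₗ[ℝ] E →ₗ[ℝ] V :=
  LinearMap.mk₂ ℝ B hB.add_left hB.smul_left hB.add_right hB.smul_right

theorem toLin_apply (hB : Bilin B) (v w : E) : hB.toLin v w = B v w := rfl

end Bilin

/-! ### Linear algebra of an inner product: adapted bases, metric traces, orthogonal projections. -/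

section Basis

variable {d : ℕ} {V V' : Type*} [AddCommGroup V] [Module ℝ V] [AddCommGroup V'] [Module ℝ V']
  {b : Euc d →L[ℝ] Euc d →L[ℝ] ℝ}

/-- `e` is an orthonormal basis for `b`. -/
def IsOrtho {ι : Type*} [DecidableEq ι] (b : Euc d →L[ℝ] Euc d →L[ℝ] ℝ)
    (e : Module.Basis ι ℝ (Euc d)) : Prop :=
  ∀ a c, b (e a) (e c) = if a = c then 1 else 0

/-- The form itself is taken as inner product, on a bare vector space so that no given norm competes
with it. The basis joins orthonormal bases of `S` and of its orthogonal complement. -/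
theorem exists_adapted_basis_aux {F : Type*} [AddCommGroup F] [Module ℝ F] [FiniteDimensional ℝ F]
    (b : F →ₗ[ℝ] F →ₗ[ℝ] ℝ) (hs : ∀ v w, b v w = b w v) (hp : ∀ v, v ≠ 0 → 0 < b v v)
    (S : Submodule ℝ F) :
    ∃ (k l : ℕ) (e : Module.Basis (Fin k ⊕ Fin l) ℝ F),
      (∀ a c, b (e a) (e c) = if a = c then 1 else 0) ∧
      (∀ i, e (Sum.inl i) ∈ S) ∧ ∀ j, ∀ w ∈ S, b w (e (Sum.inr j)) = 0 := by
  let c : InnerProductSpace.Core ℝ F :=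
    { inner := fun v w => b v w
      conj_inner_symm := fun v w => by simpa using hs w v
      re_inner_nonneg := fun v => by
        by_cases h : v = 0
        · simp [h]
        · simpa using (hp v h).le
      add_left := fun x y z => by simp
      smul_left := fun x y r => by simp
      definite := fun v h => by
        by_contra h'
        exact (hp v h').ne' h }
  let _ : NormedAddCommGroup F := c.toNormedAddCommGroup
  let _ : InnerProductSpace ℝ F := InnerProductSpace.ofCore c.toCore
  have hin : ∀ v w : F, inner ℝ v w = b v w := fun v w => rfl
  let e₁ := stdOrthonormalBasis ℝ S
  let e₂ := stdOrthonormalBasis ℝ Sᗮ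
  let e := (e₁.prod e₂).map S.orthogonalDecomposition.symm
  refine ⟨_, _, e.toBasis, fun a c => ?_, fun i => ?_, fun j w hw => ?_⟩
  · have := orthonormal_iff_ite.1 e.orthonormal a c
    rw [hin] at this
    simpa using this
  · simp [e, Submodule.orthogonalDecomposition_symm_apply]
  · rw [← hin]
    have : (e.toBasis (Sum.inr j)) ∈ Sᗮ := by
      simp [e, Submodule.orthogonalDecomposition_symm_apply]
    exact this w hw

theorem exists_adapted_basis (hb : IsInner b) (S : Submodule ℝ (Euc d)) :
    ∃ (k l : ℕ) (e : Module.Basis (Fin k ⊕ Fin l) ℝ (Euc d)), IsOrtho b e ∧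
      (∀ i, e (Sum.inl i) ∈ S) ∧ ∀ j, e (Sum.inr j) ∈ orthCompl b S := by
  obtain ⟨k, l, e, h₁, h₂, h₃⟩ := exists_adapted_basis_aux
    (LinearMap.mk₂ ℝ (fun v w => b v w) (by simp) (by simp) (by simp) (by simp)) hb.1 hb.2 S
  exact ⟨k, l, e, h₁, h₂, h₃⟩

section Ortho

variable {ι : Type*} [Fintype ι] [DecidableEq ι] {e : Module.Basis ι ℝ (Euc d)}

theorem sum_smul_single (v : Euc d) : v = ∑ j, v j • EuclideanSpace.single j (1 : ℝ) := by
  ext l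
  simp [Pi.single_apply]

theorem IsOrtho.sum_smul (he : IsOrtho b e) (v : Euc d) : ∑ a, b (e a) v • e a = v := by
  have : ∀ a, b (e a) v = e.repr v a := by
    intro a
    conv_lhs => rw [← e.sum_repr v]
    simp only [map_sum, map_smul, he a, smul_eq_mul, mul_ite, mul_one, mul_zero,
      Finset.sum_ite_eq, Finset.mem_univ, if_true]
  simp_rw [this]
  exact e.sum_repr v

/-- Expanding the standard vectors in the orthonormal basis identifies Σ_a e_a e_aᵀ with the inverse
Gram matrix. This is the bridge from the definition of `metricTrace` to sums over orthonormal bases,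
and it gives invertibility of the Gram matrix. -/
theorem gram_left_inv (he : IsOrtho b e) :
    (Matrix.of fun i j : Fin d => ∑ a, (e a) i * (e a) j) * gramMatrix b = 1 := by
  ext i k
  have h1 := congrArg (fun v : Euc d => v i) (he.sum_smul (EuclideanSpace.single k 1))
  have h2 : ∀ a, b (e a) (EuclideanSpace.single k 1)
      = ∑ j, (e a) j * b (EuclideanSpace.single j 1) (EuclideanSpace.single k 1) := by
    intro a
    conv_lhs => rw [sum_smul_single (e a)]
    simp
  simp only [Matrix.mul_apply, Matrix.of_apply, gramMatrix, Finset.sum_mul]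
  rw [Finset.sum_comm]
  have h4 : ∀ a, ∑ j, (e a) i * (e a) j *
      b (EuclideanSpace.single j 1) (EuclideanSpace.single k 1)
      = b (e a) (EuclideanSpace.single k 1) * (e a) i := by
    intro a
    rw [h2, Finset.sum_mul]
    refine Finset.sum_congr rfl fun j _ => by ring
  simp_rw [h4]
  simp only [WithLp.ofLp_sum, WithLp.ofLp_smul, Finset.sum_apply, Pi.smul_apply,
    smul_eq_mul] at h1
  rw [h1]
  simp [Matrix.one_apply]

theorem gram_inv_apply (he : IsOrtho b e) (i j : Fin d) :
    (gramMatrix b)⁻¹ i j = ∑ a, (e a) i * (e a) j := by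
  rw [Matrix.inv_eq_left_inv (gram_left_inv he)]
  rfl

theorem Bilin.sum_single {B : Euc d → Euc d → V} (hB : Bilin B) (v w : Euc d) :
    B v w = ∑ i, ∑ j, (v i * w j) • B (EuclideanSpace.single i 1) (EuclideanSpace.single j 1) := by
  rw [← hB.toLin_apply]
  conv_lhs => rw [sum_smul_single v, sum_smul_single w]
  simp only [map_sum, LinearMap.sum_apply, map_smul, LinearMap.smul_apply, hB.toLin_apply,
    Finset.smul_sum, mul_smul]
  rw [Finset.sum_comm]
  refine Finset.sum_congr rfl fun i _ => Finset.sum_congr rfl fun j _ => ?_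
  rw [smul_comm]

/-- The basis is arbitrary, so identities between traces may be checked in one adapted to the
distribution. -/
theorem metricTrace_eq_sum (he : IsOrtho b e) {B : Euc d → Euc d → V}
    (hB : Bilin B) : metricTrace b B = ∑ a, B (e a) (e a) := by
  simp_rw [fun a => hB.sum_single (e a) (e a)]
  unfold metricTrace
  rw [Finset.sum_comm]
  simp_rw [gram_inv_apply he, Finset.sum_smul]
  rw [Finset.sum_comm]
  conv_rhs => rw [Finset.sum_comm]
  refine Finset.sum_congr rfl fun i _ => ?_
  conv_rhs => rw [Finset.sum_comm]

theorem exists_ortho (hb : IsInner b) :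
    ∃ (k : ℕ) (e : Module.Basis (Fin k) ℝ (Euc d)), IsOrtho b e := by
  obtain ⟨k, l, e, h, -⟩ := exists_adapted_basis hb ⊤
  refine ⟨k + l, e.reindex finSumFinEquiv, fun a c => ?_⟩
  rw [Module.Basis.reindex_apply, Module.Basis.reindex_apply, h]
  simp

end Ortho

theorem isUnit_det_gram (hb : IsInner b) : IsUnit (gramMatrix b).det := by
  obtain ⟨k, e, he⟩ := exists_ortho hb
  exact (Matrix.isUnit_iff_isUnit_det _).1 (IsUnit.of_mul_eq_one_right _ (gram_left_inv he))

theorem metricTrace_map (L : V →ₗ[ℝ] V') (B : Euc d → Euc d → V) :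
    L (metricTrace b B) = metricTrace b fun v w => L (B v w) := by
  simp [metricTrace]

theorem metricTrace_add (B B' : Euc d → Euc d → V) :
    metricTrace b (fun v w => B v w + B' v w) = metricTrace b B + metricTrace b B' := by
  simp [metricTrace, Finset.sum_add_distrib]

/-- The inverse Gram matrix is symmetric, whatever the function `B`. -/
theorem metricTrace_swap (hb : IsInner b) (B : Euc d → Euc d → V) :
    metricTrace b (fun v w => B w v) = metricTrace b B := by
  obtain ⟨k, e, he⟩ := exists_ortho hb
  unfold metricTrace
  rw [Finset.sum_comm]
  refine Finset.sum_congr rfl fun i _ => Finset.sum_congr rfl fun j _ => ?_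
  rw [gram_inv_apply he, gram_inv_apply he]
  simp_rw [mul_comm]

/-- Metric traces are invariant under linear isometries. -/
theorem metricTrace_comp {b' : Euc d →L[ℝ] Euc d →L[ℝ] ℝ} (hb : IsInner b)
    (L : Euc d →L[ℝ] Euc d) (hL : ∀ v w, b' (L v) (L w) = b v w) {B : Euc d → Euc d → V}
    (hB : Bilin B) : metricTrace b (fun v w => B (L v) (L w)) = metricTrace b' B := by
  obtain ⟨k, e, he⟩ := exists_ortho hb
  have inj : Function.Injective L := by
    rw [injective_iff_map_eq_zero]
    intro v hv
    by_contra h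
    have := hb.2 v h
    rw [← hL, hv] at this
    simp at this
  let L' : Euc d ≃ₗ[ℝ] Euc d := LinearEquiv.ofInjectiveEndo L.toLinearMap inj
  have hL' : ∀ v, L' v = L v := fun v => rfl
  have he' : IsOrtho b' (e.map L') := by
    intro a c
    rw [Module.Basis.map_apply, Module.Basis.map_apply, hL', hL', hL, he a c]
  rw [metricTrace_eq_sum he' hB, metricTrace_eq_sum he (e := e)]
  · simp [hL']
  · constructor <;> intros <;> simp [hB.add_left, hB.add_right, hB.smul_left, hB.smul_right]

theorem inner_sharp (hb : IsInner b) (l : Euc d →L[ℝ] ℝ) (w : Euc d) :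
    b (sharp b l) w = l w := by
  obtain ⟨k, e, he⟩ := exists_ortho hb
  have : sharp b l = ∑ a, l (e a) • e a :=
    metricTrace_eq_sum he (by
      constructor <;> intros
      · simp
      · rw [smul_comm]
      · rw [map_add, add_smul]
      · rw [map_smul, smul_assoc])
  rw [this]
  conv_rhs => rw [← he.sum_smul w]
  simp [mul_comm]

theorem IsInner.isCompl (hb : IsInner b) (S : Submodule ℝ (Euc d)) :
    IsCompl S (orthCompl b S) := by
  obtain ⟨k, l, e, he, h1, h2⟩ := exists_adapted_basis hb S
  constructor
  · rw [Submodule.disjoint_def]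
    intro v hv hv'
    by_contra h
    exact (hb.2 v h).ne' (hv' v hv)
  · rw [codisjoint_iff, eq_top_iff]
    intro v _
    rw [← he.sum_smul v, Fintype.sum_sum_type]
    exact Submodule.add_mem_sup (Submodule.sum_mem _ fun i _ => Submodule.smul_mem _ _ (h1 i))
      (Submodule.sum_mem _ fun i _ => Submodule.smul_mem _ _ (h2 i))

variable {S : Submodule ℝ (Euc d)}

theorem orthProj_mem (hb : IsInner b) (v : Euc d) : orthProj b S v ∈ S := by
  rw [orthProj, dif_pos (hb.isCompl S)]
  exact (Submodule.projectionOnto S _ (hb.isCompl S) v).2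

theorem orthProj_of_mem (hb : IsInner b) {v : Euc d} (hv : v ∈ S) : orthProj b S v = v := by
  rw [orthProj, dif_pos (hb.isCompl S)]
  exact Submodule.projection_apply_of_mem_left _ hv

theorem orthProj_of_mem_compl (hb : IsInner b) {v : Euc d} (hv : v ∈ orthCompl b S) :
    orthProj b S v = 0 := by
  rw [orthProj, dif_pos (hb.isCompl S)]
  exact (Submodule.projection_apply_eq_zero_iff _).2 hv

theorem sub_orthProj_mem (hb : IsInner b) (v : Euc d) : v - orthProj b S v ∈ orthCompl b S := by
  rw [orthProj, dif_pos (hb.isCompl S), ← Submodule.projection_apply_eq_zero_iff (hb.isCompl S),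
    map_sub, sub_eq_zero]
  exact (Submodule.projection_apply_of_mem_left _
    (Submodule.projectionOnto S _ (hb.isCompl S) v).2).symm

theorem orthProj_unique (hb : IsInner b) {v w : Euc d} (hw : w ∈ S) (hvw : v - w ∈ orthCompl b S) :
    orthProj b S v = w := by
  have h1 := orthProj_of_mem hb hw
  have h2 := orthProj_of_mem_compl hb hvw
  rw [map_sub, h1, sub_eq_zero] at h2
  exact h2

theorem orthProj_idem (hb : IsInner b) (v : Euc d) :
    orthProj b S (orthProj b S v) = orthProj b S v :=
  orthProj_of_mem hb (orthProj_mem hb v)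

theorem orthProj_symm (hb : IsInner b) (v w : Euc d) :
    b (orthProj b S v) w = b v (orthProj b S w) := by
  have h1 := sub_orthProj_mem (S := S) hb w _ (orthProj_mem hb v)
  have h2 := sub_orthProj_mem (S := S) hb v _ (orthProj_mem hb w)
  rw [map_sub, sub_eq_zero] at h1 h2
  rw [h1, hb.1 v, h2, hb.1]

/-- An isometry carrying `S` onto `S'` also carries complement to complement, so the image of the
projection has the two properties that characterise the projection of the image. -/
theorem orthProj_comp {b' : Euc d →L[ℝ] Euc d →L[ℝ] ℝ} (hb : IsInner b) (hb' : IsInner b')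
    (L : Euc d →L[ℝ] Euc d) (hL : ∀ v w, b' (L v) (L w) = b v w) (hs : Function.Surjective L)
    {S' : Submodule ℝ (Euc d)} (hS : ∀ v, v ∈ S ↔ L v ∈ S') (v : Euc d) :
    orthProj b' S' (L v) = L (orthProj b S v) := by
  refine orthProj_unique hb' ((hS _).1 (orthProj_mem hb v)) fun w hw => ?_
  obtain ⟨w, rfl⟩ := hs w
  rw [← map_sub, hL]
  exact sub_orthProj_mem hb v w ((hS w).2 hw)

theorem isometry_surjective {b' : Euc d →L[ℝ] Euc d →L[ℝ] ℝ} (hb : IsInner b)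
    (L : Euc d →L[ℝ] Euc d) (hL : ∀ v w, b' (L v) (L w) = b v w) : Function.Surjective L := by
  have inj : Function.Injective L.toLinearMap := by
    rw [injective_iff_map_eq_zero]
    intro v hv
    by_contra h
    have := hb.2 v h
    rw [← hL, show L v = 0 from hv] at this
    simp at this
  exact LinearMap.injective_iff_surjective.1 inj

end Basis

/-! ### Covariant derivatives of one-forms -/

section Calculus

variable {E W W' : Type*} [NormedAddCommGroup E] [NormedSpace ℝ E]
  [NormedAddCommGroup W] [NormedSpace ℝ W] [NormedAddCommGroup W'] [NormedSpace ℝ W']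

theorem fderiv_apply₁ {F : E → W →L[ℝ] W'} {s : E → W} {z : E} (hF : DifferentiableAt ℝ F z)
    (hs : DifferentiableAt ℝ s z) (w : E) :
    fderiv ℝ (fun y => F y (s y)) z w = fderiv ℝ F z w (s z) + F z (fderiv ℝ s z w) := by
  rw [fderiv_clm_apply hF hs]
  simp [add_comm]

theorem fderiv_apply_const {F : E → W →L[ℝ] W'} {z : E} (hF : DifferentiableAt ℝ F z) (s : W)
    (w : E) : fderiv ℝ (fun y => F y s) z w = fderiv ℝ F z w s := by
  rw [fderiv_apply₁ hF (differentiableAt_const _)]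
  simp

theorem fderiv_fderiv_symm {F : E → W} {z : E} (hF : ContDiffAt ℝ ∞ F z) (v w : E) :
    fderiv ℝ (fderiv ℝ F) z v w = fderiv ℝ (fderiv ℝ F) z w v :=
  (hF.isSymmSndFDerivAt (by
    rw [minSmoothness_of_isRCLikeNormedField]
    exact WithTop.coe_le_coe.2 le_top)).eq v w

theorem ContDiffAt.fderiv_infty {F : E → W} {z : E} (hF : ContDiffAt ℝ ∞ F z) :
    ContDiffAt ℝ ∞ (fderiv ℝ F) z :=
  hF.fderiv_right (by simp)

theorem ContDiffAt.diff {F : E → W} {z : E} (hF : ContDiffAt ℝ ∞ F z) : DifferentiableAt ℝ F z :=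
  hF.differentiableAt (by simp)

variable (Γ : E → E →L[ℝ] E →L[ℝ] E) (κ : E → E →L[ℝ] W →L[ℝ] W) (A : E → E →L[ℝ] W)

/-- The covariant derivative `∇_w s` of a section for the connection with form `κ`. -/
def nab (s : E → W) (z w : E) : W := fderiv ℝ s z w + κ z w (s z)

/-- The covariant derivative `(∇_w A)(v)` of a vector-valued one-form, `w` being the first
argument. -/
def cov1 (z : E) : E →L[ℝ] E →L[ℝ] W :=
  fderiv ℝ A z + ((ContinuousLinearMap.compL ℝ E W W).flip (A z)).comp (κ z)
    - (ContinuousLinearMap.compL ℝ E E W (A z)).comp (Γ z)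

theorem cov1_apply (z w v : E) :
    cov1 Γ κ A z w v = fderiv ℝ A z w v + κ z w (A z v) - A z (Γ z w v) := rfl

/-- The second covariant derivative `(∇²_{w', w} A)(v)`. -/
def cov2 (z w' w v : E) : W :=
  fderiv ℝ (cov1 Γ κ A) z w' w v + κ z w' (cov1 Γ κ A z w v) - cov1 Γ κ A z (Γ z w' w) v
    - cov1 Γ κ A z w (Γ z w' v)

/-- The curvature of the connection with form `κ`. -/
def curv (z v w : E) (s : W) : W :=
  fderiv ℝ κ z v w s - fderiv ℝ κ z w v s + κ z v (κ z w s) - κ z w (κ z v s)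

variable {Γ κ A} {z : E}

theorem contDiffAt_cov1 (hΓ : ContDiffAt ℝ ∞ Γ z) (hκ : ContDiffAt ℝ ∞ κ z)
    (hA : ContDiffAt ℝ ∞ A z) : ContDiffAt ℝ ∞ (cov1 Γ κ A) z := by
  have := ContDiffAt.fderiv_infty hA
  unfold cov1
  refine ((this.add (ContDiffAt.clm_comp ?_ hκ)).sub (ContDiffAt.clm_comp ?_ hΓ))
  · exact (ContinuousLinearMap.contDiff _).contDiffAt.comp z hA
  · exact (ContinuousLinearMap.contDiff _).contDiffAt.comp z hA

theorem fderiv_cov1 (hΓ : ContDiffAt ℝ ∞ Γ z) (hκ : ContDiffAt ℝ ∞ κ z)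
    (hA : ContDiffAt ℝ ∞ A z) (w' w v : E) :
    fderiv ℝ (cov1 Γ κ A) z w' w v = fderiv ℝ (fderiv ℝ A) z w' w v
      + (fderiv ℝ κ z w' w (A z v) + κ z w (fderiv ℝ A z w' v))
      - (fderiv ℝ A z w' (Γ z w v) + A z (fderiv ℝ Γ z w' w v)) := by
  have h1 := ContDiffAt.diff (contDiffAt_cov1 hΓ hκ hA)
  have hA' := ContDiffAt.diff (ContDiffAt.fderiv_infty hA)
  have dA := ContDiffAt.diff hA
  have dκ := ContDiffAt.diff hκ
  have dΓ := ContDiffAt.diff hΓ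
  rw [← fderiv_apply_const h1 w w', ← fderiv_apply_const (by fun_prop) v w']
  simp_rw [cov1_apply]
  rw [fderiv_fun_sub (by fun_prop) (by fun_prop), fderiv_fun_add (by fun_prop) (by fun_prop)]
  simp only [add_apply, sub_apply]
  rw [fderiv_apply_const (F := fun y => fderiv ℝ A y w) (by fun_prop),
    fderiv_apply_const hA',
    fderiv_apply₁ (F := fun y => κ y w) (s := fun y => A y v) (by fun_prop) (by fun_prop),
    fderiv_apply_const dκ, fderiv_apply_const dA,
    fderiv_apply₁ (F := A) (s := fun y => Γ y w v) (by fun_prop) (by fun_prop),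
    fderiv_apply_const (F := fun y => Γ y w) (by fun_prop), fderiv_apply_const dΓ]

/-- The Ricci identity: second covariant derivatives commute up to curvature. -/
theorem cov2_comm (hΓ : ContDiffAt ℝ ∞ Γ z) (hκ : ContDiffAt ℝ ∞ κ z) (hA : ContDiffAt ℝ ∞ A z)
    (hs : ∀ v w, Γ z v w = Γ z w v) (w' w v : E) :
    cov2 Γ κ A z w' w v - cov2 Γ κ A z w w' v
      = curv κ z w' w (A z v) - A z (curv Γ z w' w v) := by
  unfold cov2
  rw [fderiv_cov1 hΓ hκ hA, fderiv_cov1 hΓ hκ hA, fderiv_fderiv_symm hA w w', hs w w']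
  simp only [cov1_apply, curv, map_add, map_sub]
  abel

theorem contDiffAt_comp_clm {P : E → E →L[ℝ] E} (hA : ContDiffAt ℝ ∞ A z)
    (hP : ContDiffAt ℝ ∞ P z) : ContDiffAt ℝ ∞ (fun y => (A y).comp (P y)) z :=
  hA.clm_comp hP

theorem cov1_comp {P : E → E →L[ℝ] E} (hA : DifferentiableAt ℝ A z) (hP : DifferentiableAt ℝ P z)
    (w v : E) :
    cov1 Γ κ (fun y => (A y).comp (P y)) z w v
      = cov1 Γ κ A z w (P z v) + A z (cov1 Γ Γ P z w v) := by
  simp only [cov1_apply]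
  rw [← fderiv_apply_const (hA.clm_comp hP)]
  simp only [ContinuousLinearMap.comp_apply]
  rw [fderiv_apply₁ (F := A) (s := fun y => P y v) (by fun_prop) (by fun_prop),
    fderiv_apply_const hP]
  simp only [map_add, map_sub]
  abel

/-- The Leibniz rule applied twice. The first-order rule is itself differentiated, so it must hold
near `z`, whence the smoothness assumed on a neighbourhood. -/
theorem cov2_comp {P : E → E →L[ℝ] E} (hΓ : ContDiffAt ℝ ∞ Γ z) (hκ : ContDiffAt ℝ ∞ κ z)
    (hA : ∀ᶠ y in nhds z, ContDiffAt ℝ ∞ A y) (hP : ∀ᶠ y in nhds z, ContDiffAt ℝ ∞ P y)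
    (w' w v : E) :
    cov2 Γ κ (fun y => (A y).comp (P y)) z w' w v
      = cov2 Γ κ A z w' w (P z v) + cov1 Γ κ A z w (cov1 Γ Γ P z w' v)
        + cov1 Γ κ A z w' (cov1 Γ Γ P z w v) + A z (cov2 Γ Γ P z w' w v) := by
  have hAz := hA.self_of_nhds
  have hPz := hP.self_of_nhds
  have cA := ContDiffAt.diff (contDiffAt_cov1 hΓ hκ hAz)
  have cP := ContDiffAt.diff (contDiffAt_cov1 hΓ hΓ hPz)
  have cAP := ContDiffAt.diff (contDiffAt_cov1 hΓ hκ (contDiffAt_comp_clm hAz hPz))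
  have dA := ContDiffAt.diff hAz
  have dP := ContDiffAt.diff hPz
  have e : (fun y => cov1 Γ κ (fun y => (A y).comp (P y)) y w v)
      =ᶠ[nhds z] fun y => cov1 Γ κ A y w (P y v) + A y (cov1 Γ Γ P y w v) := by
    filter_upwards [hA, hP] with y h1 h2
    exact cov1_comp (ContDiffAt.diff h1) (ContDiffAt.diff h2) w v
  have key : fderiv ℝ (cov1 Γ κ (fun y => (A y).comp (P y))) z w' w v
      = fderiv ℝ (cov1 Γ κ A) z w' w (P z v) + cov1 Γ κ A z w (fderiv ℝ P z w' v)
        + (fderiv ℝ A z w' (cov1 Γ Γ P z w v) + A z (fderiv ℝ (cov1 Γ Γ P) z w' w v)) := by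
    rw [← fderiv_apply_const cAP w w', ← fderiv_apply_const (by fun_prop) v w', e.fderiv_eq,
      fderiv_fun_add (by fun_prop) (by fun_prop), add_apply,
      fderiv_apply₁ (F := fun y => cov1 Γ κ A y w) (s := fun y => P y v) (by fun_prop)
        (by fun_prop),
      fderiv_apply_const cA, fderiv_apply_const dP,
      fderiv_apply₁ (F := A) (s := fun y => cov1 Γ Γ P y w v) (by fun_prop) (by fun_prop),
      fderiv_apply_const (F := fun y => cov1 Γ Γ P y w) (by fun_prop), fderiv_apply_const cP]
  have h1 := fun w v => cov1_comp (Γ := Γ) (κ := κ) dA dP w v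
  unfold cov2
  rw [key, h1, h1, h1, cov1_apply Γ Γ P z w' v, cov1_apply Γ κ A z w' (cov1 Γ Γ P z w v)]
  simp only [map_add, map_sub]
  abel

/-- The fibre metric `h` is parallel. -/
def IsParallel (κ : E → E →L[ℝ] W →L[ℝ] W) (h : E → W →L[ℝ] W →L[ℝ] ℝ) (z : E) : Prop :=
  ∀ w s s', fderiv ℝ h z w s s' = h z (κ z w s) s' + h z s (κ z w s')

theorem fderiv_metric {h : E → W →L[ℝ] W →L[ℝ] ℝ} (hp : IsParallel κ h z)
    (hh : DifferentiableAt ℝ h z) {s s' : E → W} (hs : DifferentiableAt ℝ s z)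
    (hs' : DifferentiableAt ℝ s' z) (w : E) :
    fderiv ℝ (fun y => h y (s y) (s' y)) z w
      = h z (nab κ s z w) (s' z) + h z (s z) (nab κ s' z w) := by
  rw [fderiv_apply₁ (F := fun y => h y (s y)) (s := s') (hh.clm_apply hs) hs',
    fderiv_apply₁ hh hs, add_apply, hp]
  simp only [nab, map_add, add_apply]
  abel

theorem nab_form (hA : DifferentiableAt ℝ A z) (w v : E) :
    nab κ (fun y => A y v) z w = cov1 Γ κ A z w v + A z (Γ z w v) := by
  rw [cov1_apply, nab, fderiv_apply_const hA]
  abel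

set_option maxHeartbeats 1000000 in
/-- The curvature is skew-symmetric for a parallel metric. -/
theorem curv_skew {h : E → W →L[ℝ] W →L[ℝ] ℝ} (hp : ∀ᶠ y in nhds z, IsParallel κ h y)
    (hh : ContDiffAt ℝ ∞ h z) (hκ : ContDiffAt ℝ ∞ κ z) (v w : E) (s s' : W) :
    h z (curv κ z v w s) s' + h z s (curv κ z v w s') = 0 := by
  have dh := ContDiffAt.diff hh
  have dκ := ContDiffAt.diff hκ
  have dh' : DifferentiableAt ℝ (fderiv ℝ h) z := ContDiffAt.diff (ContDiffAt.fderiv_infty hh)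
  -- The second derivative of `h`, obtained by differentiating the parallel condition. Its symmetry
  -- in `v` and `w` is the claim.
  have key : ∀ v w, fderiv ℝ (fderiv ℝ h) z v w s s'
      = h z (κ z v (κ z w s)) s' + h z (κ z w s) (κ z v s') + h z (fderiv ℝ κ z v w s) s'
        + (h z (κ z v s) (κ z w s') + h z s (κ z v (κ z w s'))
          + h z s (fderiv ℝ κ z v w s')) := by
    intro v w
    have e : (fun y => fderiv ℝ h y w s s')
        =ᶠ[nhds z] fun y => h y (κ y w s) s' + h y s (κ y w s') := by
      filter_upwards [hp] with y hy
      exact hy w s s'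
    rw [← fderiv_apply_const dh' w v, ← fderiv_apply_const (by fun_prop) s v,
      ← fderiv_apply_const (by fun_prop) s' v, e.fderiv_eq,
      fderiv_fun_add (by fun_prop) (by fun_prop), add_apply,
      fderiv_metric (s := fun y => κ y w s) (s' := fun _ => s') hp.self_of_nhds dh (by fun_prop)
        (by fun_prop),
      fderiv_metric (s := fun _ => s) (s' := fun y => κ y w s') hp.self_of_nhds dh (by fun_prop)
        (by fun_prop)]
    simp only [nab]
    rw [fderiv_apply_const (F := fun y => κ y w) (by fun_prop),
      fderiv_apply_const (F := fun y => κ y w) (by fun_prop), fderiv_apply_const dκ]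
    simp only [fderiv_fun_const, Pi.zero_apply, zero_apply, zero_add, map_add, add_apply]
    ring
  have k := fderiv_fderiv_symm hh v w
  have k' := congrArg (fun L => L s s') k
  rw [key, key] at k'
  simp only [curv, map_add, map_sub, add_apply, sub_apply]
  linear_combination k'

theorem curv_anti (v w : E) (s : W) : curv κ z v w s = -curv κ z w v s := by
  simp only [curv]
  abel

/-- The first Bianchi identity. -/
theorem curv_bianchi (hΓ : ContDiffAt ℝ ∞ Γ z) (hs : ∀ᶠ y in nhds z, ∀ v w, Γ y v w = Γ y w v)
    (a v w : E) : curv Γ z a v w + curv Γ z v w a + curv Γ z w a v = 0 := by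
  have dΓ := ContDiffAt.diff hΓ
  have hd : ∀ a v w, fderiv ℝ Γ z a v w = fderiv ℝ Γ z a w v := by
    intro a v w
    have e : (fun y => Γ y v w) =ᶠ[nhds z] fun y => Γ y w v := by
      filter_upwards [hs] with y hy
      exact hy v w
    rw [← fderiv_apply_const dΓ, ← fderiv_apply_const (by fun_prop), e.fderiv_eq,
      fderiv_apply_const (F := fun y => Γ y w) (by fun_prop), fderiv_apply_const dΓ]
  have hz := hs.self_of_nhds
  simp only [curv]
  rw [hd a v w, hd v w a, hd w a v, hz v w, hz a w, hz a v]
  abel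

/-- The classical consequence of the two skew symmetries and of the first Bianchi identity: four
Bianchi sums combine so that only the two curvatures compared survive. -/
theorem curv_pair {h : E → E →L[ℝ] E →L[ℝ] ℝ} (hp : ∀ᶠ y in nhds z, IsParallel Γ h y)
    (hh : ContDiffAt ℝ ∞ h z) (hΓ : ContDiffAt ℝ ∞ Γ z)
    (hs : ∀ᶠ y in nhds z, ∀ v w, Γ y v w = Γ y w v) (hsymm : ∀ v w, h z v w = h z w v)
    (a b c e : E) : h z (curv Γ z a b c) e = h z (curv Γ z c e a) b := by
  have sk : ∀ a b c e, h z (curv Γ z a b c) e = -h z (curv Γ z a b e) c := by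
    intro a b c e
    have := curv_skew hp hh hΓ a b c e
    rw [hsymm c] at this
    linear_combination this
  have an : ∀ a b c e, h z (curv Γ z a b c) e = -h z (curv Γ z b a c) e := by
    intro a b c e
    rw [curv_anti, map_neg, neg_apply]
  have bi : ∀ a b c e, h z (curv Γ z a b c) e + h z (curv Γ z b c a) e
      + h z (curv Γ z c a b) e = 0 := by
    intro a b c e
    have := congrArg (fun v => h z v e) (curv_bianchi hΓ hs a b c)
    simpa using this
  linarith [bi a b c e, bi b c e a, bi c e a b, bi e a b c, sk a b c e, an a b c e, an a b e c,
    sk a c b e, an a c b e, an a c e b, sk a e b c, an a e b c, an a e c b, sk b a c e,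
    sk b c a e, an b c a e, an b c e a, sk b e a c, an b e a c, an b e c a, sk c a b e,
    sk c b a e, sk c e a b, an c e a b, an c e b a, sk e a b c, sk e b a c, sk e c a b]

end Calculus

/-! ### The Levi-Civita connection in coordinates -/

section LeviCivita

variable {d q : ℕ}

theorem contDiffAt_det {E : Type*} [NormedAddCommGroup E] [NormedSpace ℝ E] {z : E}
    {M : E → Matrix (Fin d) (Fin d) ℝ} (hM : ∀ i j, ContDiffAt ℝ ∞ (fun y => M y i j) z) :
    ContDiffAt ℝ ∞ (fun y => (M y).det) z := by
  simp_rw [Matrix.det_apply, Units.smul_def, zsmul_eq_mul]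
  exact ContDiffAt.sum fun σ _ => contDiffAt_const.mul (contDiffAt_prod fun i _ => hM _ _)

/-- Cramer's rule: the entries are cofactors divided by a determinant that does not vanish at `z`.
-/
theorem contDiffAt_matrix_inv {E : Type*} [NormedAddCommGroup E] [NormedSpace ℝ E] {z : E}
    {M : E → Matrix (Fin d) (Fin d) ℝ} (hM : ∀ i j, ContDiffAt ℝ ∞ (fun y => M y i j) z)
    (hz : IsUnit (M z).det) (i j : Fin d) : ContDiffAt ℝ ∞ (fun y => (M y)⁻¹ i j) z := by
  simp_rw [Matrix.inv_def, Matrix.smul_apply, smul_eq_mul, Ring.inverse_eq_inv,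
    Matrix.adjugate_apply]
  refine ((contDiffAt_det hM).inv hz.ne_zero).mul (contDiffAt_det fun k l => ?_)
  by_cases h : k = j
  · subst h
    simpa using contDiffAt_const
  · simpa [Matrix.updateRow_ne h] using hM k l

variable {G : Euc d → Euc d →L[ℝ] Euc d →L[ℝ] ℝ} {H : Euc q → Euc q →L[ℝ] Euc q →L[ℝ] ℝ}
  {z : Euc d}

theorem contDiffAt_gram_inv (hG : ContDiffAt ℝ ∞ G z) (hz : IsInner (G z)) (i j : Fin d) :
    ContDiffAt ℝ ∞ (fun y => (gramMatrix (G y))⁻¹ i j) z :=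
  contDiffAt_matrix_inv (fun _ _ => (hG.clm_apply contDiffAt_const).clm_apply contDiffAt_const)
    (isUnit_det_gram hz) i j

/-- The Christoffel symbols as a continuous bilinear map. -/
def chr (G : Euc d → Euc d →L[ℝ] Euc d →L[ℝ] ℝ) (z : Euc d) : Euc d →L[ℝ] Euc d →L[ℝ] Euc d :=
  ∑ i, ∑ j, (gramMatrix (G z))⁻¹ i j •
    (ContinuousLinearMap.compL ℝ (Euc d) ℝ (Euc d)
      (ContinuousLinearMap.toSpanSingleton ℝ (EuclideanSpace.single i 1))).comp
    ((1 / 2 : ℝ) • ((ContinuousLinearMap.compL ℝ (Euc d) (Euc d →L[ℝ] ℝ) ℝ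
        (ContinuousLinearMap.apply ℝ ℝ (EuclideanSpace.single j 1))).comp (fderiv ℝ G z)
      + ((ContinuousLinearMap.compL ℝ (Euc d) (Euc d →L[ℝ] ℝ) ℝ
        (ContinuousLinearMap.apply ℝ ℝ (EuclideanSpace.single j 1))).comp (fderiv ℝ G z)).flip
      - fderiv ℝ G z (EuclideanSpace.single j 1)))

/-- The Koszul form. -/
def koszul (G : Euc d → Euc d →L[ℝ] Euc d →L[ℝ] ℝ) (z v w : Euc d) : Euc d →L[ℝ] ℝ :=
  (1 / 2 : ℝ) • (fderiv ℝ G z v w + fderiv ℝ G z w v - ((fderiv ℝ G z).flip v).flip w)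

theorem koszul_apply (z v w a : Euc d) : koszul G z v w a
    = (1 / 2 : ℝ) * (fderiv ℝ G z v w a + fderiv ℝ G z w v a - fderiv ℝ G z a v w) := rfl

theorem chr_apply (z v w : Euc d) : chr G z v w = sharp (G z) (koszul G z v w) := by
  simp only [chr, sharp, metricTrace, sum_apply, smul_apply,
    ContinuousLinearMap.comp_apply, ContinuousLinearMap.compL_apply,
    ContinuousLinearMap.toSpanSingleton_apply, add_apply, sub_apply,
    ContinuousLinearMap.flip_apply, ContinuousLinearMap.apply_apply]
  refine Finset.sum_congr rfl fun i _ => Finset.sum_congr rfl fun j _ => rfl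

/-- Differentiability of `G` lets constant arguments be pulled out of the derivatives, which makes
the symbols bilinear. -/
theorem christoffel_eq (hG : DifferentiableAt ℝ G z) (v w : Euc d) :
    Coord.christoffel G z v w = chr G z v w := by
  rw [chr_apply, Coord.christoffel]
  congr 1
  funext a
  have h : ∀ a b c, fderiv ℝ (fun y => G y a b) z c = fderiv ℝ G z c a b := by
    intro a b c
    rw [fderiv_apply_const (F := fun y => G y a) (by fun_prop), fderiv_apply_const hG]
  rw [koszul_apply, h, h, h]

/-- `G` is a smooth Riemannian metric on `U`. -/
structure IsMetricOn (G : Euc d → Euc d →L[ℝ] Euc d →L[ℝ] ℝ) (U : Set (Euc d)) : Prop where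
  isOpen : IsOpen U
  smooth : ∀ z ∈ U, ContDiffAt ℝ ∞ G z
  inner : ∀ z ∈ U, IsInner (G z)

namespace IsMetricOn

variable {U : Set (Euc d)}

theorem diff (hG : IsMetricOn G U) (hz : z ∈ U) : DifferentiableAt ℝ G z := ContDiffAt.diff (hG.smooth z hz)

theorem eventually (hG : IsMetricOn G U) (hz : z ∈ U) : ∀ᶠ y in nhds z, y ∈ U := hG.isOpen.mem_nhds hz

theorem mono (hG : IsMetricOn G U) {U' : Set (Euc d)} (h : U' ⊆ U) (h' : IsOpen U') : IsMetricOn G U' :=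
  ⟨h', fun z hz => hG.smooth z (h hz), fun z hz => hG.inner z (h hz)⟩

theorem fderiv_symm (hG : IsMetricOn G U) (hz : z ∈ U) (a v w : Euc d) : fderiv ℝ G z a v w = fderiv ℝ G z a w v := by
  have hd := hG.diff hz
  have e : (fun y => G y v w) =ᶠ[nhds z] fun y => G y w v := by
    filter_upwards [hG.eventually hz] with y hy
    exact (hG.inner y hy).1 v w
  rw [← fderiv_apply_const hd, ← fderiv_apply_const (by fun_prop), e.fderiv_eq,
    fderiv_apply_const (F := fun y => G y w) (by fun_prop), fderiv_apply_const hd]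

theorem chr_symm (hG : IsMetricOn G U) (hz : z ∈ U) (v w : Euc d) : chr G z v w = chr G z w v := by
  rw [chr_apply, chr_apply]
  congr 1
  funext a
  rw [koszul_apply, koszul_apply, hG.fderiv_symm hz a v w]
  ring

/-- In the sum of the two Koszul expressions all derivatives cancel in pairs except those along `w`.
-/
theorem isParallel (hG : IsMetricOn G U) (hz : z ∈ U) : IsParallel (chr G) G z := by
  intro w s s'
  have hi := hG.inner z hz
  rw [hi.1 s, chr_apply, chr_apply, inner_sharp hi, inner_sharp hi, koszul_apply, koszul_apply,
    hG.fderiv_symm hz w s' s, hG.fderiv_symm hz s' w s, hG.fderiv_symm hz s w s']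
  ring

theorem smooth_gram_inv (hG : IsMetricOn G U) (hz : z ∈ U) (i j : Fin d) :
    ContDiffAt ℝ ∞ (fun y => (gramMatrix (G y))⁻¹ i j) z :=
  contDiffAt_gram_inv (hG.smooth z hz) (hG.inner z hz) i j

theorem smooth_chr (hG : IsMetricOn G U) (hz : z ∈ U) : ContDiffAt ℝ ∞ (chr G) z := by
  have h := ContDiffAt.fderiv_infty (hG.smooth z hz)
  unfold chr
  refine ContDiffAt.sum fun i _ => ContDiffAt.sum fun j _ =>
    (hG.smooth_gram_inv hz i j).smul (contDiffAt_const.clm_comp ?_)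
  refine ContDiffAt.fun_smul contDiffAt_const ?_
  have h1 := ContDiffAt.clm_comp (contDiffAt_const (c := ContinuousLinearMap.compL ℝ (Euc d)
    (Euc d →L[ℝ] ℝ) ℝ (ContinuousLinearMap.apply ℝ ℝ (EuclideanSpace.single j (1 : ℝ))))) h
  refine (h1.add ?_).sub (h.clm_apply contDiffAt_const)
  exact (ContinuousLinearMap.flipₗᵢ ℝ (Euc d) (Euc d) ℝ).contDiff.contDiffAt.comp z h1

theorem smooth_metricTrace (hG : IsMetricOn G U) {E W : Type*} [NormedAddCommGroup E] [NormedSpace ℝ E]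
    [NormedAddCommGroup W] [NormedSpace ℝ W] {s : Set E} {θ : E → Euc d} {x : E}
    (hθ : ContDiffWithinAt ℝ ∞ θ s x) (hz : θ x ∈ U) {B : E → Euc d → Euc d → W}
    (hB : ∀ v w, ContDiffWithinAt ℝ ∞ (fun y => B y v w) s x) :
    ContDiffWithinAt ℝ ∞ (fun y => metricTrace (G (θ y)) (B y)) s x :=
  ContDiffWithinAt.sum fun i _ => ContDiffWithinAt.sum fun j _ =>
    ((hG.smooth_gram_inv hz i j).comp_contDiffWithinAt x hθ).smul (hB _ _)

/-- With M the matrix of Γ(w, ·), parallelism gives the derivative of g as Mᵀg + gM. Differentiating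
g⁻¹g = 1 then shows that the inverse metric is parallel too. -/
theorem fderiv_gram_inv (hG : IsMetricOn G U) (hz : z ∈ U) (w : Euc d) (i j : Fin d) :
    fderiv ℝ (fun y => (gramMatrix (G y))⁻¹ i j) z w
      = -∑ k, ((gramMatrix (G z))⁻¹ i k * chr G z w (EuclideanSpace.single k 1) j
          + chr G z w (EuclideanSpace.single k 1) i * (gramMatrix (G z))⁻¹ k j) := by
  set g := gramMatrix (G z) with hg
  let M : Matrix (Fin d) (Fin d) ℝ :=
    Matrix.of fun k j => chr G z w (EuclideanSpace.single j 1) k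
  let Dc : Matrix (Fin d) (Fin d) ℝ :=
    Matrix.of fun i j => fderiv ℝ (fun y => (gramMatrix (G y))⁻¹ i j) z w
  have hsum : ∀ v w : Euc d, G z v w = ∑ l, v l * G z (EuclideanSpace.single l 1) w := by
    intro v w
    conv_lhs => rw [sum_smul_single v]
    simp
  have hDg : ∀ j k, fderiv ℝ (fun y => gramMatrix (G y) j k) z w
      = (M.transpose * g + g * M) j k := by
    intro j k
    have hd := hG.diff hz
    have : fderiv ℝ (fun y => gramMatrix (G y) j k) z w
      = fderiv ℝ G z w (EuclideanSpace.single j 1) (EuclideanSpace.single k 1) := by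
      simp only [gramMatrix, Matrix.of_apply]
      rw [fderiv_apply_const (F := fun y => G y (EuclideanSpace.single j 1)) (by fun_prop),
        fderiv_apply_const hd]
    rw [this, hG.isParallel hz, (hG.inner z hz).1 (EuclideanSpace.single j 1), hsum (chr _ _ _ _),
      hsum (chr _ _ _ (EuclideanSpace.single k 1)), Matrix.add_apply, Matrix.mul_apply,
      Matrix.mul_apply]
    congr 1
    refine Finset.sum_congr rfl fun l _ => ?_
    rw [(hG.inner z hz).1, mul_comm]
    rfl
  have hu := isUnit_det_gram (hG.inner z hz)
  -- The derivative of g⁻¹g = 1, an identity valid on a neighbourhood of `z`, taken entry by entry.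
  have h1 : Dc * g + g⁻¹ * (M.transpose * g + g * M) = 0 := by
    ext i k
    have e : (fun y => ∑ j, (gramMatrix (G y))⁻¹ i j * gramMatrix (G y) j k)
        =ᶠ[nhds z] fun _ => (1 : Matrix (Fin d) (Fin d) ℝ) i k := by
      filter_upwards [hG.eventually hz] with y hy
      rw [← Matrix.mul_apply, Matrix.nonsing_inv_mul _ (isUnit_det_gram (hG.inner y hy))]
    have dg : ∀ j k, DifferentiableAt ℝ (fun y => gramMatrix (G y) j k) z := fun j k =>
      ContDiffAt.diff
        (((hG.smooth z hz).clm_apply contDiffAt_const).clm_apply contDiffAt_const)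
    have dc : ∀ i j, DifferentiableAt ℝ (fun y => (gramMatrix (G y))⁻¹ i j) z := fun i j =>
      ContDiffAt.diff (hG.smooth_gram_inv hz i j)
    have h2 := congrArg (fun L : Euc d →L[ℝ] ℝ => L w) (e.fderiv_eq (𝕜 := ℝ))
    rw [fderiv_fun_sum (u := Finset.univ) (A := fun j y =>
      (gramMatrix (G y))⁻¹ i j * gramMatrix (G y) j k) fun j _ => (dc i j).mul (dg j k)] at h2
    simp only [sum_apply, fderiv_fun_const, Pi.zero_apply, zero_apply] at h2
    rw [Matrix.add_apply, Matrix.mul_apply, Matrix.mul_apply, ← Finset.sum_add_distrib,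
      Matrix.zero_apply, ← h2]
    refine Finset.sum_congr rfl fun j _ => ?_
    rw [fderiv_fun_mul (dc i j) (dg j k)]
    simp only [add_apply, smul_apply, smul_eq_mul, hDg]
    simp only [Dc, Matrix.of_apply, hg]
    ring
  have h3 : Dc = -(g⁻¹ * M.transpose + M * g⁻¹) := by
    have h4 : Dc * g * g⁻¹ = Dc := Matrix.mul_nonsing_inv_cancel_right _ _ hu
    rw [← h4, eq_neg_of_add_eq_zero_left h1, Matrix.neg_mul, Matrix.mul_add, Matrix.add_mul,
      ← Matrix.mul_assoc, Matrix.mul_nonsing_inv_cancel_right _ _ hu, ← Matrix.mul_assoc g⁻¹ g,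
      Matrix.nonsing_inv_mul _ hu, Matrix.one_mul]
  have h5 := congrFun (congrFun h3 i) j
  rw [Matrix.neg_apply, Matrix.add_apply, Matrix.mul_apply, Matrix.mul_apply,
    ← Finset.sum_add_distrib] at h5
  exact h5

/-- Metric traces commute with covariant derivatives. -/
theorem fderiv_metricTrace (hG : IsMetricOn G U) {W : Type*} [NormedAddCommGroup W] [NormedSpace ℝ W] (hz : z ∈ U)
    {B : Euc d → Euc d →L[ℝ] Euc d →L[ℝ] W} (hB : DifferentiableAt ℝ B z) (w : Euc d) :
    fderiv ℝ (fun y => metricTrace (G y) fun v v' => B y v v') z w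
      = metricTrace (G z) fun v v' => fderiv ℝ B z w v v' - B z (chr G z w v) v'
          - B z v (chr G z w v') := by
  have dc : ∀ i j, DifferentiableAt ℝ (fun y => (gramMatrix (G y))⁻¹ i j) z := fun i j =>
    ContDiffAt.diff (hG.smooth_gram_inv hz i j)
  unfold metricTrace
  have h1 : ∀ i j, DifferentiableAt ℝ (fun y => (gramMatrix (G y))⁻¹ i j •
      B y (EuclideanSpace.single i 1) (EuclideanSpace.single j 1)) z := fun i j =>
    (dc i j).smul (by fun_prop)
  rw [fderiv_fun_sum fun i _ => DifferentiableAt.fun_sum fun j _ => h1 i j]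
  simp_rw [fun i => fderiv_fun_sum (u := Finset.univ) fun j _ => h1 i j]
  have h2 : ∀ i j, fderiv ℝ (fun y => (gramMatrix (G y))⁻¹ i j •
      B y (EuclideanSpace.single i 1) (EuclideanSpace.single j 1)) z w
      = (gramMatrix (G z))⁻¹ i j •
          fderiv ℝ B z w (EuclideanSpace.single i 1) (EuclideanSpace.single j 1)
        - (∑ k, ((gramMatrix (G z))⁻¹ i k * chr G z w (EuclideanSpace.single k 1) j)) •
          B z (EuclideanSpace.single i 1) (EuclideanSpace.single j 1)
        - (∑ k, (chr G z w (EuclideanSpace.single k 1) i * (gramMatrix (G z))⁻¹ k j)) •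
          B z (EuclideanSpace.single i 1) (EuclideanSpace.single j 1) := by
    intro i j
    rw [fderiv_fun_smul (dc i j) (by fun_prop)]
    simp only [add_apply, smul_apply, ContinuousLinearMap.smulRight_apply]
    rw [hG.fderiv_gram_inv hz, fderiv_apply_const
      (F := fun y => B y (EuclideanSpace.single i 1)) (by fun_prop), fderiv_apply_const hB,
      Finset.sum_add_distrib]
    module
  simp only [sum_apply, h2, smul_sub, Finset.sum_sub_distrib]
  have h3 : ∀ (v : Euc d) (L : Euc d →L[ℝ] W),
      L v = ∑ k, v k • L (EuclideanSpace.single k 1) := by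
    intro v L
    conv_lhs => rw [sum_smul_single v]
    simp
  have h4 : ∀ i j, B z (EuclideanSpace.single i 1) (chr G z w (EuclideanSpace.single j 1))
      = ∑ k, chr G z w (EuclideanSpace.single j 1) k •
        B z (EuclideanSpace.single i 1) (EuclideanSpace.single k 1) := fun i j => h3 _ _
  have h5 : ∀ i j, B z (chr G z w (EuclideanSpace.single i 1)) (EuclideanSpace.single j 1)
      = ∑ k, chr G z w (EuclideanSpace.single i 1) k •
        B z (EuclideanSpace.single k 1) (EuclideanSpace.single j 1) := fun i j =>
    h3 _ ((B z).flip (EuclideanSpace.single j 1))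
  simp only [h4, h5, Finset.sum_smul, Finset.smul_sum, smul_smul]
  rw [sub_right_comm]
  congr 1
  · congr 1
    rw [Finset.sum_comm]
    conv_rhs => rw [Finset.sum_comm]
    refine Finset.sum_congr rfl fun j _ => ?_
    rw [Finset.sum_comm]
    refine Finset.sum_congr rfl fun i _ => Finset.sum_congr rfl fun k _ => ?_
    rw [mul_comm]
  · refine Finset.sum_congr rfl fun i _ => ?_
    rw [Finset.sum_comm]

end IsMetricOn

end LeviCivita

/-! ### Leibniz rules for bilinear forms and self-adjoint fields. -/

section Calculus

variable {E W : Type*} [NormedAddCommGroup E] [NormedSpace ℝ E]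
  [NormedAddCommGroup W] [NormedSpace ℝ W]
  {Γ : E → E →L[ℝ] E →L[ℝ] E} {κ : E → E →L[ℝ] W →L[ℝ] W} {z : E}

/-- The bilinear map `B(S v, S' v')`. -/
def bil {W' : Type*} [NormedAddCommGroup W'] [NormedSpace ℝ W'] (B : E → W →L[ℝ] W →L[ℝ] W')
    (S S' : E → E →L[ℝ] W) (z : E) : E →L[ℝ] E →L[ℝ] W' :=
  ((ContinuousLinearMap.compL ℝ E W W').flip (S' z)).comp ((B z).comp (S z))

theorem bil_apply {W' : Type*} [NormedAddCommGroup W'] [NormedSpace ℝ W']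
    (B : E → W →L[ℝ] W →L[ℝ] W') (S S' : E → E →L[ℝ] W) (z v v' : E) :
    bil B S S' z v v' = B z (S z v) (S' z v') := rfl

theorem differentiableAt_bil {W' : Type*} [NormedAddCommGroup W'] [NormedSpace ℝ W']
    {B : E → W →L[ℝ] W →L[ℝ] W'} {S S' : E → E →L[ℝ] W} (hB : DifferentiableAt ℝ B z)
    (hS : DifferentiableAt ℝ S z) (hS' : DifferentiableAt ℝ S' z) :
    DifferentiableAt ℝ (bil B S S') z := by
  unfold bil
  refine DifferentiableAt.clm_comp ?_ (hB.clm_comp hS)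
  exact (ContinuousLinearMap.differentiableAt _).comp z hS'

theorem fderiv_bil_metric {h : E → W →L[ℝ] W →L[ℝ] ℝ} (hp : IsParallel κ h z)
    (hh : DifferentiableAt ℝ h z) {S S' : E → E →L[ℝ] W} (hS : DifferentiableAt ℝ S z)
    (hS' : DifferentiableAt ℝ S' z) (w v v' : E) :
    fderiv ℝ (bil h S S') z w v v' = h z (cov1 Γ κ S z w v + S z (Γ z w v)) (S' z v')
      + h z (S z v) (cov1 Γ κ S' z w v' + S' z (Γ z w v')) := by
  have h1 := differentiableAt_bil hh hS hS'
  rw [← fderiv_apply_const h1, ← fderiv_apply_const (by fun_prop)]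
  simp_rw [bil_apply]
  rw [fderiv_metric (s := fun y => S y v) (s' := fun y => S' y v') hp hh (by fun_prop)
    (by fun_prop), nab_form hS, nab_form hS']

/-- The covariant derivative of a bilinear form. -/
def covB (Γ : E → E →L[ℝ] E →L[ℝ] E) (κ : E → E →L[ℝ] W →L[ℝ] W) (B : E → E →L[ℝ] E →L[ℝ] W)
    (z w v v' : E) : W :=
  fderiv ℝ B z w v v' + κ z w (B z v v') - B z (Γ z w v) v' - B z v (Γ z w v')

/-- Regarding ∇A as a bilinear form makes its symmetries accessible to `covB_swap`. -/
theorem cov2_eq_covB (A : E → E →L[ℝ] W) (z w' w v : E) :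
    cov2 Γ κ A z w' w v = covB Γ κ (cov1 Γ κ A) z w' w v := rfl

theorem covB_bil {B : E → E →L[ℝ] E →L[ℝ] W} {P P' : E → E →L[ℝ] E} (hB : DifferentiableAt ℝ B z)
    (hP : DifferentiableAt ℝ P z) (hP' : DifferentiableAt ℝ P' z) (w v v' : E) :
    covB Γ κ (bil B P P') z w v v' = covB Γ κ B z w (P z v) (P' z v')
      + B z (cov1 Γ Γ P z w v) (P' z v') + B z (P z v) (cov1 Γ Γ P' z w v') := by
  have h1 := differentiableAt_bil hB hP hP'
  have key : fderiv ℝ (bil B P P') z w v v' = fderiv ℝ B z w (P z v) (P' z v')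
      + B z (fderiv ℝ P z w v) (P' z v') + B z (P z v) (fderiv ℝ P' z w v') := by
    have hBP : DifferentiableAt ℝ (fun y => B y (P y v)) z := hB.clm_apply (by fun_prop)
    rw [← fderiv_apply_const h1, ← fderiv_apply_const (by fun_prop)]
    simp_rw [bil_apply]
    rw [fderiv_apply₁ (F := fun y => B y (P y v)) (s := fun y => P' y v') hBP (by fun_prop),
      fderiv_apply₁ (F := B) (s := fun y => P y v) hB (by fun_prop), fderiv_apply_const hP,
      fderiv_apply_const hP']
    rfl
  simp only [covB, key, bil_apply, cov1_apply, map_add, map_sub, add_apply, sub_apply]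
  abel

/-- A symmetry valid near `z` may be differentiated covariantly. It serves with `c = 1` for
symmetric forms and `c = -1` for skew ones. -/
theorem covB_swap {B : E → E →L[ℝ] E →L[ℝ] W} (hB : DifferentiableAt ℝ B z) (c : ℝ)
    (h : ∀ᶠ y in nhds z, ∀ v v', B y v v' = c • B y v' v) (w v v' : E) :
    covB Γ κ B z w v v' = c • covB Γ κ B z w v' v := by
  have hz := h.self_of_nhds
  have key : fderiv ℝ B z w v v' = c • fderiv ℝ B z w v' v := by
    have e : (fun y => B y v v') =ᶠ[nhds z] fun y => c • B y v' v := by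
      filter_upwards [h] with y hy
      exact hy v v'
    rw [← fderiv_apply_const hB, ← fderiv_apply_const (by fun_prop), e.fderiv_eq,
      fderiv_fun_const_smul (by fun_prop), smul_apply,
      fderiv_apply_const (F := fun y => B y v') (by fun_prop), fderiv_apply_const hB]
  simp only [covB]
  rw [key, hz v v', hz (Γ z w v) v', hz v (Γ z w v')]
  simp only [map_smul, smul_sub, smul_add]
  abel

/-- A vector `w` frozen in coordinates is not parallel; the term in `Γ` accounts for the difference.
-/
theorem cov1_cov1 {A : E → E →L[ℝ] W} (hA : DifferentiableAt ℝ (cov1 Γ κ A) z) (w' w v : E) :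
    cov1 Γ κ (fun y => cov1 Γ κ A y w) z w' v
      = cov2 Γ κ A z w' w v + cov1 Γ κ A z (Γ z w' w) v := by
  rw [cov1_apply, cov2, fderiv_apply_const hA]
  abel

/-- Differentiating ⟨Sv, v'⟩ = ⟨v, Sv'⟩ with a parallel metric, the Christoffel terms cancel by the
self-adjointness of S itself. -/
theorem cov1_selfAdjoint {h : E → E →L[ℝ] E →L[ℝ] ℝ} (hp : IsParallel Γ h z)
    (hh : DifferentiableAt ℝ h z) {S : E → E →L[ℝ] E} (hS : DifferentiableAt ℝ S z)
    (hs : ∀ᶠ y in nhds z, ∀ v v', h y (S y v) v' = h y v (S y v')) (w v v' : E) :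
    h z (cov1 Γ Γ S z w v) v' = h z v (cov1 Γ Γ S z w v') := by
  have e : (fun y => h y (S y v) v') =ᶠ[nhds z] fun y => h y v (S y v') := by
    filter_upwards [hs] with y hy
    exact hy v v'
  have e' := congrArg (fun L : E →L[ℝ] ℝ => L w) (e.fderiv_eq (𝕜 := ℝ))
  have hz := hs.self_of_nhds
  have h1 : ∀ v, nab Γ (fun _ => v) z w = Γ z w v := fun v => by simp [nab]
  rw [fderiv_metric (s := fun y => S y v) (s' := fun _ => v') hp hh (by fun_prop) (by fun_prop),
    fderiv_metric (s := fun _ => v) (s' := fun y => S y v') hp hh (by fun_prop) (by fun_prop),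
    nab_form hS, nab_form hS, h1, h1, map_add, map_add, add_apply, hz, hz] at e'
  linear_combination e'

end Calculus

/-! ### Pulled-back connection, tension field, Laplacian of an energy density. -/

section Coordinates

variable {d q : ℕ} {G : Euc d → Euc d →L[ℝ] Euc d →L[ℝ] ℝ} {H : Euc q → Euc q →L[ℝ] Euc q →L[ℝ] ℝ}
  {U : Set (Euc d)} {V : Set (Euc q)} {u : Euc d → Euc q} {z : Euc d}

/-- The form of the pull-back by `u` of the Levi-Civita connection of `H`. -/
def pull (H : Euc q → Euc q →L[ℝ] Euc q →L[ℝ] ℝ) (u : Euc d → Euc q) (z : Euc d) :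
    Euc d →L[ℝ] Euc q →L[ℝ] Euc q :=
  (chr H (u z)).comp (fderiv ℝ u z)

theorem pull_apply (z w : Euc d) (s : Euc q) :
    pull H u z w s = chr H (u z) (fderiv ℝ u z w) s := rfl

theorem smooth_pull (hH : IsMetricOn H V) (hu : ContDiffAt ℝ ∞ u z) (hz : u z ∈ V) :
    ContDiffAt ℝ ∞ (pull H u) z :=
  ((hH.smooth_chr hz).comp z hu).clm_comp (ContDiffAt.fderiv_infty hu)

theorem pull_parallel (hH : IsMetricOn H V) (hu : ContDiffAt ℝ ∞ u z) (hz : u z ∈ V) :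
    IsParallel (pull H u) (fun y => H (u y)) z := by
  intro w s s'
  have : fderiv ℝ (fun y => H (u y)) z w = fderiv ℝ H (u z) (fderiv ℝ u z w) := by
    rw [show (fun y => H (u y)) = H ∘ u from rfl,
      fderiv_comp z (hH.diff hz) (ContDiffAt.diff hu)]
    rfl
  rw [this, hH.isParallel hz]
  rfl

theorem curvature_eq (hG : IsMetricOn G U) (hz : z ∈ U) (v w a : Euc d) :
    Coord.curvature G z v w a = curv (chr G) z v w a := by
  have hd := ContDiffAt.diff (hG.smooth_chr hz)
  have e : ∀ v a, (fun y => Coord.christoffel G y v a) =ᶠ[nhds z] fun y => chr G y v a := by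
    intro v a
    filter_upwards [hG.eventually hz] with y hy
    exact christoffel_eq (hG.diff hy) v a
  have hf : ∀ w v a, fderiv ℝ (fun y => Coord.christoffel G y v a) z w
      = fderiv ℝ (chr G) z w v a := by
    intro w v a
    rw [(e v a).fderiv_eq, fderiv_apply_const (F := fun y => chr G y v) (by fun_prop),
      fderiv_apply_const hd]
  simp only [Coord.curvature, hf, christoffel_eq (hG.diff hz), curv]

/-- The second derivatives of `u` enter symmetrically and cancel; what remains is the curvature of
`H` on the image vectors. -/
theorem curv_pull (hH : IsMetricOn H V) (hu : ContDiffAt ℝ ∞ u z) (hz : u z ∈ V) (v w : Euc d)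
    (s : Euc q) : curv (pull H u) z v w s
      = Coord.curvature H (u z) (fderiv ℝ u z v) (fderiv ℝ u z w) s := by
  rw [curvature_eq hH hz]
  have h1 := ContDiffAt.diff (hH.smooth_chr hz)
  have h2 := ContDiffAt.diff hu
  have h3 : DifferentiableAt ℝ (fun y => chr H (u y)) z := h1.comp z h2
  have h4 := ContDiffAt.diff (ContDiffAt.fderiv_infty hu)
  have h5 := ContDiffAt.diff (smooth_pull hH hu hz)
  have h6 : ∀ v w, fderiv ℝ (pull H u) z v w s
      = fderiv ℝ (chr H) (u z) (fderiv ℝ u z v) (fderiv ℝ u z w) s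
        + chr H (u z) (fderiv ℝ (fderiv ℝ u) z v w) s := by
    intro v w
    rw [← fderiv_apply_const h5]
    have h7 : (fun y => pull H u y w) = fun y => chr H (u y) (fderiv ℝ u y w) := rfl
    rw [h7, fderiv_apply₁ (F := fun y => chr H (u y)) h3 (by fun_prop), fderiv_apply_const h4,
      show (fun y => chr H (u y)) = chr H ∘ u from rfl, fderiv_comp z h1 h2]
    rfl
  simp only [curv, h6, pull_apply]
  rw [fderiv_fderiv_symm hu v w]
  abel

/-- The conventions differ: the direction of differentiation is the last argument of
`Coord.covDerivOneForm` and the first one of `cov1`. -/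
theorem covDerivOneForm_eq (hG : IsMetricOn G U) (hz : z ∈ U) (hH : IsMetricOn H V)
    (hz' : u z ∈ V) {A : Euc d → Euc d →L[ℝ] Euc q} (hA : DifferentiableAt ℝ A z) (v w : Euc d) :
    Coord.covDerivOneForm G H u (fun y a => A y a) z v w
      = cov1 (chr G) (pull H u) A z w v := by
  rw [Coord.covDerivOneForm, Coord.pullbackCovDeriv, christoffel_eq (hG.diff hz),
    christoffel_eq (hH.diff hz'), fderiv_apply_const hA]
  rfl

/-- Torsion-freeness of both connections together with the symmetry of the second derivative of `u`.
-/
theorem cov1_fderiv_symm (hG : IsMetricOn G U) (hz : z ∈ U) (hH : IsMetricOn H V)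
    (hu : ContDiffAt ℝ ∞ u z) (hz' : u z ∈ V) (v w : Euc d) :
    cov1 (chr G) (pull H u) (fderiv ℝ u) z w v = cov1 (chr G) (pull H u) (fderiv ℝ u) z v w := by
  simp only [cov1_apply, pull_apply]
  rw [fderiv_fderiv_symm hu, hG.chr_symm hz, hH.chr_symm hz']

theorem tension_eq (hG : IsMetricOn G U) (hz : z ∈ U) (hH : IsMetricOn H V)
    (hu : ContDiffAt ℝ ∞ u z) (hz' : u z ∈ V) : Coord.tension G H u z
      = metricTrace (G z) fun v w => cov1 (chr G) (pull H u) (fderiv ℝ u) z v w := by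
  unfold Coord.tension
  congr 1
  funext v w
  rw [covDerivOneForm_eq hG hz hH hz' (ContDiffAt.diff (ContDiffAt.fderiv_infty hu)),
    cov1_fderiv_symm hG hz hH hu hz']

/-- The covariant derivative of a trace is the trace of the covariant derivative. -/
theorem nab_metricTrace {W : Type*} [NormedAddCommGroup W] [NormedSpace ℝ W]
    (hG : IsMetricOn G U) (hz : z ∈ U) (κ : Euc d → Euc d →L[ℝ] W →L[ℝ] W)
    {B : Euc d → Euc d →L[ℝ] Euc d →L[ℝ] W} (hB : DifferentiableAt ℝ B z) (w : Euc d) :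
    nab κ (fun y => metricTrace (G y) fun v v' => B y v v') z w
      = metricTrace (G z) fun v v' => covB (chr G) κ B z w v v' := by
  have h1 := metricTrace_map (b := G z) (κ z w).toLinearMap fun v v' => B z v v'
  simp only [ContinuousLinearMap.coe_coe] at h1
  rw [nab, hG.fderiv_metricTrace hz hB, h1, ← metricTrace_add]
  congr 1
  funext v v'
  rw [covB]
  abel

/-- The Laplacian is minus the trace of the Hessian. -/
theorem laplacian_eq (hG : IsMetricOn G U) (hz : z ∈ U) {φ : Euc d → ℝ}
    (hφ : ∀ y ∈ U, ContDiffAt ℝ ∞ φ y) : Coord.laplacian G φ z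
      = -metricTrace (G z) fun v w =>
          fderiv ℝ (fderiv ℝ φ) z v w - fderiv ℝ φ z (chr G z v w) := by
  have hd := ContDiffAt.diff (ContDiffAt.fderiv_infty (hφ z hz))
  have hV : DifferentiableAt ℝ (Coord.gradient G φ) z := by
    refine ContDiffAt.diff ?_
    have := hG.smooth_metricTrace (s := Set.univ) (θ := id) contDiffWithinAt_id hz
      (B := fun y v w => fderiv ℝ φ y w • v) fun v w =>
        (((ContDiffAt.fderiv_infty (hφ z hz)).clm_apply
          contDiffAt_const).smul contDiffAt_const).contDiffWithinAt
    rw [contDiffWithinAt_univ] at this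
    exact this
  unfold Coord.laplacian Coord.divergence
  congr 2
  funext a b
  have e : (fun y => G y (Coord.gradient G φ y) b) =ᶠ[nhds z] fun y => fderiv ℝ φ y b := by
    filter_upwards [hG.eventually hz] with y hy
    exact inner_sharp (hG.inner y hy) _ b
  have h1 := congrArg (fun L : Euc d →L[ℝ] ℝ => L a) (e.fderiv_eq (𝕜 := ℝ))
  rw [fderiv_metric (κ := chr G) (s' := fun _ => b) (hG.isParallel hz) (hG.diff hz) hV (by fun_prop),
    fderiv_apply_const hd] at h1
  have h2 : nab (chr G) (fun _ => b) z a = chr G z a b := by simp [nab]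
  rw [h2] at h1
  have h3 : G z (Coord.gradient G φ z) (chr G z a b) = fderiv ℝ φ z (chr G z a b) :=
    inner_sharp (hG.inner z hz) _ _
  rw [Coord.covDeriv, christoffel_eq (hG.diff hz), ← h1, ← h3]
  simp [nab]

theorem fderiv_trace_bil {W : Type*} [NormedAddCommGroup W] [NormedSpace ℝ W]
    (hG : IsMetricOn G U) (hz : z ∈ U) {κ : Euc d → Euc d →L[ℝ] W →L[ℝ] W}
    {h : Euc d → W →L[ℝ] W →L[ℝ] ℝ} (hp : IsParallel κ h z) (hh : DifferentiableAt ℝ h z)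
    {S S' : Euc d → Euc d →L[ℝ] W} (hS : DifferentiableAt ℝ S z) (hS' : DifferentiableAt ℝ S' z)
    (w : Euc d) :
    fderiv ℝ (fun y => metricTrace (G y) fun v v' => h y (S y v) (S' y v')) z w
      = metricTrace (G z) fun v v' => h z (cov1 (chr G) κ S z w v) (S' z v')
          + h z (S z v) (cov1 (chr G) κ S' z w v') := by
  have h1 := hG.fderiv_metricTrace hz (differentiableAt_bil hh hS hS') w
  simp_rw [bil_apply] at h1
  rw [h1]
  congr 1
  funext v v'
  rw [fderiv_bil_metric (Γ := chr G) hp hh hS hS']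
  simp only [map_add, add_apply]
  ring

/-- Laplacian of the energy density of a one-form. -/
theorem laplacian_energy {W : Type*} [NormedAddCommGroup W] [NormedSpace ℝ W]
    (hG : IsMetricOn G U) (hz : z ∈ U) {κ : Euc d → Euc d →L[ℝ] W →L[ℝ] W}
    {h : Euc d → W →L[ℝ] W →L[ℝ] ℝ} (hp : ∀ y ∈ U, IsParallel κ h y)
    (hh : ∀ y ∈ U, ContDiffAt ℝ ∞ h y) (hs : ∀ y ∈ U, ∀ s s', h y s s' = h y s' s)
    (hκ : ∀ y ∈ U, ContDiffAt ℝ ∞ κ y)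
    {α : Euc d → Euc d →L[ℝ] W} (hα : ∀ y ∈ U, ContDiffAt ℝ ∞ α y) :
    Coord.laplacian G (fun y => (1 / 2 : ℝ) * metricTrace (G y) fun v v' => h y (α y v) (α y v')) z
      = -metricTrace (G z) fun w' w => metricTrace (G z) fun v v' =>
          h z (cov2 (chr G) κ α z w' w v) (α z v')
          + h z (cov1 (chr G) κ α z w v) (cov1 (chr G) κ α z w' v') := by
  have dφ : ∀ y ∈ U, ContDiffAt ℝ ∞ (fun y => (1 / 2 : ℝ) *
      metricTrace (G y) fun v v' => h y (α y v) (α y v')) y := by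
    intro y hy
    have := hG.smooth_metricTrace (s := Set.univ) (θ := id) contDiffWithinAt_id hy
      (B := fun y v v' => h y (α y v) (α y v')) fun v v' =>
        (((hh y hy).clm_apply ((hα y hy).clm_apply contDiffAt_const)).clm_apply
          ((hα y hy).clm_apply contDiffAt_const)).contDiffWithinAt
    rw [contDiffWithinAt_univ] at this
    exact contDiffAt_const.mul this
  have dT : ∀ y ∈ U, DifferentiableAt ℝ (fun y => metricTrace (G y) fun v v' =>
      h y (α y v) (α y v')) y := by
    intro y hy
    have := (ContDiffAt.diff (dφ y hy)).const_mul 2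
    refine this.congr_of_eventuallyEq (Filter.Eventually.of_forall fun x => ?_)
    simp
  -- The two Leibniz terms agree by symmetry of `h` and of the trace, which absorbs the factor ½.
  have h1 : ∀ y ∈ U, ∀ w, fderiv ℝ (fun y => (1 / 2 : ℝ) *
      metricTrace (G y) fun v v' => h y (α y v) (α y v')) y w
      = metricTrace (G y) fun v v' => h y (cov1 (chr G) κ α y w v) (α y v') := by
    intro y hy w
    have da := ContDiffAt.diff (hα y hy)
    rw [fderiv_const_mul (dT y hy), smul_apply,
      fderiv_trace_bil hG hy (hp y hy) (ContDiffAt.diff (hh y hy)) da da, metricTrace_add,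
      ← metricTrace_swap (hG.inner y hy) (fun v v' => h y (α y v) (cov1 (chr G) κ α y w v'))]
    simp_rw [fun v v' => hs y hy (α y v) (cov1 (chr G) κ α y w v')]
    rw [smul_eq_mul]
    ring
  rw [laplacian_eq hG hz dφ]
  congr 2
  funext w' w
  have hd := ContDiffAt.diff (ContDiffAt.fderiv_infty (dφ z hz))
  have dc := ContDiffAt.diff (contDiffAt_cov1 (hG.smooth_chr hz) (hκ z hz) (hα z hz))
  rw [← fderiv_apply_const hd, h1 z hz]
  have e : (fun y => fderiv ℝ (fun y => (1 / 2 : ℝ) *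
      metricTrace (G y) fun v v' => h y (α y v) (α y v')) y w) =ᶠ[nhds z]
      fun y => metricTrace (G y) fun v v' => h y (cov1 (chr G) κ α y w v) (α y v') := by
    filter_upwards [hG.eventually hz] with y hy
    exact h1 y hy w
  rw [e.fderiv_eq, fderiv_trace_bil hG hz (hp z hz) (ContDiffAt.diff (hh z hz))
    (S := fun y => cov1 (chr G) κ α y w) (by fun_prop) (ContDiffAt.diff (hα z hz)), sub_eq_iff_eq_add,
    ← metricTrace_add]
  congr 1
  funext v v'
  rw [cov1_cov1 dc, map_add, add_apply]
  ring

end Coordinates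

/-! ### First and second covariant derivatives of the projection onto the distribution. -/

section Projection

variable {d : ℕ}

/-- The orthogonal projection onto the distribution, as a field of continuous linear maps. -/
def projD (G : Euc d → Euc d →L[ℝ] Euc d →L[ℝ] ℝ) (D : Euc d → Submodule ℝ (Euc d))
    (z : Euc d) : Euc d →L[ℝ] Euc d :=
  LinearMap.toContinuousLinearMap (orthProj (G z) (D z))

theorem projD_apply (G : Euc d → Euc d →L[ℝ] Euc d →L[ℝ] ℝ) (D : Euc d → Submodule ℝ (Euc d))
    (z v : Euc d) : projD G D z v = orthProj (G z) (D z) v := rfl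

/-- The covariant derivative of the orthogonal projection onto the distribution. -/
abbrev covP (G : Euc d → Euc d →L[ℝ] Euc d →L[ℝ] ℝ) (D : Euc d → Submodule ℝ (Euc d))
    (z : Euc d) : Euc d →L[ℝ] Euc d →L[ℝ] Euc d :=
  cov1 (chr G) (chr G) (projD G D) z

/-- The second covariant derivative of the orthogonal projection onto the distribution. -/
abbrev cov2P (G : Euc d → Euc d →L[ℝ] Euc d →L[ℝ] ℝ) (D : Euc d → Submodule ℝ (Euc d))
    (z w' w v : Euc d) : Euc d :=
  cov2 (chr G) (chr G) (projD G D) z w' w v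

/-- In coordinates: `G` is a metric on `U` and `D` the tangent distribution of a foliation for
which `G` is bundle-like and tense, expressed by the covariant derivative of the projection. -/
structure IsTenseOn (G : Euc d → Euc d →L[ℝ] Euc d →L[ℝ] ℝ)
    (D : Euc d → Submodule ℝ (Euc d)) (U : Set (Euc d)) : Prop where
  metric : IsMetricOn G U
  smooth : ∀ z ∈ U, ContDiffAt ℝ ∞ (projD G D) z
  invol : ∀ z ∈ U, ∀ v w, covP G D z (projD G D z v) (projD G D z w)
    = covP G D z (projD G D z w) (projD G D z v)
  bundle : ∀ z ∈ U, ∀ v w, covP G D z (v - projD G D z v) (w - projD G D z w)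
    = -covP G D z (w - projD G D z w) (v - projD G D z v)
  tense : ∀ z ∈ U, ∀ v, projD G D z (nab (chr G) (Coord.meanCurvature G D) z (projD G D z v)
      - covP G D z (Coord.meanCurvature G D z) v)
    = nab (chr G) (Coord.meanCurvature G D) z (projD G D z v)
      - covP G D z (Coord.meanCurvature G D z) v

namespace IsTenseOn

variable {G : Euc d → Euc d →L[ℝ] Euc d →L[ℝ] ℝ} {D : Euc d → Submodule ℝ (Euc d)}
  {U : Set (Euc d)} {z : Euc d}

theorem proj_idem (hG : IsMetricOn G U) (hz : z ∈ U) (v : Euc d) :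
    projD G D z (projD G D z v) = projD G D z v :=
  orthProj_idem (hG.inner z hz) v

theorem proj_symm (hG : IsMetricOn G U) (hz : z ∈ U) (v w : Euc d) :
    G z (projD G D z v) w = G z v (projD G D z w) :=
  orthProj_symm (hG.inner z hz) v w

theorem proj_comp_eventually (hG : IsMetricOn G U) (hz : z ∈ U) :
    (fun y => (projD G D y).comp (projD G D y)) =ᶠ[nhds z] projD G D := by
  filter_upwards [hG.eventually hz] with y hy
  ext1 v
  exact proj_idem hG hy v

/-- Differentiate P² = P. Hence ∇_w P sends tangential vectors to normal ones and normal vectors to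
tangential ones. -/
theorem covP_eq (hG : IsMetricOn G U) (hP : ∀ y ∈ U, ContDiffAt ℝ ∞ (projD G D) y) (hz : z ∈ U)
    (w v : Euc d) :
    covP G D z w v = covP G D z w (projD G D z v) + projD G D z (covP G D z w v) := by
  have hd := ContDiffAt.diff (hP z hz)
  have h1 : (projD G D z).comp (projD G D z) = projD G D z :=
    (proj_comp_eventually hG hz).self_of_nhds
  rw [← cov1_comp hd hd, covP, cov1_apply, cov1_apply, (proj_comp_eventually hG hz).fderiv_eq, h1]

/-- For constant `w`, the covariant derivative of the field P w is (∇P)w plus the tangential vector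
P Γ(·, w). Removing tangential parts kills the latter, and `covP_eq` turns the former into (∇P)(P
w). -/
theorem meanCurvature_eq (hG : IsMetricOn G U) (hP : ∀ y ∈ U, ContDiffAt ℝ ∞ (projD G D) y)
    (hz : z ∈ U) : Coord.meanCurvature G D z
      = metricTrace (G z) fun v w => covP G D z (projD G D z v) (projD G D z w) := by
  unfold Coord.meanCurvature
  congr 1
  funext v w
  have h1 : Coord.covDeriv G (fun y => orthProj (G y) (D y) w) z (orthProj (G z) (D z) v)
      = covP G D z (projD G D z v) w + projD G D z (chr G z (projD G D z v) w) := by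
    rw [Coord.covDeriv, christoffel_eq (hG.diff hz), ← nab_form (ContDiffAt.diff (hP z hz))]
    rfl
  rw [h1]
  have h2 := covP_eq hG hP hz (projD G D z v) w
  have h3 := proj_idem (D := D) hG hz (chr G z (projD G D z v) w)
  have h4 : orthProj (G z) (D z) (covP G D z (projD G D z v) w
      + projD G D z (chr G z (projD G D z v) w)) = projD G D z (covP G D z (projD G D z v) w)
      + projD G D z (chr G z (projD G D z v) w) := by
    rw [← projD_apply, map_add, h3]
  rw [h4, add_sub_add_right_eq_sub]
  exact sub_eq_of_eq_add h2

theorem covP_diff (h : IsTenseOn G D U) (hz : z ∈ U) : DifferentiableAt ℝ (covP G D) z :=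
  ContDiffAt.diff (contDiffAt_cov1 (h.metric.smooth_chr hz) (h.metric.smooth_chr hz)
    (h.smooth z hz))

theorem proj_diff (h : IsTenseOn G D U) (hz : z ∈ U) : DifferentiableAt ℝ (projD G D) z :=
  ContDiffAt.diff (h.smooth z hz)

/-- P² = P differentiated twice. On tangential vectors it expresses the tangential part of ∇²P
through products of first derivatives. -/
theorem cov2P_eq (h : IsTenseOn G D U) (hz : z ∈ U) (w' w v : Euc d) :
    cov2P G D z w' w v = cov2P G D z w' w (projD G D z v) + covP G D z w (covP G D z w' v)
      + covP G D z w' (covP G D z w v) + projD G D z (cov2P G D z w' w v) := by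
  have hs : ∀ᶠ y in nhds z, ContDiffAt ℝ ∞ (projD G D) y := by
    filter_upwards [h.metric.eventually hz] with y hy
    exact h.smooth y hy
  have hΓ := h.metric.smooth_chr hz
  rw [← cov2_comp hΓ hΓ hs hs]
  have e : cov1 (chr G) (chr G) (fun y => (projD G D y).comp (projD G D y))
      =ᶠ[nhds z] covP G D := by
    filter_upwards [(proj_comp_eventually (D := D) h.metric hz).eventuallyEq_nhds] with y hy
    have h1 : (projD G D y).comp (projD G D y) = projD G D y := hy.self_of_nhds
    rw [covP, cov1, cov1, hy.fderiv_eq, h1]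
  rw [cov2P, cov2, cov2, e.fderiv_eq, e.self_of_nhds]

theorem covP_symm (h : IsTenseOn G D U) (hz : z ∈ U) (w v v' : Euc d) :
    G z (covP G D z w v) v' = G z v (covP G D z w v') := by
  refine cov1_selfAdjoint (h.metric.isParallel hz) (h.metric.diff hz) (h.proj_diff hz) ?_ w v v'
  filter_upwards [h.metric.eventually hz] with y hy v v'
  exact proj_symm h.metric hy v v'

theorem cov2P_symm (h : IsTenseOn G D U) (hz : z ∈ U) (w' w v v' : Euc d) :
    G z (cov2P G D z w' w v) v' = G z v (cov2P G D z w' w v') := by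
  have hd := h.covP_diff hz
  have h1 := cov1_selfAdjoint (S := fun y => covP G D y w) (h.metric.isParallel hz)
    (h.metric.diff hz) (by fun_prop) (by
      filter_upwards [h.metric.eventually hz] with y hy v v'
      exact h.covP_symm hy w v v') w' v v'
  rw [cov1_cov1 hd, cov1_cov1 hd, map_add, map_add, add_apply, h.covP_symm hz] at h1
  linear_combination h1

/-- The symmetry `invol` holds on all of `U`, so it can be differentiated; the terms of first order
come from the derivatives of the two projections. -/
theorem deriv_invol (h : IsTenseOn G D U) (hz : z ∈ U) (e v w : Euc d) :
    cov2P G D z e (projD G D z v) (projD G D z w)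
      + covP G D z (covP G D z e v) (projD G D z w) + covP G D z (projD G D z v) (covP G D z e w)
    = cov2P G D z e (projD G D z w) (projD G D z v)
      + covP G D z (covP G D z e w) (projD G D z v)
      + covP G D z (projD G D z w) (covP G D z e v) := by
  have hK := h.covP_diff hz
  have hP := h.proj_diff hz
  have h1 := covB_swap (Γ := chr G) (κ := chr G) (differentiableAt_bil hK hP hP) 1 (by
    filter_upwards [h.metric.eventually hz] with y hy v w
    rw [one_smul]
    exact h.invol y hy v w) e v w
  rw [one_smul, covB_bil hK hP hP, covB_bil hK hP hP] at h1
  exact h1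

/-- The projection onto the orthogonal complement. -/
def projN (G : Euc d → Euc d →L[ℝ] Euc d →L[ℝ] ℝ) (D : Euc d → Submodule ℝ (Euc d))
    (z : Euc d) : Euc d →L[ℝ] Euc d :=
  ContinuousLinearMap.id ℝ (Euc d) - projD G D z

theorem projN_apply (v : Euc d) : projN G D z v = v - projD G D z v := rfl

theorem cov1_projN (w v : Euc d) :
    cov1 (chr G) (chr G) (projN G D) z w v = -covP G D z w v := by
  have : fderiv ℝ (projN G D) z = -fderiv ℝ (projD G D) z := by
    unfold projN
    rw [fderiv_const_sub]
  rw [cov1_apply, cov1_apply, this, projN_apply, projN_apply, map_sub, neg_apply, neg_apply]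
  abel

/-- The analogue of `deriv_invol` for the skew symmetry on normal vectors. The complementary
projection has derivative −∇P, whence the minus signs. -/
theorem deriv_bundle (h : IsTenseOn G D U) (hz : z ∈ U) (e v w : Euc d) :
    cov2P G D z e (projN G D z v) (projN G D z w)
      - covP G D z (covP G D z e v) (projN G D z w) - covP G D z (projN G D z v) (covP G D z e w)
    = -(cov2P G D z e (projN G D z w) (projN G D z v)
      - covP G D z (covP G D z e w) (projN G D z v)
      - covP G D z (projN G D z w) (covP G D z e v)) := by
  have hK := h.covP_diff hz
  have hP : DifferentiableAt ℝ (projN G D) z := (h.proj_diff hz).const_sub _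
  have h1 := covB_swap (Γ := chr G) (κ := chr G) (differentiableAt_bil hK hP hP) (-1) (by
    filter_upwards [h.metric.eventually hz] with y hy v w
    rw [neg_smul, one_smul]
    exact h.bundle y hy v w) e v w
  rw [neg_smul, one_smul, covB_bil hK hP hP, covB_bil hK hP hP, cov1_projN,
    cov1_projN] at h1
  simp only [map_neg, neg_apply, ← sub_eq_add_neg] at h1
  exact h1

theorem nab_meanCurvature (h : IsTenseOn G D U) (hz : z ∈ U) (w : Euc d) :
    nab (chr G) (Coord.meanCurvature G D) z w
      = metricTrace (G z) fun v v' => cov2P G D z w (projD G D z v) (projD G D z v')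
        + covP G D z (covP G D z w v) (projD G D z v')
        + covP G D z (projD G D z v) (covP G D z w v') := by
  have hK := h.covP_diff hz
  have hP := h.proj_diff hz
  have e : Coord.meanCurvature G D =ᶠ[nhds z]
      fun y => metricTrace (G y) fun v v' => bil (covP G D) (projD G D) (projD G D) y v v' := by
    filter_upwards [h.metric.eventually hz] with y hy
    exact meanCurvature_eq h.metric h.smooth hy
  have h1 := nab_metricTrace h.metric hz (chr G) (differentiableAt_bil hK hP hP) w
  rw [nab, e.fderiv_eq, e.self_of_nhds]
  refine h1.trans ?_
  congr 1
  funext v v'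
  exact covB_bil hK hP hP w v v'

end IsTenseOn

end Projection

/-! ### The pointwise cancellations behind the Bochner formula. -/

section Algebra

variable {d q k l : ℕ}

/-- The pointwise algebra of the Bochner formula for the tangential energy, in an orthonormal
basis adapted to the distribution. -/
theorem bochner_algebra {g : Euc d →L[ℝ] Euc d →L[ℝ] ℝ} {h : Euc q →L[ℝ] Euc q →L[ℝ] ℝ}
    (hh : ∀ s s', h s s' = h s' s) (hg : ∀ v w, g v w = g w v)
    {e : Module.Basis (Fin k ⊕ Fin l) ℝ (Euc d)} (he : IsOrtho g e)
    (K : Euc d →L[ℝ] Euc d →L[ℝ] Euc d) (Ks : ∀ w v v', g (K w v) v' = g v (K w v'))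
    (KF : ∀ w i i', g (K w (e (.inl i))) (e (.inl i')) = 0)
    (KN : ∀ w j j', g (K w (e (.inr j))) (e (.inr j')) = 0)
    (Kb : ∀ j j', K (e (.inr j)) (e (.inr j')) = -K (e (.inr j')) (e (.inr j)))
    (D2 : Fin k ⊕ Fin l → Fin k → Euc d)
    (D2F : ∀ a i i', g (D2 a i) (e (.inl i'))
      = -(2 * g (K (e a) (K (e a) (e (.inl i)))) (e (.inl i'))))
    (ric : Fin k → Fin k ⊕ Fin l → ℝ)
    (mixed : ∀ i j, ∑ a, g (D2 a i) (e (.inr j)) + ric i (.inr j)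
      = 2 * ∑ c, g (K (K (e (.inr c)) (e (.inr j))) (e (.inr c))) (e (.inl i)))
    (A : Euc d →L[ℝ] Euc q) (A1 : Euc d →L[ℝ] Euc d →L[ℝ] Euc q)
    (A1s : ∀ v w, A1 v w = A1 w v) (M2 N2 Rp : Fin k ⊕ Fin l → Fin k → Euc q)
    (Rs : Fin k ⊕ Fin l → Fin k → Euc d)
    (hN2 : ∀ a i, N2 a i = M2 a i + Rp a i - A (Rs a i)
      + (2 : ℝ) • A1 (e a) (K (e a) (e (.inl i))) + A (D2 a i))
    (hRs : ∀ i b, ∑ a, g (Rs a i) (e b) = -ric i b)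
    (C : Fin k ⊕ Fin l → Fin k ⊕ Fin l → Euc q)
    (CF : ∀ a i, C a (.inl i) = A1 (e a) (e (.inl i)) + A (K (e a) (e (.inl i))))
    (CN : ∀ a j, C a (.inr j) = A (K (e a) (e (.inr j)))) :
    ∑ i, h (∑ a, M2 a i) (A (e (.inl i))) - ∑ a, ((∑ i, h (N2 a i) (A (e (.inl i))))
        + ∑ b, h (C a b) (C a b))
      = -(∑ i, ∑ a, h (Rp a i) (A (e (.inl i))))
        - ∑ i, ∑ i', ric i (.inl i') * h (A (e (.inl i))) (A (e (.inl i')))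
        - ∑ i, ∑ j, h (C (.inr j) (.inl i) + C (.inl i) (.inr j))
            (C (.inr j) (.inl i) + C (.inl i) (.inr j))
        - ∑ i, ∑ i', h (C (.inl i) (.inl i')) (C (.inl i) (.inl i'))
        + ∑ j, ∑ j', h (C (.inr j) (.inr j')) (C (.inr j) (.inr j'))
        + 2 * ∑ i, ∑ j, h (C (.inl i) (.inr j)) (C (.inl i) (.inr j)) := by
  have exp : ∀ (S : Euc d →L[ℝ] Euc q) (v : Euc d), S v = ∑ i, g v (e (.inl i)) • S (e (.inl i))
      + ∑ j, g v (e (.inr j)) • S (e (.inr j)) := by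
    intro S v
    conv_lhs => rw [← he.sum_smul v, Fintype.sum_sum_type]
    simp only [map_add, map_sum, map_smul, hg v]
  have expF : ∀ (S : Euc d →L[ℝ] Euc q) w i, S (K w (e (.inl i)))
      = ∑ j, g (K w (e (.inl i))) (e (.inr j)) • S (e (.inr j)) := by
    intro S w i
    rw [exp S]
    simp [KF]
  have expN : ∀ (S : Euc d →L[ℝ] Euc q) w j, S (K w (e (.inr j)))
      = ∑ i, g (K w (e (.inr j))) (e (.inl i)) • S (e (.inl i)) := by
    intro S w i
    rw [exp S]
    simp [KN]
  -- `K w` is self-adjoint and exchanges the two blocks, so a sum over tangential indices becomes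
  -- one over normal indices.
  have swap : ∀ (S : Euc d →L[ℝ] Euc q) w, ∑ i, h (S (K w (e (.inl i)))) (A (e (.inl i)))
      = ∑ j, h (S (e (.inr j))) (A (K w (e (.inr j)))) := by
    intro S w
    simp only [expF S, expN A, map_sum, map_smul, sum_apply, smul_apply]
    rw [Finset.sum_comm]
    refine Finset.sum_congr rfl fun j _ => Finset.sum_congr rfl fun i _ => ?_
    rw [Ks, hg]
  -- the terms `A1 (K ·)`
  have t1 : ∑ a, ∑ i, h (A1 (e a) (K (e a) (e (.inl i)))) (A (e (.inl i)))
      = ∑ i, ∑ j, (h (C (.inr j) (.inl i)) (C (.inl i) (.inr j))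
        - h (A (K (e (.inr j)) (e (.inl i)))) (A (K (e (.inl i)) (e (.inr j))))) := by
    simp_rw [fun a => swap (A1 (e a)) (e a)]
    rw [Fintype.sum_sum_type]
    -- A symmetric form is contracted with a skew one; here the bundle-like condition removes the
    -- purely normal part.
    have z1 : ∑ c : Fin l, ∑ j, h (A1 (e (.inr c)) (e (.inr j)))
        (A (K (e (.inr c)) (e (.inr j)))) = 0 := by
      have z2 : ∑ c : Fin l, ∑ j, h (A1 (e (.inr c)) (e (.inr j)))
          (A (K (e (.inr c)) (e (.inr j)))) = -∑ c : Fin l, ∑ j,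
          h (A1 (e (.inr c)) (e (.inr j))) (A (K (e (.inr c)) (e (.inr j)))) := by
        conv_lhs => rw [Finset.sum_comm]
        simp only [← Finset.sum_neg_distrib]
        refine Finset.sum_congr rfl fun c _ => Finset.sum_congr rfl fun j _ => ?_
        rw [Kb j c, A1s, map_neg, map_neg]
      linarith
    rw [z1, add_zero]
    refine Finset.sum_congr rfl fun i _ => Finset.sum_congr rfl fun j _ => ?_
    rw [CF, CN, map_add, add_apply, A1s]
    ring
  -- the tangential part of the terms `A (D2 ·)`
  have t2 : ∀ a, ∑ i, h (A (K (e a) (K (e a) (e (.inl i))))) (A (e (.inl i)))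
      = ∑ j, h (C a (.inr j)) (C a (.inr j)) := by
    intro a
    have := swap (A.comp (K (e a))) (e a)
    simp only [ContinuousLinearMap.comp_apply] at this
    simp only [this, CN]
  -- The tangential part of `D2` is −2 K², and K² preserves the tangential block (`zN`), so it can
  -- be written without expanding in the basis.
  have FF : ∀ a i, ∑ i', g (D2 a i) (e (.inl i')) • A (e (.inl i'))
      = -((2 : ℝ) • A (K (e a) (K (e a) (e (.inl i))))) := by
    intro a i
    have zN : ∀ j, g (K (e a) (K (e a) (e (.inl i)))) (e (.inr j)) = 0 := by
      intro j
      rw [Ks]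
      have := he.sum_smul (K (e a) (e (.inr j)))
      rw [← this, Fintype.sum_sum_type]
      simp only [map_add, map_sum, map_smul, KF, hg _ (K (e a) (e (.inr j))), KN]
      simp
    rw [exp A (K (e a) (K (e a) (e (.inl i))))]
    simp [zN, D2F, Finset.smul_sum, mul_smul]
  -- The normal part of `D2` is eliminated with `mixed`. The mixed Ricci term that appears will
  -- cancel the one coming from the curvature of the source in `t5`.
  have t3 : ∑ a, ∑ i, h (A (D2 a i)) (A (e (.inl i)))
      = -(2 * ∑ a, ∑ j, h (C a (.inr j)) (C a (.inr j)))
        + ∑ i, ∑ j, (2 * ∑ c, g (K (K (e (.inr c)) (e (.inr j))) (e (.inr c))) (e (.inl i))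
          - ric i (.inr j)) * h (A (e (.inr j))) (A (e (.inl i))) := by
    have s1 : ∀ a i, h (A (D2 a i)) (A (e (.inl i)))
        = -(2 * h (A (K (e a) (K (e a) (e (.inl i))))) (A (e (.inl i))))
          + ∑ j, g (D2 a i) (e (.inr j)) * h (A (e (.inr j))) (A (e (.inl i))) := by
      intro a i
      rw [exp A (D2 a i), FF]
      simp
    simp only [s1, Finset.sum_add_distrib, Finset.sum_neg_distrib, ← Finset.mul_sum, t2]
    congr 1
    rw [Finset.sum_comm]
    refine Finset.sum_congr rfl fun i _ => ?_
    rw [Finset.sum_comm]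
    refine Finset.sum_congr rfl fun j _ => ?_
    rw [← Finset.sum_mul, ← mixed]
    ring
  -- The quadratic term of `mixed` is, once contracted with A, the product already met in `t1`; the
  -- two cancel in the total.
  have t4 : ∑ i, ∑ j, (∑ c, g (K (K (e (.inr c)) (e (.inr j))) (e (.inr c))) (e (.inl i)))
        * h (A (e (.inr j))) (A (e (.inl i)))
      = ∑ i, ∑ j, h (A (K (e (.inr j)) (e (.inl i)))) (A (K (e (.inl i)) (e (.inr j)))) := by
    have s1 : ∀ c j i, g (K (K (e (.inr c)) (e (.inr j))) (e (.inr c))) (e (.inl i))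
        = ∑ p, g (K (e (.inr c)) (e (.inl p))) (e (.inr j))
          * g (K (e (.inl p)) (e (.inr c))) (e (.inl i)) := by
      intro c j i
      conv_lhs => rw [← he.sum_smul (K (e (.inr c)) (e (.inr j))), Fintype.sum_sum_type]
      simp only [hg _ (K (e (.inr c)) (e (.inr j))), KN, zero_smul, Finset.sum_const_zero,
        add_zero, map_sum, map_smul, sum_apply, smul_apply, smul_eq_mul]
      refine Finset.sum_congr rfl fun p _ => ?_
      rw [Ks, hg (e _)]
    simp only [s1, expF A, expN A, map_sum, map_smul, sum_apply, smul_apply, smul_eq_mul,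
      Finset.sum_mul, Finset.mul_sum]
    have reorder : ∀ F : Fin k → Fin l → Fin l → Fin k → ℝ,
        ∑ i, ∑ j, ∑ c, ∑ p, F i j c p = ∑ p, ∑ c, ∑ i, ∑ j, F i j c p := by
      intro F
      rw [Finset.sum_congr rfl fun i _ => (Finset.sum_congr rfl fun j _ =>
        Finset.sum_comm).trans Finset.sum_comm, Finset.sum_comm]
      refine Finset.sum_congr rfl fun p _ => ?_
      rw [Finset.sum_congr rfl fun i _ => Finset.sum_comm, Finset.sum_comm]
    rw [reorder]
    refine Finset.sum_congr rfl fun p _ => Finset.sum_congr rfl fun c _ =>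
      Finset.sum_congr rfl fun i _ => Finset.sum_congr rfl fun j _ => ?_
    ring
  have t5 : ∑ a, ∑ i, h (A (Rs a i)) (A (e (.inl i)))
      = -(∑ i, ∑ i', ric i (.inl i') * h (A (e (.inl i))) (A (e (.inl i'))))
        - ∑ i, ∑ j, ric i (.inr j) * h (A (e (.inr j))) (A (e (.inl i))) := by
    rw [Finset.sum_comm, ← Finset.sum_neg_distrib, ← Finset.sum_sub_distrib]
    refine Finset.sum_congr rfl fun i _ => ?_
    simp only [exp A (Rs _ i), map_add, map_sum, map_smul, add_apply, sum_apply, smul_apply,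
      smul_eq_mul, Finset.sum_add_distrib]
    rw [Finset.sum_comm, Finset.sum_comm (s := Finset.univ (α := Fin k ⊕ Fin l))
      (t := Finset.univ (α := Fin l))]
    simp only [← Finset.sum_mul, hRs, neg_mul, Finset.sum_neg_distrib, sub_eq_add_neg]
    congr 2
    refine Finset.sum_congr rfl fun i' _ => ?_
    rw [hh]
  have t6 : ∑ i, ∑ j, (2 * ∑ c, g (K (K (e (.inr c)) (e (.inr j))) (e (.inr c))) (e (.inl i))
          - ric i (.inr j)) * h (A (e (.inr j))) (A (e (.inl i)))
      = 2 * ∑ i, ∑ j, h (A (K (e (.inr j)) (e (.inl i)))) (A (K (e (.inl i)) (e (.inr j))))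
        - ∑ i, ∑ j, ric i (.inr j) * h (A (e (.inr j))) (A (e (.inl i))) := by
    rw [← t4]
    simp only [sub_mul, Finset.sum_sub_distrib, mul_assoc, ← Finset.mul_sum]
  -- The factor 2 of the middle term is what matches the 2 in `mixed`, and the cross term 2⟨C_ji,
  -- C_ij⟩ left over completes the square in `R1`.
  have L : ∑ a, ∑ i, h (N2 a i) (A (e (.inl i))) = ∑ i, h (∑ a, M2 a i) (A (e (.inl i)))
      + ∑ i, ∑ a, h (Rp a i) (A (e (.inl i))) - ∑ a, ∑ i, h (A (Rs a i)) (A (e (.inl i)))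
      + 2 * ∑ a, ∑ i, h (A1 (e a) (K (e a) (e (.inl i)))) (A (e (.inl i)))
      + ∑ a, ∑ i, h (A (D2 a i)) (A (e (.inl i))) := by
    simp only [hN2, map_add, map_sub, map_smul, add_apply, sub_apply, smul_apply, smul_eq_mul,
      Finset.sum_add_distrib, Finset.sum_sub_distrib, map_sum, sum_apply, ← Finset.mul_sum]
    rw [Finset.sum_comm, Finset.sum_comm (f := fun a i => h (Rp a i) (A (e (.inl i))))]
  have R1 : ∑ i, ∑ j, h (C (.inr j) (.inl i) + C (.inl i) (.inr j))
            (C (.inr j) (.inl i) + C (.inl i) (.inr j))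
      = ∑ j, ∑ i, h (C (.inr j) (.inl i)) (C (.inr j) (.inl i))
        + 2 * ∑ i, ∑ j, h (C (.inr j) (.inl i)) (C (.inl i) (.inr j))
        + ∑ i, ∑ j, h (C (.inl i) (.inr j)) (C (.inl i) (.inr j)) := by
    rw [Finset.sum_comm (s := Finset.univ (α := Fin l))]
    simp only [Finset.mul_sum, ← Finset.sum_add_distrib]
    refine Finset.sum_congr rfl fun i _ => Finset.sum_congr rfl fun j _ => ?_
    simp only [map_add, add_apply]
    rw [hh (C (.inl i) (.inr j)) (C (.inr j) (.inl i))]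
    ring
  simp only [Finset.sum_add_distrib] at L ⊢
  rw [L, t1, t3, t5, t6, R1]
  simp only [Fintype.sum_sum_type, Finset.sum_add_distrib, Finset.sum_sub_distrib]
  ring

end Algebra

/-! ### Multilinearity of curvature and second derivatives, iterated traces. -/

section Linearity

variable {E W : Type*} [NormedAddCommGroup E] [NormedSpace ℝ E]
  [NormedAddCommGroup W] [NormedSpace ℝ W]
  (Γ : E → E →L[ℝ] E →L[ℝ] E) (κ : E → E →L[ℝ] W →L[ℝ] W) (A : E → E →L[ℝ] W) (z : E)

/-- The curvature as a trilinear map. -/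
def curvL : E →ₗ[ℝ] E →ₗ[ℝ] W →ₗ[ℝ] W :=
  LinearMap.mk₂ ℝ (fun v w => (fderiv ℝ κ z v w - fderiv ℝ κ z w v + (κ z v).comp (κ z w)
      - (κ z w).comp (κ z v)).toLinearMap)
    (by intros; ext1; simp; abel) (by intros; ext1; simp [smul_sub])
    (by intros; ext1; simp; abel) (by intros; ext1; simp [smul_sub])

theorem curv_eq (v w : E) (s : W) : curv κ z v w s = curvL κ z v w s := rfl

/-- The second covariant derivative as a trilinear map. -/
def cov2L : E →ₗ[ℝ] E →ₗ[ℝ] E →ₗ[ℝ] W :=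
  LinearMap.mk₂ ℝ (fun w' w => (fderiv ℝ (cov1 Γ κ A) z w' w + (κ z w').comp (cov1 Γ κ A z w)
      - cov1 Γ κ A z (Γ z w' w) - (cov1 Γ κ A z w).comp (Γ z w')).toLinearMap)
    (by intros; ext1; simp; abel) (by intros; ext1; simp [smul_sub])
    (by intros; ext1; simp; abel) (by intros; ext1; simp [smul_sub])

theorem cov2_eq (w' w v : E) : cov2 Γ κ A z w' w v = cov2L Γ κ A z w' w v := rfl

end Linearity

section Traces

variable {d q : ℕ} {V : Type*} [AddCommGroup V] [Module ℝ V]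
  {b : Euc d →L[ℝ] Euc d →L[ℝ] ℝ} {ι : Type*} [Fintype ι] [DecidableEq ι]
  {e : Module.Basis ι ℝ (Euc d)}

theorem metricTrace_metricTrace (he : IsOrtho b e) {F : Euc d → Euc d → Euc d → Euc d → V}
    (h₁ : ∀ v v', Bilin (F v v')) (h₂ : ∀ w w', Bilin fun v v' => F v v' w w') :
    metricTrace b (fun v v' => metricTrace b (F v v')) = ∑ a, ∑ c, F (e a) (e a) (e c) (e c) := by
  simp_rw [fun v v' => metricTrace_eq_sum he (h₁ v v')]
  rw [metricTrace_eq_sum he]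
  constructor <;> intros
  · rw [← Finset.sum_add_distrib]
    exact Finset.sum_congr rfl fun c _ => (h₂ _ _).add_left _ _ _
  · rw [Finset.smul_sum]
    exact Finset.sum_congr rfl fun c _ => (h₂ _ _).smul_left _ _ _
  · rw [← Finset.sum_add_distrib]
    exact Finset.sum_congr rfl fun c _ => (h₂ _ _).add_right _ _ _
  · rw [Finset.smul_sum]
    exact Finset.sum_congr rfl fun c _ => (h₂ _ _).smul_right _ _ _

theorem normSq₂_eq_sum (he : IsOrtho b e) (c : Euc q →L[ℝ] Euc q →L[ℝ] ℝ)
    {S : Euc d → Euc d → Euc q} (hS : Bilin S) :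
    normSq₂ b c S = ∑ a, ∑ a', c (S (e a) (e a')) (S (e a) (e a')) := by
  refine metricTrace_metricTrace he (fun v v' => ?_) fun w w' => ?_ <;> constructor <;> intros <;>
  simp [hS.add_left, hS.add_right, hS.smul_left, hS.smul_right]

end Traces

namespace Coord

variable {d q : ℕ}
  (G : Euc d → Euc d →L[ℝ] Euc d →L[ℝ] ℝ) (D : Euc d → Submodule ℝ (Euc d))
  (H : Euc q → Euc q →L[ℝ] Euc q →L[ℝ] ℝ) (u : Euc d → Euc q)

/-- The tangential energy density in coordinates. -/
def energy (z : Euc d) : ℝ :=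
  (1 / 2 : ℝ) * metricTrace (G z) fun v w =>
    H (u z) (fderiv ℝ u z (orthProj (G z) (D z) v)) (fderiv ℝ u z (orthProj (G z) (D z) w))

/-- The right-hand side of the Eells–Sampson type formula in coordinates. -/
def eellsSampsonTerm (z : Euc d) : ℝ :=
  let P := orthProj (G z) (D z)
  let Q := LinearMap.id - P
  let B := covDerivTangential G H u D z
  let df := fun v : Euc d => fderiv ℝ u z v
  let dT := fun v : Euc d => fderiv ℝ u z (P v)
  (metricTrace (G z) fun v v' => metricTrace (G z) fun w w' =>
      H (u z) (curvature H (u z) (dT v) (df w) (df w')) (dT v'))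
    - (metricTrace (G z) fun v v' => metricTrace (G z) fun w w' =>
      ricci G z v w * H (u z) (dT v') (dT w'))
    - normSq₂ (G z) (H (u z)) (fun v w => B (P w) (Q v) + B (Q v) (P w))
    - normSq₂ (G z) (H (u z)) (fun v w => B (P v) (P w))
    + normSq₂ (G z) (H (u z)) (fun v w => B (Q v) (Q w))
    + 2 * normSq₂ (G z) (H (u z)) (fun v w => B (Q v) (P w))

end Coord

/-! ### The Bochner formula in coordinates. -/

section Bochner

open IsTenseOn

variable {d q k l : ℕ} {G : Euc d → Euc d →L[ℝ] Euc d →L[ℝ] ℝ} {D : Euc d → Submodule ℝ (Euc d)}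
  {H : Euc q → Euc q →L[ℝ] Euc q →L[ℝ] ℝ} {U : Set (Euc d)} {V : Set (Euc q)} {u : Euc d → Euc q}
  {z : Euc d} {e : Module.Basis (Fin k ⊕ Fin l) ℝ (Euc d)}

theorem curv_metric_facts (hG : IsMetricOn G U) (hz : z ∈ U) :
    (∀ a b c e, G z (curv (chr G) z a b c) e = -G z (curv (chr G) z a b e) c) ∧
    (∀ a b c e, G z (curv (chr G) z a b c) e = -G z (curv (chr G) z b a c) e) ∧
    ∀ a b c e, G z (curv (chr G) z a b c) e = G z (curv (chr G) z c e a) b := by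
  have hp : ∀ᶠ y in nhds z, IsParallel (chr G) G y := by
    filter_upwards [hG.eventually hz] with y hy
    exact hG.isParallel hy
  refine ⟨fun a b c e => ?_, fun a b c e => ?_, fun a b c e => ?_⟩
  · have := curv_skew hp (hG.smooth z hz) (hG.smooth_chr hz) a b c e
    rw [(hG.inner z hz).1 c] at this
    linear_combination this
  · rw [curv_anti, map_neg, neg_apply]
  · refine curv_pair hp (hG.smooth z hz) (hG.smooth_chr hz) ?_ (hG.inner z hz).1 a b c e
    filter_upwards [hG.eventually hz] with y hy
    exact hG.chr_symm hy

/-- The repeated index of ∇²_{a,a}P is moved by Ricci identities. Along the leaves, differentiated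
integrability turns ∇²_{k,k}P e_i into ∇²_{i,k}P e_k plus curvature; the trace of the latter
derivative is read off the mean curvature by tenseness, and all products of two ∇P cancel. Across
the leaves the differentiated skew symmetry leaves exactly the products on the right. The two
curvature contributions add up to minus the Ricci term. -/
theorem IsTenseOn.mixed (hT : IsTenseOn G D U) (hz : z ∈ U) (he : IsOrtho (G z) e)
    (hF : ∀ i, projD G D z (e (.inl i)) = e (.inl i)) (hN : ∀ j, projD G D z (e (.inr j)) = 0)
    (i : Fin k) (j : Fin l) :
    ∑ a, G z (cov2P G D z (e a) (e a) (e (.inl i))) (e (.inr j))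
      + ∑ a, G z (curv (chr G) z (e a) (e (.inl i)) (e (.inr j))) (e a)
    = 2 * ∑ c, G z (covP G D z (covP G D z (e (.inr c)) (e (.inr j))) (e (.inr c)))
        (e (.inl i)) := by
  have hG := hT.metric
  have hs := (hG.inner z hz).1
  have hQ : ∀ j, projN G D z (e (.inr j)) = e (.inr j) := fun j => by
    rw [projN_apply, hN, sub_zero]
  have hKF : ∀ w x, projD G D z x = x → projD G D z (covP G D z w x) = 0 := by
    intro w x hx
    have := covP_eq hG hT.smooth hz w x
    rw [hx] at this
    exact left_eq_add.1 this
  have hKN : ∀ w x, projD G D z x = 0 → projD G D z (covP G D z w x) = covP G D z w x := by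
    intro w x hx
    have := covP_eq hG hT.smooth hz w x
    rw [hx, map_zero, zero_add] at this
    exact this.symm
  have orth : ∀ x y, projD G D z x = 0 → projD G D z y = y → G z x y = 0 := by
    intro x y hx hy
    rw [← hy, ← proj_symm hG hz, hx, map_zero, zero_apply]
  have orth' : ∀ x y, projD G D z x = 0 → projD G D z y = y → G z y x = 0 := by
    intro x y hx hy
    rw [hs, orth x y hx hy]
  have hKcc : ∀ c, covP G D z (e (.inr c)) (e (.inr c)) = 0 := by
    intro c
    have := hT.bundle z hz (e (.inr c)) (e (.inr c))
    rw [← projN_apply, hQ] at this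
    exact (smul_eq_zero.1 ((two_smul ℝ _).trans (add_eq_zero_iff_eq_neg.2 this))).resolve_left
      two_ne_zero
  have hKcj : ∀ c j, covP G D z (e (.inr c)) (e (.inr j))
      = -covP G D z (e (.inr j)) (e (.inr c)) := by
    intro c j
    have := hT.bundle z hz (e (.inr c)) (e (.inr j))
    rw [← projN_apply, ← projN_apply, hQ, hQ] at this
    exact this
  obtain ⟨R1, R2, R3⟩ := curv_metric_facts hG hz
  have comm := fun w' w v => cov2_comm (A := projD G D) (hG.smooth_chr hz) (hG.smooth_chr hz)
    (hT.smooth z hz) (hG.chr_symm hz) w' w v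
  -- leafwise terms
  have F1 : ∀ k, G z (cov2P G D z (e (.inl k)) (e (.inl k)) (e (.inl i))) (e (.inr j))
      = G z (cov2P G D z (e (.inl i)) (e (.inl k)) (e (.inl k))) (e (.inr j))
        - G z (curv (chr G) z (e (.inl k)) (e (.inl i)) (e (.inr j))) (e (.inl k))
        + G z (covP G D z (covP G D z (e (.inl k)) (e (.inl i))) (e (.inl k))) (e (.inr j))
        - G z (covP G D z (covP G D z (e (.inl k)) (e (.inl k))) (e (.inl i))) (e (.inr j)) := by
    intro k
    have h1 := congrArg (fun v => G z v (e (.inr j)))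
      (hT.deriv_invol hz (e (.inl k)) (e (.inl k)) (e (.inl i)))
    have h2 := congrArg (fun v => G z v (e (.inr j))) (comm (e (.inl k)) (e (.inl i)) (e (.inl k)))
    simp only [hF, map_add, map_sub, add_apply, sub_apply] at h1 h2
    have h3 := orth' (e (.inr j)) _ (hN j) (hKN (e (.inl k)) _ (hKF (e (.inl k)) _ (hF i)))
    have h4 := orth' (e (.inr j)) _ (hN j) (hKN (e (.inl i)) _ (hKF (e (.inl k)) _ (hF k)))
    have h5 := orth' (e (.inr j)) (projD G D z (curv (chr G) z (e (.inl k)) (e (.inl i))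
      (e (.inl k)))) (hN j) (proj_idem hG hz _)
    have h6 := R1 (e (.inl k)) (e (.inl i)) (e (.inl k)) (e (.inr j))
    linarith
  -- With τ the mean curvature, tenseness says that ∇_{e_i}τ and (∇_τ P)e_i have the same normal
  -- part; both are expanded as traces over the leaf.
  have F2 : ∑ k, G z (cov2P G D z (e (.inl i)) (e (.inl k)) (e (.inl k))) (e (.inr j))
      = ∑ k, G z (covP G D z (covP G D z (e (.inl k)) (e (.inl k))) (e (.inl i))) (e (.inr j))
        - ∑ k, G z (covP G D z (covP G D z (e (.inl k)) (e (.inl i))) (e (.inl k)))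
          (e (.inr j)) := by
    have h1 := hT.nab_meanCurvature hz (e (.inl i))
    rw [metricTrace_eq_sum he (by
      constructor <;> intros <;> simp only [cov2P, cov2_eq, map_add, map_smul, add_apply,
        smul_apply, LinearMap.add_apply, LinearMap.smul_apply] <;> module)] at h1
    rw [Fintype.sum_sum_type] at h1
    have h0 : ∀ w c, cov2P G D z w 0 c = 0 := fun w c => by
      rw [cov2P, cov2_eq, map_zero, LinearMap.zero_apply]
    simp only [hF, hN, map_zero, zero_apply, h0, add_zero, Finset.sum_const_zero] at h1
    have h2 := meanCurvature_eq hG hT.smooth hz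
    rw [metricTrace_eq_sum he (by
      constructor <;> intros <;> simp only [map_add, map_smul, add_apply, smul_apply]),
      Fintype.sum_sum_type] at h2
    simp only [hF, hN, map_zero, Finset.sum_const_zero, add_zero] at h2
    have h3 := hT.tense z hz (e (.inl i))
    rw [hF] at h3
    have h4 := orth' (e (.inr j)) _ (hN j) h3
    rw [h1, h2] at h4
    simp only [map_sub, map_sum, map_add, sub_apply, sum_apply, add_apply,
      Finset.sum_add_distrib] at h4
    have h5 : ∀ k, G z (covP G D z (e (.inl k)) (covP G D z (e (.inl i)) (e (.inl k))))
        (e (.inr j)) = 0 := fun k =>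
      orth' (e (.inr j)) _ (hN j) (hKN (e (.inl k)) _ (hKF (e (.inl i)) _ (hF k)))
    have h6 : ∀ k, covP G D z (e (.inl i)) (e (.inl k)) = covP G D z (e (.inl k)) (e (.inl i)) := by
      intro k
      have := hT.invol z hz (e (.inl i)) (e (.inl k))
      rwa [hF, hF] at this
    simp only [h5, Finset.sum_const_zero, add_zero] at h4
    simp only [h6] at h4
    linarith
  -- transverse terms
  have N1 : ∀ c, G z (cov2P G D z (e (.inr c)) (e (.inr c)) (e (.inl i))) (e (.inr j))
      = 2 * G z (covP G D z (covP G D z (e (.inr c)) (e (.inr j))) (e (.inr c))) (e (.inl i))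
        - G z (curv (chr G) z (e (.inr c)) (e (.inl i)) (e (.inr j))) (e (.inr c)) := by
    intro c
    -- Three exchanges: skew symmetry relates ∇²_{c,c}P e_j to ∇²_{c,j}P e_c (`h1`), the Ricci
    -- identity relates the latter to ∇²_{j,c}P e_c (`h3`), and this last one is determined because
    -- it is opposite to itself up to products of ∇P (`h2`).
    have h1 := congrArg (fun v => G z v (e (.inl i)))
      (hT.deriv_bundle hz (e (.inr c)) (e (.inr c)) (e (.inr j)))
    have h2 := congrArg (fun v => G z v (e (.inl i)))
      (hT.deriv_bundle hz (e (.inr j)) (e (.inr c)) (e (.inr c)))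
    have h3 := congrArg (fun v => G z v (e (.inl i))) (comm (e (.inr c)) (e (.inr j)) (e (.inr c)))
    simp only [hQ, hN, hKcc, map_zero, zero_apply, map_sub, map_neg, neg_apply, sub_apply,
      sub_zero] at h1 h2 h3
    have h4 := orth _ (e (.inl i)) (hKF (e (.inr c)) _ (hKN (e (.inr c)) _ (hN j))) (hF i)
    have h5 := orth _ (e (.inl i)) (hKF (e (.inr c)) _ (hKN (e (.inr j)) _ (hN c))) (hF i)
    have h6 : G z (covP G D z (covP G D z (e (.inr j)) (e (.inr c))) (e (.inr c))) (e (.inl i))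
        = -G z (covP G D z (covP G D z (e (.inr c)) (e (.inr j))) (e (.inr c))) (e (.inl i)) := by
      rw [hKcj j c]
      simp only [map_neg, neg_apply]
    have h7 := hT.cov2P_symm hz (e (.inr c)) (e (.inr c)) (e (.inl i)) (e (.inr j))
    rw [hs (e (.inl i))] at h7
    have h8 : G z (projD G D z (curv (chr G) z (e (.inr c)) (e (.inr j)) (e (.inr c))))
        (e (.inl i)) = G z (curv (chr G) z (e (.inr c)) (e (.inr j)) (e (.inr c))) (e (.inl i)) := by
      rw [proj_symm hG hz, hF]
    have h9 := R3 (e (.inr c)) (e (.inr j)) (e (.inr c)) (e (.inl i))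
    have h10 := R1 (e (.inr c)) (e (.inl i)) (e (.inr c)) (e (.inr j))
    have h11 : curv (chr G) z (e (.inr c)) (e (.inr j)) 0 = 0 := by
      rw [curv_eq, map_zero]
    rw [h11, map_zero, zero_apply] at h3
    linarith
  rw [Fintype.sum_sum_type, Fintype.sum_sum_type]
  simp only [F1, N1, Finset.sum_add_distrib, Finset.sum_sub_distrib, F2, ← Finset.mul_sum]
  ring

/-- The symmetry of ∇du holds on `U` and is differentiated. -/
theorem cov2_symm (hT : IsMetricOn G U) (hz : z ∈ U) (hH : IsMetricOn H V)
    (hu : ∀ y ∈ U, ContDiffAt ℝ ∞ u y) (huV : ∀ y ∈ U, u y ∈ V) (w' w v : Euc d) :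
    cov2 (chr G) (pull H u) (fderiv ℝ u) z w' w v
      = cov2 (chr G) (pull H u) (fderiv ℝ u) z w' v w := by
  have h1 := ContDiffAt.diff (contDiffAt_cov1 (hT.smooth_chr hz)
    (smooth_pull hH (hu z hz) (huV z hz)) (ContDiffAt.fderiv_infty (hu z hz)))
  rw [cov2_eq_covB, cov2_eq_covB, covB_swap h1 1, one_smul]
  filter_upwards [hT.eventually hz] with y hy v w
  rw [one_smul]
  exact cov1_fderiv_symm hT hy hH (hu y hy) (huV y hy) w v

theorem nab_tension (hG : IsMetricOn G U) (hz : z ∈ U) (hH : IsMetricOn H V)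
    (hu : ∀ y ∈ U, ContDiffAt ℝ ∞ u y) (huV : ∀ y ∈ U, u y ∈ V) (w : Euc d) :
    nab (pull H u) (Coord.tension G H u) z w
      = metricTrace (G z) fun v v' => cov2 (chr G) (pull H u) (fderiv ℝ u) z w v v' := by
  have h1 := ContDiffAt.diff (contDiffAt_cov1 (hG.smooth_chr hz)
    (smooth_pull hH (hu z hz) (huV z hz)) (ContDiffAt.fderiv_infty (hu z hz)))
  have e : Coord.tension G H u =ᶠ[nhds z] fun y => metricTrace (G y) fun v w =>
      cov1 (chr G) (pull H u) (fderiv ℝ u) y v w := by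
    filter_upwards [hG.eventually hz] with y hy
    exact tension_eq hG hy hH (hu y hy) (huV y hy)
  rw [nab, e.fderiv_eq, e.self_of_nhds]
  exact nab_metricTrace hG hz (pull H u) h1 w

end Bochner

section Bochner

open IsTenseOn

variable {d q : ℕ} {G : Euc d → Euc d →L[ℝ] Euc d →L[ℝ] ℝ} {D : Euc d → Submodule ℝ (Euc d)}
  {H : Euc q → Euc q →L[ℝ] Euc q →L[ℝ] ℝ} {U : Set (Euc d)} {V : Set (Euc q)} {u : Euc d → Euc q}
  {z : Euc d}

/-- The differential of `u` restricted to the distribution. -/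
def tanDiff (G : Euc d → Euc d →L[ℝ] Euc d →L[ℝ] ℝ) (D : Euc d → Submodule ℝ (Euc d))
    (u : Euc d → Euc q) (z : Euc d) : Euc d →L[ℝ] Euc q :=
  (fderiv ℝ u z).comp (projD G D z)

/-- The covariant derivative of the restriction of the differential. -/
abbrev covT (G : Euc d → Euc d →L[ℝ] Euc d →L[ℝ] ℝ) (D : Euc d → Submodule ℝ (Euc d))
    (H : Euc q → Euc q →L[ℝ] Euc q →L[ℝ] ℝ) (u : Euc d → Euc q) (z : Euc d) :
    Euc d →L[ℝ] Euc d →L[ℝ] Euc q :=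
  cov1 (chr G) (pull H u) (tanDiff G D u) z

theorem smooth_tanDiff (hu : ContDiffAt ℝ ∞ u z) (hP : ContDiffAt ℝ ∞ (projD G D) z) :
    ContDiffAt ℝ ∞ (tanDiff G D u) z :=
  (ContDiffAt.fderiv_infty hu).clm_comp hP

theorem covDerivTangential_eq (hG : IsMetricOn G U) (hz : z ∈ U) (hH : IsMetricOn H V)
    (hz' : u z ∈ V) (hu : ContDiffAt ℝ ∞ u z) (hP : ContDiffAt ℝ ∞ (projD G D) z) (v w : Euc d) :
    Coord.covDerivTangential G H u D z v w = covT G D H u z w v :=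
  covDerivOneForm_eq hG hz hH hz' (ContDiffAt.diff (smooth_tanDiff hu hP)) v w

theorem ricci_eq (hG : IsMetricOn G U) (hz : z ∈ U) {ι : Type*} [Fintype ι] [DecidableEq ι]
    {e : Module.Basis ι ℝ (Euc d)} (he : IsOrtho (G z) e) (v w : Euc d) :
    Coord.ricci G z v w = ∑ a, G z (curv (chr G) z (e a) v w) (e a) := by
  simp only [Coord.ricci, curvature_eq hG hz, curv_eq]
  rw [metricTrace_eq_sum he]
  constructor <;> intros <;> simp

theorem IsTenseOn.laplacian_energy_eq (hT : IsTenseOn G D U) (hz : z ∈ U) (hH : IsMetricOn H V)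
    (hu : ∀ y ∈ U, ContDiffAt ℝ ∞ u y) (huV : ∀ y ∈ U, u y ∈ V) {k l : ℕ} {e : Module.Basis (Fin k ⊕ Fin l) ℝ (Euc d)}
    (he : IsOrtho (G z) e) (hF : ∀ i, projD G D z (e (.inl i)) = e (.inl i))
    (hN : ∀ j, projD G D z (e (.inr j)) = 0) :
    Coord.laplacian G (Coord.energy G D H u) z = -∑ a,
      ((∑ i, H (u z) (cov2 (chr G) (pull H u) (tanDiff G D u) z (e a) (e a) (e (.inl i)))
          (fderiv ℝ u z (e (.inl i))))
        + ∑ b, H (u z) (covT G D H u z (e a) (e b)) (covT G D H u z (e a) (e b))) := by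
  have hG := hT.metric
  have hh : ∀ y ∈ U, ∀ s s', H (u y) s s' = H (u y) s' s := fun y hy =>
    (hH.inner _ (huV y hy)).1
  have hs := (hG.inner z hz).1
  have hα : ∀ y ∈ U, ContDiffAt ℝ ∞ (tanDiff G D u) y := fun y hy =>
    smooth_tanDiff (hu y hy) (hT.smooth y hy)
  have hκ : ∀ y ∈ U, ContDiffAt ℝ ∞ (pull H u) y := fun y hy =>
    smooth_pull hH (hu y hy) (huV y hy)
  have hA : ∀ y ∈ U, ContDiffAt ℝ ∞ (fderiv ℝ u) y := fun y hy =>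
    ContDiffAt.fderiv_infty (hu y hy)
  have lap := laplacian_energy hG hz (κ := pull H u) (h := fun y => H (u y))
    (fun y hy => pull_parallel hH (hu y hy) (huV y hy))
    (fun y hy => (hH.smooth _ (huV y hy)).comp y (hu y hy)) hh hκ hα
  rw [metricTrace_metricTrace he (fun v v' => by
      constructor <;> intros <;> simp only [cov2_eq, map_add, map_smul, add_apply,
        smul_apply, smul_eq_mul, LinearMap.add_apply, LinearMap.smul_apply] <;> ring)
    (fun w w' => by
      constructor <;> intros <;> simp only [cov2_eq, map_add, map_smul, add_apply,
        smul_apply, smul_eq_mul, LinearMap.add_apply, LinearMap.smul_apply] <;> ring)] at lap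
  refine lap.trans ?_
  congr 1
  refine Finset.sum_congr rfl fun a _ => ?_
  rw [Finset.sum_add_distrib]
  congr 1
  rw [Fintype.sum_sum_type]
  simp [tanDiff, hF, hN]

theorem IsTenseOn.trace_nab_tension (hT : IsTenseOn G D U) (hz : z ∈ U) (hH : IsMetricOn H V)
    (hu : ∀ y ∈ U, ContDiffAt ℝ ∞ u y) (huV : ∀ y ∈ U, u y ∈ V) {k l : ℕ} {e : Module.Basis (Fin k ⊕ Fin l) ℝ (Euc d)}
    (he : IsOrtho (G z) e) (hF : ∀ i, projD G D z (e (.inl i)) = e (.inl i))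
    (hN : ∀ j, projD G D z (e (.inr j)) = 0) :
    (metricTrace (G z) fun v v' => H (u z) (nab (pull H u) (Coord.tension G H u) z
        (projD G D z v)) (tanDiff G D u z v'))
      = ∑ i, H (u z) (∑ a, cov2 (chr G) (pull H u) (fderiv ℝ u) z (e (.inl i)) (e a) (e a))
          (fderiv ℝ u z (e (.inl i))) := by
  have hG := hT.metric
  have h1 : ∀ w, nab (pull H u) (Coord.tension G H u) z w
      = ∑ a, cov2L (chr G) (pull H u) (fderiv ℝ u) z w (e a) (e a) := by
    intro w
    rw [nab_tension hG hz hH hu huV, metricTrace_eq_sum he]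
    · rfl
    · constructor <;> intros <;> simp only [cov2_eq, map_add, map_smul, LinearMap.add_apply,
        LinearMap.smul_apply]
  simp only [h1]
  rw [metricTrace_eq_sum he, Fintype.sum_sum_type]
  · simp only [tanDiff, ContinuousLinearMap.comp_apply, hF, hN, map_zero, Finset.sum_const_zero,
      add_zero, cov2_eq]
  · constructor <;> intros <;> simp only [map_add, map_smul, add_apply, smul_apply,
      LinearMap.add_apply, LinearMap.smul_apply, Finset.sum_add_distrib, ← Finset.smul_sum]

theorem IsTenseOn.eellsSampsonTerm_eq (hT : IsTenseOn G D U) (hz : z ∈ U) (hH : IsMetricOn H V)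
    (hu : ∀ y ∈ U, ContDiffAt ℝ ∞ u y) (huV : ∀ y ∈ U, u y ∈ V) {k l : ℕ} {e : Module.Basis (Fin k ⊕ Fin l) ℝ (Euc d)}
    (he : IsOrtho (G z) e) (hF : ∀ i, projD G D z (e (.inl i)) = e (.inl i))
    (hN : ∀ j, projD G D z (e (.inr j)) = 0) :
    Coord.eellsSampsonTerm G D H u z = -(∑ i, ∑ a, H (u z) (curv (pull H u) z (e a) (e (.inl i)) (fderiv ℝ u z (e a)))
          (fderiv ℝ u z (e (.inl i))))
        - ∑ i, ∑ i', Coord.ricci G z (e (.inl i)) (e (.inl i'))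
            * H (u z) (fderiv ℝ u z (e (.inl i))) (fderiv ℝ u z (e (.inl i')))
        - ∑ i, ∑ j, H (u z) (covT G D H u z (e (.inr j)) (e (.inl i)) + covT G D H u z (e (.inl i)) (e (.inr j)))
            (covT G D H u z (e (.inr j)) (e (.inl i)) + covT G D H u z (e (.inl i)) (e (.inr j)))
        - ∑ i, ∑ i', H (u z) (covT G D H u z (e (.inl i)) (e (.inl i')))
            (covT G D H u z (e (.inl i)) (e (.inl i')))
        + ∑ j, ∑ j', H (u z) (covT G D H u z (e (.inr j)) (e (.inr j')))
            (covT G D H u z (e (.inr j)) (e (.inr j')))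
        + 2 * ∑ i, ∑ j, H (u z) (covT G D H u z (e (.inl i)) (e (.inr j)))
            (covT G D H u z (e (.inl i)) (e (.inr j))) := by
  have hG := hT.metric
  have hcov : ∀ v w, Coord.covDerivTangential G H u D z v w = covT G D H u z w v :=
    covDerivTangential_eq hG hz hH (huV z hz) (hu z hz) (hT.smooth z hz)
  have hcurv : ∀ v w s, Coord.curvature H (u z) (fderiv ℝ u z v) (fderiv ℝ u z w) s
      = curvL (pull H u) z v w s := fun v w s =>
    (curv_pull hH (hu z hz) (huV z hz) v w s).symm
  have hric : ∀ v w, Coord.ricci G z v w = ∑ a, G z (curvL (chr G) z (e a) v w) (e a) :=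
    fun v w => ricci_eq hG hz he v w
  have hPQ : ∀ v, (LinearMap.id - orthProj (G z) (D z) : Euc d →ₗ[ℝ] Euc d) v = projN G D z v := fun v => rfl
  have hQF : ∀ i, projN G D z (e (.inl i)) = 0 := fun i => by rw [projN_apply, hF, sub_self]
  have hQN : ∀ j, projN G D z (e (.inr j)) = e (.inr j) := fun j => by
    rw [projN_apply, hN, sub_zero]
  simp only [Coord.eellsSampsonTerm, hcov, hcurv, hPQ, ← projD_apply]
  rw [normSq₂_eq_sum he _ (by constructor <;> intros <;> simp <;> abel),
    normSq₂_eq_sum he _ (by constructor <;> intros <;> simp),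
    normSq₂_eq_sum he _ (by constructor <;> intros <;> simp),
    normSq₂_eq_sum he _ (by constructor <;> intros <;> simp),
    metricTrace_metricTrace he (fun v v' => by constructor <;> intros <;> simp)
      (fun v v' => by constructor <;> intros <;> simp),
    metricTrace_metricTrace he
      (fun v v' => by
        constructor <;> intros <;> simp only [hric, map_add, map_smul,
          add_apply, smul_apply, LinearMap.add_apply, LinearMap.smul_apply, smul_eq_mul,
          Finset.sum_add_distrib, ← Finset.mul_sum] <;> ring)
      (fun v v' => by
        constructor <;> intros <;> simp only [hric, map_add, map_smul,
          add_apply, smul_apply, LinearMap.add_apply, LinearMap.smul_apply, smul_eq_mul,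
          Finset.sum_add_distrib, ← Finset.mul_sum] <;> ring)]
  simp only [Fintype.sum_sum_type, hF, hN, hQF, hQN, map_zero, zero_apply, LinearMap.zero_apply,
    Finset.sum_const_zero, add_zero, zero_add, mul_zero, curv_eq]
  -- The curvature pairing has its first two arguments in the order opposite to that of the Ricci
  -- identity, whence a sign.
  have hr : ∀ i a, H (u z) (curvL (pull H u) z (e (.inl i)) (e a) (fderiv ℝ u z (e a)))
      (fderiv ℝ u z (e (.inl i))) = -H (u z) (curvL (pull H u) z (e a) (e (.inl i))
        (fderiv ℝ u z (e a))) (fderiv ℝ u z (e (.inl i))) := by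
    intro i a
    rw [← curv_eq, curv_anti, map_neg, neg_apply, curv_eq]
  have c1 := Finset.sum_comm (s := Finset.univ) (t := Finset.univ) (f := fun (j : Fin l) (i : Fin k) =>
    H (u z) (covT G D H u z (e (.inr j)) (e (.inl i)) + covT G D H u z (e (.inl i)) (e (.inr j)))
      (covT G D H u z (e (.inr j)) (e (.inl i)) + covT G D H u z (e (.inl i)) (e (.inr j))))
  have c2 := Finset.sum_comm (s := Finset.univ) (t := Finset.univ) (f := fun i i' : Fin k =>
    H (u z) (covT G D H u z (e (.inl i)) (e (.inl i'))) (covT G D H u z (e (.inl i)) (e (.inl i'))))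
  have c3 := Finset.sum_comm (s := Finset.univ) (t := Finset.univ) (f := fun j j' : Fin l =>
    H (u z) (covT G D H u z (e (.inr j)) (e (.inr j'))) (covT G D H u z (e (.inr j)) (e (.inr j'))))
  have c4 := Finset.sum_comm (s := Finset.univ) (t := Finset.univ) (f := fun (i : Fin k) (j : Fin l) =>
    H (u z) (covT G D H u z (e (.inl i)) (e (.inr j))) (covT G D H u z (e (.inl i)) (e (.inr j))))
  simp only [hr, Finset.sum_add_distrib, Finset.sum_neg_distrib]
  rw [c1, c2, c3, c4]
  ring

/-- Supplies the hypotheses of `bochner_algebra` at a point: the block structure and skewness of ∇P,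
the two components of tr ∇²P, and the Leibniz and Ricci identities for du ∘ P. -/
theorem IsTenseOn.energy_algebra (hT : IsTenseOn G D U) (hz : z ∈ U) (hH : IsMetricOn H V)
    (hu : ∀ y ∈ U, ContDiffAt ℝ ∞ u y) (huV : ∀ y ∈ U, u y ∈ V) {k l : ℕ} {e : Module.Basis (Fin k ⊕ Fin l) ℝ (Euc d)}
    (he : IsOrtho (G z) e) (hF : ∀ i, projD G D z (e (.inl i)) = e (.inl i))
    (hN : ∀ j, projD G D z (e (.inr j)) = 0) :
    ∑ i, H (u z) (∑ a, cov2 (chr G) (pull H u) (fderiv ℝ u) z (e (.inl i)) (e a) (e a))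
          (fderiv ℝ u z (e (.inl i))) - ∑ a,
      ((∑ i, H (u z) (cov2 (chr G) (pull H u) (tanDiff G D u) z (e a) (e a) (e (.inl i)))
          (fderiv ℝ u z (e (.inl i))))
        + ∑ b, H (u z) (covT G D H u z (e a) (e b)) (covT G D H u z (e a) (e b)))
      = -(∑ i, ∑ a, H (u z) (curv (pull H u) z (e a) (e (.inl i)) (fderiv ℝ u z (e a)))
          (fderiv ℝ u z (e (.inl i))))
        - ∑ i, ∑ i', Coord.ricci G z (e (.inl i)) (e (.inl i'))
            * H (u z) (fderiv ℝ u z (e (.inl i))) (fderiv ℝ u z (e (.inl i')))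
        - ∑ i, ∑ j, H (u z) (covT G D H u z (e (.inr j)) (e (.inl i)) + covT G D H u z (e (.inl i)) (e (.inr j)))
            (covT G D H u z (e (.inr j)) (e (.inl i)) + covT G D H u z (e (.inl i)) (e (.inr j)))
        - ∑ i, ∑ i', H (u z) (covT G D H u z (e (.inl i)) (e (.inl i')))
            (covT G D H u z (e (.inl i)) (e (.inl i')))
        + ∑ j, ∑ j', H (u z) (covT G D H u z (e (.inr j)) (e (.inr j')))
            (covT G D H u z (e (.inr j)) (e (.inr j')))
        + 2 * ∑ i, ∑ j, H (u z) (covT G D H u z (e (.inl i)) (e (.inr j)))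
            (covT G D H u z (e (.inl i)) (e (.inr j))) := by
  have hG := hT.metric
  have hh : ∀ y ∈ U, ∀ s s', H (u y) s s' = H (u y) s' s := fun y hy =>
    (hH.inner _ (huV y hy)).1
  have hs := (hG.inner z hz).1
  have hα : ∀ y ∈ U, ContDiffAt ℝ ∞ (tanDiff G D u) y := fun y hy =>
    smooth_tanDiff (hu y hy) (hT.smooth y hy)
  have hκ : ∀ y ∈ U, ContDiffAt ℝ ∞ (pull H u) y := fun y hy =>
    smooth_pull hH (hu y hy) (huV y hy)
  have hA : ∀ y ∈ U, ContDiffAt ℝ ∞ (fderiv ℝ u) y := fun y hy =>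
    ContDiffAt.fderiv_infty (hu y hy)
  have hCc : ∀ w v, covT G D H u z w v = cov1 (chr G) (pull H u) (fderiv ℝ u) z w (projD G D z v)
      + fderiv ℝ u z (covP G D z w v) := fun w v =>
    cov1_comp (ContDiffAt.diff (hA z hz)) (hT.proj_diff hz) w v
  have hKF : ∀ w x, projD G D z x = x → projD G D z (covP G D z w x) = 0 := by
    intro w x hx
    have := covP_eq hG hT.smooth hz w x
    rw [hx] at this
    exact left_eq_add.1 this
  have hKN : ∀ w x, projD G D z x = 0 → projD G D z (covP G D z w x) = covP G D z w x := by
    intro w x hx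
    have := covP_eq hG hT.smooth hz w x
    rw [hx, map_zero, zero_add] at this
    exact this.symm
  have orth : ∀ x y, projD G D z x = 0 → projD G D z y = y → G z x y = 0 := by
    intro x y hx hy
    rw [← hy, ← proj_symm hG hz, hx, map_zero, zero_apply]
  obtain ⟨R1, -, -⟩ := curv_metric_facts hG hz
  have hev : ∀ᶠ y in nhds z, y ∈ U := hG.eventually hz
  have hD2F : ∀ a i i', G z (cov2P G D z (e a) (e a) (e (.inl i))) (e (.inl i'))
      = -(2 * G z (covP G D z (e a) (covP G D z (e a) (e (.inl i)))) (e (.inl i'))) := by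
    intro a i i'
    have h1 := congrArg (fun v => G z v (e (.inl i')))
      (hT.cov2P_eq hz (e a) (e a) (e (.inl i)))
    simp only [hF, map_add, add_apply] at h1
    rw [proj_symm hG hz, hF] at h1
    linarith
  have hKb : ∀ j j', covP G D z (e (.inr j)) (e (.inr j'))
      = -covP G D z (e (.inr j')) (e (.inr j)) := by
    intro j j'
    have := hT.bundle z hz (e (.inr j)) (e (.inr j'))
    rwa [hN, hN, sub_zero, sub_zero] at this
  have hmix : ∀ i j, ∑ a, G z (cov2P G D z (e a) (e a) (e (.inl i))) (e (.inr j))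
      + Coord.ricci G z (e (.inl i)) (e (.inr j))
      = 2 * ∑ c, G z (covP G D z (covP G D z (e (.inr c)) (e (.inr j))) (e (.inr c)))
        (e (.inl i)) := by
    intro i j
    rw [ricci_eq hG hz he]
    exact hT.mixed hz he hF hN i j
  -- After the Leibniz rule, symmetry of ∇du rewrites (∇²_{a,a}du)e_i as (∇²_{a,i}du)e_a, and the
  -- Ricci identity brings e_i to the front, where the trace over a is a derivative of the tension.
  have hN2 : ∀ a i, cov2 (chr G) (pull H u) (tanDiff G D u) z (e a) (e a) (e (.inl i))
      = cov2 (chr G) (pull H u) (fderiv ℝ u) z (e (.inl i)) (e a) (e a)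
        + curv (pull H u) z (e a) (e (.inl i)) (fderiv ℝ u z (e a))
        - fderiv ℝ u z (curv (chr G) z (e a) (e (.inl i)) (e a))
        + (2 : ℝ) • cov1 (chr G) (pull H u) (fderiv ℝ u) z (e a)
            (covP G D z (e a) (e (.inl i)))
        + fderiv ℝ u z (cov2P G D z (e a) (e a) (e (.inl i))) := by
    intro a i
    have h1 := cov2_comp (A := fderiv ℝ u) (P := projD G D) (hG.smooth_chr hz) (hκ z hz)
      (hev.mono hA) (hev.mono hT.smooth) (e a) (e a) (e (.inl i))
    have h2 := cov2_symm hG hz hH hu huV (e a) (e a) (e (.inl i))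
    have h3 := cov2_comm (hG.smooth_chr hz) (hκ z hz) (hA z hz) (hG.chr_symm hz) (e a)
      (e (.inl i)) (e a)
    have h4 : cov2 (chr G) (pull H u) (tanDiff G D u) z (e a) (e a) (e (.inl i)) = _ := h1
    rw [h4, hF, h2, sub_eq_iff_eq_add.1 h3]
    module
  have hRs : ∀ i b, ∑ a, G z (curv (chr G) z (e a) (e (.inl i)) (e a)) (e b)
      = -Coord.ricci G z (e (.inl i)) (e b) := by
    intro i b
    rw [ricci_eq hG hz he, ← Finset.sum_neg_distrib]
    exact Finset.sum_congr rfl fun a _ => R1 _ _ _ _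
  have hKF' : ∀ w i i', G z (covP G D z w (e (.inl i))) (e (.inl i')) = 0 := fun w i i' =>
    orth _ _ (hKF w _ (hF i)) (hF i')
  have hKN' : ∀ w j j', G z (covP G D z w (e (.inr j))) (e (.inr j')) = 0 := by
    intro w j j'
    rw [hs]
    exact orth _ _ (hN j') (hKN w _ (hN j))
  have hCF : ∀ a i, covT G D H u z (e a) (e (.inl i))
      = cov1 (chr G) (pull H u) (fderiv ℝ u) z (e a) (e (.inl i))
        + fderiv ℝ u z (covP G D z (e a) (e (.inl i))) := by
    intro a i
    rw [hCc, hF]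
  have hCN : ∀ a j, covT G D H u z (e a) (e (.inr j))
      = fderiv ℝ u z (covP G D z (e a) (e (.inr j))) := by
    intro a j
    rw [hCc, hN, map_zero, zero_add]
  have hA1 := cov1_fderiv_symm hG hz hH (hu z hz) (huV z hz)
  exact bochner_algebra (hh z hz) hs he (covP G D z) (hT.covP_symm hz) hKF' hKN' hKb _ hD2F
    (fun i b => Coord.ricci G z (e (.inl i)) (e b)) hmix (fderiv ℝ u z)
    (cov1 (chr G) (pull H u) (fderiv ℝ u) z) (fun v w => hA1 w v) _ _ _ _ hN2 hRs
    (fun a b => covT G D H u z (e a) (e b)) hCF hCN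

/-- The Bochner formula for the tangential energy density in coordinates. -/
theorem IsTenseOn.bochner (hT : IsTenseOn G D U) (hz : z ∈ U) (hH : IsMetricOn H V)
    (hu : ∀ y ∈ U, ContDiffAt ℝ ∞ u y) (huV : ∀ y ∈ U, u y ∈ V) :
    (metricTrace (G z) fun v v' => H (u z) (nab (pull H u) (Coord.tension G H u) z
        (projD G D z v)) (tanDiff G D u z v')) + Coord.laplacian G (Coord.energy G D H u) z
      = Coord.eellsSampsonTerm G D H u z := by
  obtain ⟨k, l, e, he, hS, hS'⟩ := exists_adapted_basis (hT.metric.inner z hz) (D z)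
  have hF : ∀ i, projD G D z (e (.inl i)) = e (.inl i) := fun i =>
    orthProj_of_mem (hT.metric.inner z hz) (hS i)
  have hN : ∀ j, projD G D z (e (.inr j)) = 0 := fun j =>
    orthProj_of_mem_compl (hT.metric.inner z hz) (hS' j)
  rw [hT.trace_nab_tension hz hH hu huV he hF hN, hT.laplacian_energy_eq hz hH hu huV he hF hN,
    ← sub_eq_add_neg, hT.energy_algebra hz hH hu huV he hF hN,
    hT.eellsSampsonTerm_eq hz hH hu huV he hF hN]

end Bochner

/-! ### Time-dependent maps -/

section Time

variable {E F : Type*} [NormedAddCommGroup E] [NormedSpace ℝ E]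
  [NormedAddCommGroup F] [NormedSpace ℝ F] {u : ℝ → E → F} {T : Set ℝ} {U : Set E} {t : ℝ} {z : E}

/-- Time domains over which boundary derivatives behave as interior ones. -/
structure IsTimeDomain (T : Set ℝ) : Prop where
  unique : UniqueDiffOn ℝ T
  subset : T ⊆ closure (interior T)

theorem contDiffAt_slice (hU : IsOpen U)
    (hu : ContDiffOn ℝ ∞ (fun p : ℝ × E => u p.1 p.2) (T ×ˢ U)) (ht : t ∈ T) (hz : z ∈ U) :
    ContDiffAt ℝ ∞ (u t) z := by
  have h1 : ContDiffWithinAt ℝ ∞ (fun y => u t y) U z :=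
    (hu (t, z) ⟨ht, hz⟩).comp z (f := fun y => (t, y))
      (contDiffWithinAt_const.prodMk contDiffWithinAt_id) fun y hy => ⟨ht, hy⟩
  exact h1.contDiffAt (hU.mem_nhds hz)

theorem hasFDerivAt_slice (hU : IsOpen U)
    (hu : ContDiffOn ℝ ∞ (fun p : ℝ × E => u p.1 p.2) (T ×ˢ U)) (ht : t ∈ T) (hz : z ∈ U) :
    HasFDerivAt (u t) ((fderivWithin ℝ (fun p : ℝ × E => u p.1 p.2) (T ×ˢ U) (t, z)).comp
      (ContinuousLinearMap.inr ℝ ℝ E)) z := by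
  have h1 := ((hu (t, z) ⟨ht, hz⟩).differentiableWithinAt (by simp)).hasFDerivWithinAt
  have h2 : HasFDerivWithinAt (fun y => (t, y)) (ContinuousLinearMap.inr ℝ ℝ E) U z :=
    (hasFDerivAt_prodMk_right t z).hasFDerivWithinAt
  exact (h1.comp z h2 fun y hy => ⟨ht, hy⟩).hasFDerivAt (hU.mem_nhds hz)

theorem fderiv_slice (hU : IsOpen U)
    (hu : ContDiffOn ℝ ∞ (fun p : ℝ × E => u p.1 p.2) (T ×ˢ U)) (ht : t ∈ T) (hz : z ∈ U) :
    fderiv ℝ (u t) z = (fderivWithin ℝ (fun p : ℝ × E => u p.1 p.2) (T ×ˢ U) (t, z)).comp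
      (ContinuousLinearMap.inr ℝ ℝ E) :=
  (hasFDerivAt_slice hU hu ht hz).fderiv

theorem hasDerivWithinAt_slice (hu : ContDiffOn ℝ ∞ (fun p : ℝ × E => u p.1 p.2) (T ×ˢ U))
    (ht : t ∈ T) (hz : z ∈ U) : HasDerivWithinAt (fun s => u s z)
      (fderivWithin ℝ (fun p : ℝ × E => u p.1 p.2) (T ×ˢ U) (t, z) (1, 0)) T t := by
  have h1 := ((hu (t, z) ⟨ht, hz⟩).differentiableWithinAt (by simp)).hasFDerivWithinAt
  have h2 : HasFDerivWithinAt (fun s : ℝ => (s, z)) (ContinuousLinearMap.inl ℝ ℝ E) T t :=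
    (hasFDerivAt_prodMk_left t z).hasFDerivWithinAt
  exact (HasFDerivWithinAt.comp (f := fun s : ℝ => (s, z)) t h1 h2
    fun y hy => ⟨hy, hz⟩).hasDerivWithinAt

theorem contDiffOn_fderiv_slice (hT : IsTimeDomain T) (hU : IsOpen U)
    (hu : ContDiffOn ℝ ∞ (fun p : ℝ × E => u p.1 p.2) (T ×ˢ U)) :
    ContDiffOn ℝ ∞ (fun p : ℝ × E => fderiv ℝ (u p.1) p.2) (T ×ˢ U) := by
  have h1 := hu.fderivWithin (m := ∞) (hT.unique.prod hU.uniqueDiffOn) (by simp)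
  exact (h1.clm_comp contDiffOn_const).congr fun p hp => fderiv_slice hU hu hp.1 hp.2

/-- Time and space derivatives commute. -/
theorem hasDerivWithinAt_fderiv (hT : IsTimeDomain T) (hU : IsOpen U)
    (hu : ContDiffOn ℝ ∞ (fun p : ℝ × E => u p.1 p.2) (T ×ˢ U)) (ht : t ∈ T) (hz : z ∈ U) (v : E) :
    HasDerivWithinAt (fun s => fderiv ℝ (u s) z v)
      (fderiv ℝ (fun y => derivWithin (fun s => u s y) T t) z v) T t := by
  have hS := hT.unique.prod hU.uniqueDiffOn
  have h1 := hu.fderivWithin (m := ∞) hS (by simp)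
  have hd := ((h1 (t, z) ⟨ht, hz⟩).differentiableWithinAt (by simp)).hasFDerivWithinAt
  -- At an endpoint of the time interval, symmetry of second derivatives within the domain is
  -- obtained from the point lying in the closure of the interior.
  have symm := (hu (t, z) ⟨ht, hz⟩).isSymmSndFDerivWithinAt (by
      rw [minSmoothness_of_isRCLikeNormedField]
      exact WithTop.coe_le_coe.2 le_top) hS (by
      rw [interior_prod_eq, hU.interior_eq, closure_prod_eq]
      exact ⟨hT.subset ht, subset_closure hz⟩) ⟨ht, hz⟩
  have e1 : HasFDerivWithinAt (fun y => derivWithin (fun s => u s y) T t)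
      (((ContinuousLinearMap.apply ℝ F ((1 : ℝ), (0 : E))).comp (fderivWithin ℝ (fderivWithin ℝ
        (fun p : ℝ × E => u p.1 p.2) (T ×ˢ U)) (T ×ˢ U) (t, z))).comp
        (ContinuousLinearMap.inr ℝ ℝ E)) U z := by
    have h2 : HasFDerivWithinAt (fun y => (t, y)) (ContinuousLinearMap.inr ℝ ℝ E) U z :=
      (hasFDerivAt_prodMk_right t z).hasFDerivWithinAt
    have h3 := ((ContinuousLinearMap.apply ℝ F ((1 : ℝ), (0 : E))).hasFDerivAt).comp_hasFDerivWithinAt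
      z (hd.comp z h2 fun y hy => ⟨ht, hy⟩)
    refine HasFDerivWithinAt.congr' h3 (fun y hy => ?_) hz
    exact (hasDerivWithinAt_slice hu ht hy).derivWithin (hT.unique t ht)
  rw [(e1.hasFDerivAt (hU.mem_nhds hz)).fderiv]
  have h2 : HasFDerivWithinAt (fun s : ℝ => (s, z)) (ContinuousLinearMap.inl ℝ ℝ E) T t :=
    (hasFDerivAt_prodMk_left t z).hasFDerivWithinAt
  have h3 := (((ContinuousLinearMap.apply ℝ F ((0 : ℝ), v)).hasFDerivAt).comp_hasFDerivWithinAt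
      t (HasFDerivWithinAt.comp (f := fun s : ℝ => (s, z)) t hd h2
        fun y hy => ⟨hy, hz⟩)).hasDerivWithinAt
  refine (HasDerivWithinAt.congr_of_mem h3 (fun s hs => ?_) ht).congr_deriv ?_
  · rw [fderiv_slice hU hu hs hz]
    rfl
  · exact symm.eq _ _

end Time

/-! ### Evolution of the tangential energy under the flow, in coordinates. -/

section Heat

variable {d q : ℕ} {G : Euc d → Euc d →L[ℝ] Euc d →L[ℝ] ℝ} {D : Euc d → Submodule ℝ (Euc d)}
  {H : Euc q → Euc q →L[ℝ] Euc q →L[ℝ] ℝ} {U : Set (Euc d)} {V : Set (Euc q)}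
  {u : ℝ → Euc d → Euc q} {T : Set ℝ} {t : ℝ} {z : Euc d}

theorem contDiffOn_energy (hG : IsMetricOn G U) (hP : ∀ y ∈ U, ContDiffAt ℝ ∞ (projD G D) y)
    (hH : IsMetricOn H V) (hT : IsTimeDomain T)
    (hu : ContDiffOn ℝ ∞ (fun p : ℝ × Euc d => u p.1 p.2) (T ×ˢ U))
    (huV : ∀ s ∈ T, ∀ y ∈ U, u s y ∈ V) :
    ContDiffOn ℝ ∞ (fun p : ℝ × Euc d => Coord.energy G D H (u p.1) p.2) (T ×ˢ U) := by
  intro p hp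
  have hα : ∀ v, ContDiffWithinAt ℝ ∞
      (fun p : ℝ × Euc d => fderiv ℝ (u p.1) p.2 (projD G D p.2 v)) (T ×ˢ U) p := fun v =>
    (contDiffOn_fderiv_slice hT hG.isOpen hu p hp).clm_apply
      (((hP _ hp.2).comp_contDiffWithinAt p contDiffWithinAt_snd).clm_apply contDiffWithinAt_const)
  exact contDiffWithinAt_const.mul (hG.smooth_metricTrace contDiffWithinAt_snd hp.2 fun v w =>
    (((hH.smooth _ (huV _ hp.1 _ hp.2)).comp_contDiffWithinAt p (hu p hp)).clm_apply
      (hα v)).clm_apply (hα w))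

theorem hasDerivWithinAt_energy (hG : IsMetricOn G U) (hH : IsMetricOn H V) (hT : IsTimeDomain T)
    (hu : ContDiffOn ℝ ∞ (fun p : ℝ × Euc d => u p.1 p.2) (T ×ˢ U))
    (huV : ∀ s ∈ T, ∀ y ∈ U, u s y ∈ V) (ht : t ∈ T) (hz : z ∈ U) :
    HasDerivWithinAt (fun s => Coord.energy G D H (u s) z)
      (metricTrace (G z) fun v v' => H (u t z) (nab (pull H (u t))
        (fun y => derivWithin (fun s => u s y) T t) z (projD G D z v)) (tanDiff G D (u t) z v'))
      T t := by
  set X : Euc d → Euc q := fun y => derivWithin (fun s => u s y) T t with hX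
  have hV := huV t ht z hz
  have h0 : HasDerivWithinAt (fun s => u s z) (X z) T t :=
    (hasDerivWithinAt_slice hu ht hz).differentiableWithinAt.hasDerivWithinAt
  have h1 : HasDerivWithinAt (fun s => H (u s z)) (fderiv ℝ H (u t z) (X z)) T t :=
    (hH.diff hV).hasFDerivAt.comp_hasDerivWithinAt t h0
  have h2 := fun v => hasDerivWithinAt_fderiv hT hG.isOpen hu ht hz v
  -- Symmetry of the Christoffel symbols of the target: the covariant time derivative of du(v) is
  -- the covariant derivative of ∂_t u along v.
  have hn : ∀ v, nab (pull H (u t)) X z v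
      = fderiv ℝ X z v + chr H (u t z) (X z) (fderiv ℝ (u t) z v) := fun v => by
    rw [nab, pull_apply, hH.chr_symm hV]
  have term : ∀ v w, HasDerivWithinAt
      (fun s => H (u s z) (fderiv ℝ (u s) z (projD G D z v)) (fderiv ℝ (u s) z (projD G D z w)))
      (H (u t z) (nab (pull H (u t)) X z (projD G D z v)) (tanDiff G D (u t) z w)
        + H (u t z) (nab (pull H (u t)) X z (projD G D z w)) (tanDiff G D (u t) z v)) T t := by
    intro v w
    refine ((h1.clm_apply (h2 (projD G D z v))).clm_apply (h2 (projD G D z w))).congr_deriv ?_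
    rw [add_apply, hH.isParallel hV, hn, hn, (hH.inner _ hV).1 (_ + _) (tanDiff G D (u t) z v)]
    simp only [map_add, add_apply, tanDiff, ContinuousLinearMap.comp_apply]
    ring
  have sum : HasDerivWithinAt (fun s => Coord.energy G D H (u s) z) ((1 / 2 : ℝ) *
      metricTrace (G z) fun v w =>
        H (u t z) (nab (pull H (u t)) X z (projD G D z v)) (tanDiff G D (u t) z w)
        + H (u t z) (nab (pull H (u t)) X z (projD G D z w)) (tanDiff G D (u t) z v)) T t :=
    HasDerivWithinAt.const_mul _ (HasDerivWithinAt.fun_sum fun i _ =>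
      HasDerivWithinAt.fun_sum fun j _ => (term _ _).const_mul _)
  refine sum.congr_deriv ?_
  rw [metricTrace_add, metricTrace_swap (hG.inner z hz)
    fun v w => H (u t z) (nab (pull H (u t)) X z (projD G D z w)) (tanDiff G D (u t) z v)]
  ring

/-- The Bochner formula for the tangential energy density along the heat flow, in coordinates. -/
theorem IsTenseOn.heat_bochner (hD : IsTenseOn G D U) (hH : IsMetricOn H V) (hT : IsTimeDomain T)
    (hu : ContDiffOn ℝ ∞ (fun p : ℝ × Euc d => u p.1 p.2) (T ×ˢ U))
    (huV : ∀ s ∈ T, ∀ y ∈ U, u s y ∈ V)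
    (hflow : ∀ s ∈ T, ∀ y ∈ U, derivWithin (fun r => u r y) T s = Coord.tension G H (u s) y)
    (ht : t ∈ T) (hz : z ∈ U) :
    derivWithin (fun s => Coord.energy G D H (u s) z) T t
        + Coord.laplacian G (Coord.energy G D H (u t)) z
      = Coord.eellsSampsonTerm G D H (u t) z := by
  have hs : ∀ y ∈ U, ContDiffAt ℝ ∞ (u t) y := fun y hy =>
    contDiffAt_slice hD.metric.isOpen hu ht hy
  rw [← hD.bochner hz hH hs (huV t ht),
    (hasDerivWithinAt_energy hD.metric hH hT hu huV ht hz).derivWithin (hT.unique t ht)]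
  -- The flow equation holds near `z`, so it may be differentiated in space.
  have e : (fun y => derivWithin (fun s => u s y) T t) =ᶠ[nhds z] Coord.tension G H (u t) := by
    filter_upwards [hD.metric.eventually hz] with y hy
    exact hflow t ht y hy
  simp only [nab, e.fderiv_eq, e.self_of_nhds]

end Heat

/-! ### Families of quadratic forms -/

section Quadratic

variable {S B : Type*} [TopologicalSpace S] [NormedAddCommGroup B] [NormedSpace ℝ B]
  {K : Set S} {φ ψ : S × B → ℝ}

/-- Continuous families of functions that are homogeneous of degree two. -/
structure IsQuad (K : Set S) (φ : S × B → ℝ) : Prop where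
  cont : ContinuousOn φ (K ×ˢ Set.univ)
  homog : ∀ p ∈ K, ∀ (c : ℝ) (β : B), φ (p, c • β) = c ^ 2 * φ (p, β)

namespace IsQuad

theorem add (h : IsQuad K φ) (h' : IsQuad K ψ) : IsQuad K fun x => φ x + ψ x :=
  ⟨h.cont.add h'.cont, fun p hp c β => by rw [h.homog p hp, h'.homog p hp]; ring⟩

theorem mul {f : S → ℝ} (hf : ContinuousOn f K) (h : IsQuad K φ) :
    IsQuad K fun x => f x.1 * φ x :=
  ⟨(hf.comp continuousOn_fst fun _ hx => hx.1).mul h.cont,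
    fun p hp c β => by rw [h.homog p hp]; ring⟩

theorem sub (h : IsQuad K φ) (h' : IsQuad K ψ) : IsQuad K fun x => φ x - ψ x :=
  ⟨h.cont.sub h'.cont, fun p hp c β => by rw [h.homog p hp, h'.homog p hp]; ring⟩

theorem sum {ι : Type*} {s : Finset ι} {φ : ι → S × B → ℝ} (h : ∀ i ∈ s, IsQuad K (φ i)) :
    IsQuad K fun x => ∑ i ∈ s, φ i x :=
  ⟨continuousOn_finsetSum s fun i hi => (h i hi).cont, fun p hp c β => by
    rw [Finset.mul_sum]
    exact Finset.sum_congr rfl fun i hi => (h i hi).homog p hp c β⟩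

theorem bilinear {d q : ℕ} {b : S → Euc q →L[ℝ] Euc q →L[ℝ] ℝ} {f g : S → Euc d}
    (hb : ContinuousOn b K) (hf : ContinuousOn f K) (hg : ContinuousOn g K) :
    IsQuad K fun x : S × (Euc d →L[ℝ] Euc q) => b x.1 (x.2 (f x.1)) (x.2 (g x.1)) := by
  refine ⟨?_, fun p hp c β => ?_⟩
  · have m : Set.MapsTo (Prod.fst : S × (Euc d →L[ℝ] Euc q) → S) (K ×ˢ Set.univ) K :=
      fun _ hx => hx.1
    exact ((hb.comp continuousOn_fst m).clm_apply
      (continuousOn_snd.clm_apply (hf.comp continuousOn_fst m))).clm_apply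
      (continuousOn_snd.clm_apply (hg.comp continuousOn_fst m))
  · simp only [smul_apply, map_smul, smul_eq_mul]
    ring

/-- On the compact unit sphere φ/ψ is bounded at `p₀`; compactness also makes the neighbourhood of
`p₀` uniform in `β`, and homogeneity extends the bound from the sphere to all `β`. -/
theorem exists_bound [FiniteDimensional ℝ B] (h : IsQuad K φ) (h' : IsQuad K ψ)
    (pos : ∀ p ∈ K, ∀ β, β ≠ 0 → 0 < ψ (p, β)) {p₀ : S} (hp₀ : p₀ ∈ K) :
    ∃ C : ℝ, ∀ᶠ p in nhdsWithin p₀ K, ∀ β, φ (p, β) ≤ C * ψ (p, β) := by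
  have : ProperSpace B := FiniteDimensional.proper_real B
  have hK : IsCompact (Metric.sphere (0 : B) 1) := isCompact_sphere 0 1
  have ne : ∀ β ∈ Metric.sphere (0 : B) 1, β ≠ 0 := by
    rintro β hβ rfl
    simp at hβ
  have hm : ∀ β ∈ Metric.sphere (0 : B) 1, (p₀, β) ∈ K ×ˢ (Set.univ : Set B) :=
    fun β _ => ⟨hp₀, trivial⟩
  have hc : ContinuousOn (fun β : B => φ (p₀, β) / ψ (p₀, β)) (Metric.sphere (0 : B) 1) :=
    (h.cont.comp (by fun_prop) hm).div (h'.cont.comp (by fun_prop) hm) fun β hβ =>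
      (pos p₀ hp₀ β (ne β hβ)).ne'
  obtain ⟨C, hC⟩ := hK.bddAbove_image hc
  -- The margin 1 makes the inequality strict at `p₀`, hence stable under small changes of `p`.
  refine ⟨C + 1, ?_⟩
  have key : ∀ᶠ p in nhds p₀, ∀ β ∈ Metric.sphere (0 : B) 1,
      p ∈ K → φ (p, β) < (C + 1) * ψ (p, β) := by
    refine hK.eventually_forall_of_forall_eventually fun β hβ => ?_
    have h1 : φ (p₀, β) < (C + 1) * ψ (p₀, β) := by
      have h2 := hC (Set.mem_image_of_mem _ hβ)
      have h3 := pos p₀ hp₀ β (ne β hβ)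
      rw [div_le_iff₀ h3] at h2
      linarith
    have h2 : ContinuousWithinAt (fun x => (C + 1) * ψ x - φ x) (K ×ˢ Set.univ) (p₀, β) :=
      ((continuousOn_const.mul h'.cont).sub h.cont) _ (hm β hβ)
    have h3 := eventually_nhdsWithin_iff.1 (h2.eventually (lt_mem_nhds (sub_pos.2 h1)))
    filter_upwards [h3] with x hx hx'
    exact sub_pos.1 (hx ⟨hx', trivial⟩)
  filter_upwards [mem_nhdsWithin_of_mem_nhds key, self_mem_nhdsWithin] with p hp hpK β
  by_cases hβ : β = 0
  · have h1 := h.homog p hpK 0 0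
    have h2 := h'.homog p hpK 0 0
    rw [zero_smul] at h1 h2
    rw [hβ, h1, h2]
    simp
  · have hn : ‖β‖ ≠ 0 := norm_ne_zero_iff.2 hβ
    have h1 : β = ‖β‖ • (‖β‖⁻¹ • β) := by rw [smul_smul, mul_inv_cancel₀ hn, one_smul]
    have h2 := (hp (‖β‖⁻¹ • β) (by simp [norm_smul, hn]) hpK).le
    rw [h1, h.homog p hpK, h'.homog p hpK]
    nlinarith [sq_nonneg ‖β‖]

end IsQuad

end Quadratic

/-! ### The local differential inequality. -/

section Estimate

open IsTenseOn

variable {d q : ℕ} {G : Euc d → Euc d →L[ℝ] Euc d →L[ℝ] ℝ} {D : Euc d → Submodule ℝ (Euc d)}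
  {H : Euc q → Euc q →L[ℝ] Euc q →L[ℝ] ℝ} {U : Set (Euc d)} {V : Set (Euc q)}
  {u : ℝ → Euc d → Euc q} {T : Set ℝ} {t : ℝ} {z : Euc d}

theorem IsQuad.trace {S B : Type*} [TopologicalSpace S] [NormedAddCommGroup B] [NormedSpace ℝ B]
    {K : Set S} (hG : IsMetricOn G U) {θ : S → Euc d} (hθ : ContinuousOn θ K)
    (hU : ∀ p ∈ K, θ p ∈ U) {φ : Euc d → Euc d → S × B → ℝ} (h : ∀ v w, IsQuad K (φ v w)) :
    IsQuad K fun x => metricTrace (G (θ x.1)) fun v w => φ v w x := by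
  refine IsQuad.sum fun i _ => IsQuad.sum fun j _ => IsQuad.mul (f := fun p =>
    (gramMatrix (G (θ p)))⁻¹ i j) (fun p hp => ?_) (h _ _)
  exact (hG.smooth_gram_inv (hU p hp) i j).continuousAt.comp_continuousWithinAt (hθ p hp)

theorem metricTrace_pos {b : Euc d →L[ℝ] Euc d →L[ℝ] ℝ} (hb : IsInner b)
    {c : Euc q →L[ℝ] Euc q →L[ℝ] ℝ} (hc : IsInner c) {β : Euc d →L[ℝ] Euc q} (hβ : β ≠ 0) :
    0 < metricTrace b fun v w => c (β v) (β w) := by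
  obtain ⟨k, e, he⟩ := exists_ortho hb
  rw [metricTrace_eq_sum he (by
    constructor <;> intros <;> simp only [map_add, map_smul, add_apply, smul_apply])]
  have h0 : ∀ x, 0 ≤ c x x := fun x => by
    by_cases hx : x = 0
    · simp [hx]
    · exact (hc.2 x hx).le
  obtain ⟨i, hi⟩ : ∃ i, β (e i) ≠ 0 := by
    by_contra! hn
    exact hβ (ContinuousLinearMap.coe_injective (e.ext fun i => by simpa using hn i))
  exact Finset.sum_pos' (fun i _ => h0 _) ⟨i, Finset.mem_univ i, hc.2 _ hi⟩

theorem normSq₂_nonneg {b : Euc d →L[ℝ] Euc d →L[ℝ] ℝ} (hb : IsInner b)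
    {c : Euc q →L[ℝ] Euc q →L[ℝ] ℝ} (hc : IsInner c) {S : Euc d → Euc d → Euc q} (hS : Bilin S) :
    0 ≤ normSq₂ b c S := by
  obtain ⟨k, e, he⟩ := exists_ortho hb
  rw [normSq₂_eq_sum he c hS]
  refine Finset.sum_nonneg fun i _ => Finset.sum_nonneg fun j _ => ?_
  by_cases hx : S (e i) (e j) = 0
  · simp [hx]
  · exact (hc.2 _ hx).le

/-- The terms without sign in the Eells–Sampson type formula, as a quadratic form in the
restricted differential. -/
def quadTerm (G : Euc d → Euc d →L[ℝ] Euc d →L[ℝ] ℝ) (D : Euc d → Submodule ℝ (Euc d))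
    (H : Euc q → Euc q →L[ℝ] Euc q →L[ℝ] ℝ) (u : Euc d → Euc q) (z : Euc d)
    (β : Euc d →L[ℝ] Euc q) : ℝ :=
  (metricTrace (G z) fun v v' => metricTrace (G z) fun w w' =>
      H (u z) (curv (chr H) (u z) (β v) (fderiv ℝ u z w) (fderiv ℝ u z w')) (β v'))
    - (metricTrace (G z) fun v v' => metricTrace (G z) fun w w' =>
      Coord.ricci G z v w * H (u z) (β v') (β w'))
    + (metricTrace (G z) fun v v' => metricTrace (G z) fun w w' =>
      H (u z) (β (covP G D z (projN G D z w) (projN G D z v)))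
        (β (covP G D z (projN G D z w') (projN G D z v'))))
    + 2 * metricTrace (G z) fun v v' => metricTrace (G z) fun w w' =>
      H (u z) (β (covP G D z (projD G D z w) (projN G D z v)))
        (β (covP G D z (projD G D z w') (projN G D z v')))

/-- The negative squares are dropped. For v normal, (∇_w(du ∘ P))(v) = du((∇_w P)v) with (∇_w P)v
tangential, so the positive squares involve du only through its restriction to the distribution. -/
theorem IsTenseOn.eellsSampsonTerm_le {u : Euc d → Euc q} (hT : IsTenseOn G D U) (hz : z ∈ U)
    (hH : IsMetricOn H V) (hu : ContDiffAt ℝ ∞ u z) (huV : u z ∈ V) :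
    Coord.eellsSampsonTerm G D H u z ≤ quadTerm G D H u z (tanDiff G D u z) := by
  have hG := hT.metric
  have hcov : ∀ v w, Coord.covDerivTangential G H u D z v w = covT G D H u z w v :=
    covDerivTangential_eq hG hz hH huV hu (hT.smooth z hz)
  have hPQ : ∀ v, (LinearMap.id - orthProj (G z) (D z) : Euc d →ₗ[ℝ] Euc d) v = projN G D z v :=
    fun v => rfl
  have hPN : ∀ v, projD G D z (projN G D z v) = 0 := fun v => by
    rw [projN_apply, map_sub, proj_idem hG hz, sub_self]
  have hB : ∀ w v, covT G D H u z w (projN G D z v)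
      = tanDiff G D u z (covP G D z w (projN G D z v)) := by
    intro w v
    have h1 := cov1_comp (Γ := chr G) (κ := pull H u) (ContDiffAt.diff (ContDiffAt.fderiv_infty hu))
      (hT.proj_diff hz) w (projN G D z v)
    have h2 := covP_eq hG hT.smooth hz w (projN G D z v)
    rw [hPN, map_zero, zero_add] at h1 h2
    refine h1.trans ?_
    rw [h2]
    simp only [tanDiff, ContinuousLinearMap.comp_apply, proj_idem hG hz]
  have hi := hG.inner z hz
  have hc := hH.inner _ huV
  simp only [Coord.eellsSampsonTerm, hcov, hPQ, ← projD_apply, curvature_eq hH huV]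
  have n1 := normSq₂_nonneg hi hc (S := fun v w => covT G D H u z (projN G D z v) (projD G D z w)
    + covT G D H u z (projD G D z w) (projN G D z v))
    (by constructor <;> intros <;> simp only [map_add, map_smul, add_apply, smul_apply] <;> module)
  have n2 := normSq₂_nonneg hi hc (S := fun v w => covT G D H u z (projD G D z w) (projD G D z v))
    (by constructor <;> intros <;> simp only [map_add, map_smul, add_apply, smul_apply])
  have e1 : normSq₂ (G z) (H (u z)) (fun v w => covT G D H u z (projN G D z w) (projN G D z v))
      = metricTrace (G z) fun v v' => metricTrace (G z) fun w w' =>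
      H (u z) (tanDiff G D u z (covP G D z (projN G D z w) (projN G D z v)))
        (tanDiff G D u z (covP G D z (projN G D z w') (projN G D z v'))) := by
    simp only [hB, normSq₂]
  have e2 : normSq₂ (G z) (H (u z)) (fun v w => covT G D H u z (projD G D z w) (projN G D z v))
      = metricTrace (G z) fun v v' => metricTrace (G z) fun w w' =>
      H (u z) (tanDiff G D u z (covP G D z (projD G D z w) (projN G D z v)))
        (tanDiff G D u z (covP G D z (projD G D z w') (projN G D z v'))) := by
    simp only [hB, normSq₂]
  rw [e1, e2]
  simp only [quadTerm]
  have : ∀ v, fderiv ℝ u z (projD G D z v) = tanDiff G D u z v := fun v => rfl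
  simp only [this]
  linarith

/-- The full differential of `u` occurs only as a coefficient, continuous in time and space; in `β`
each term is homogeneous of degree two. -/
theorem isQuad_quadTerm (hT : IsTenseOn G D U) (hH : IsMetricOn H V) (hI : IsTimeDomain T)
    (hu : ContDiffOn ℝ ∞ (fun p : ℝ × Euc d => u p.1 p.2) (T ×ˢ U))
    (huV : ∀ s ∈ T, ∀ y ∈ U, u s y ∈ V) :
    IsQuad (T ×ˢ U) fun x : (ℝ × Euc d) × (Euc d →L[ℝ] Euc q) =>
      quadTerm G D H (u x.1.1) x.1.2 x.2 := by
  have hG := hT.metric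
  have c2 : ContinuousOn (Prod.snd : ℝ × Euc d → Euc d) (T ×ˢ U) := continuousOn_snd
  have lift : ∀ {F : Type} [NormedAddCommGroup F] [NormedSpace ℝ F] {f : Euc d → F},
      (∀ y ∈ U, ContDiffAt ℝ ∞ f y) → ContinuousOn (fun p : ℝ × Euc d => f p.2) (T ×ˢ U) :=
    fun hf p hp => (hf p.2 hp.2).continuousAt.comp_continuousWithinAt (c2 p hp)
  have lift' : ∀ {F : Type} [NormedAddCommGroup F] [NormedSpace ℝ F] {f : Euc q → F},
      (∀ y ∈ V, ContDiffAt ℝ ∞ f y) →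
      ContinuousOn (fun p : ℝ × Euc d => f (u p.1 p.2)) (T ×ˢ U) := fun hf p hp =>
    ContinuousAt.comp_continuousWithinAt (f := fun p : ℝ × Euc d => u p.1 p.2)
      (hf _ (huV _ hp.1 _ hp.2)).continuousAt (hu.continuousOn p hp)
  have cH := lift' hH.smooth
  have cK := lift' fun y hy => hH.smooth_chr hy
  have cdK := lift' fun y hy => ContDiffAt.fderiv_infty (hH.smooth_chr hy)
  have cA := (contDiffOn_fderiv_slice hI hG.isOpen hu).continuousOn
  have cP := lift hT.smooth
  have cN := lift (f := projN G D) fun y hy => contDiffAt_const.sub (hT.smooth y hy)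
  have cC := lift (f := covP G D) fun y hy =>
    contDiffAt_cov1 (hG.smooth_chr hy) (hG.smooth_chr hy) (hT.smooth y hy)
  have tr : ∀ {φ : Euc d → Euc d → (ℝ × Euc d) × (Euc d →L[ℝ] Euc q) → ℝ},
      (∀ v w, IsQuad (T ×ˢ U) (φ v w)) →
      IsQuad (T ×ˢ U) fun x => metricTrace (G x.1.2) fun v w => φ v w x :=
    fun h => IsQuad.trace hG c2 (fun p hp => hp.2) h
  have cRic : ∀ v w, ContinuousOn (fun p : ℝ × Euc d => Coord.ricci G p.2 v w) (T ×ˢ U) := by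
    intro v w p hp
    have h1 : ContinuousAt (fun z => Coord.ricci G z v w) p.2 := by
      have hk := hG.smooth_chr hp.2
      have hd := ContDiffAt.fderiv_infty hk
      have h2 : ContDiffWithinAt ℝ ∞ (fun z => metricTrace (G z) fun a b =>
          G z (curv (chr G) z a v w) b) Set.univ p.2 := by
        refine hG.smooth_metricTrace contDiffWithinAt_id hp.2 fun a b => ?_
        refine ContDiffAt.contDiffWithinAt ?_
        have hg := hG.smooth p.2 hp.2
        unfold curv
        fun_prop
      have h3 : (fun z => Coord.ricci G z v w) =ᶠ[nhds p.2] fun z => metricTrace (G z) fun a b =>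
          G z (curv (chr G) z a v w) b := by
        filter_upwards [hG.eventually hp.2] with y hy
        simp only [Coord.ricci, curvature_eq hG hy]
      exact (h2.continuousWithinAt.continuousAt Filter.univ_mem).congr h3.symm
    exact h1.comp_continuousWithinAt (c2 p hp)
  have m : Set.MapsTo (Prod.fst : (ℝ × Euc d) × (Euc d →L[ℝ] Euc q) → ℝ × Euc d)
      ((T ×ˢ U) ×ˢ Set.univ) (T ×ˢ U) := fun _ hx => hx.1
  refine (((tr fun v v' => tr fun w w' => ⟨?_, fun p hp c β => ?_⟩).sub
    (tr fun v v' => tr fun w w' => IsQuad.mul (cRic v w) (IsQuad.bilinear cH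
      continuousOn_const continuousOn_const))).add
    (tr fun v v' => tr fun w w' => IsQuad.bilinear cH ((cC.clm_apply
      (cN.clm_apply continuousOn_const)).clm_apply (cN.clm_apply continuousOn_const))
      ((cC.clm_apply (cN.clm_apply continuousOn_const)).clm_apply
        (cN.clm_apply continuousOn_const)))).add
    (IsQuad.mul (f := fun _ => 2) continuousOn_const
      (tr fun v v' => tr fun w w' => IsQuad.bilinear cH ((cC.clm_apply
      (cP.clm_apply continuousOn_const)).clm_apply (cN.clm_apply continuousOn_const))
      ((cC.clm_apply (cP.clm_apply continuousOn_const)).clm_apply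
        (cN.clm_apply continuousOn_const))))
  · have cH' := cH.comp continuousOn_fst m
    have cK' := cK.comp continuousOn_fst m
    have cdK' := cdK.comp continuousOn_fst m
    have cA' := cA.comp continuousOn_fst m
    have cβ : ∀ v, ContinuousOn (fun x : (ℝ × Euc d) × (Euc d →L[ℝ] Euc q) => x.2 v)
        ((T ×ˢ U) ×ˢ Set.univ) := fun v => continuousOn_snd.clm_apply continuousOn_const
    have cw := cA'.clm_apply (continuousOn_const (c := w))
    have cw' := cA'.clm_apply (continuousOn_const (c := w'))
    exact (cH'.clm_apply (((((cdK'.clm_apply (cβ v)).clm_apply cw).clm_apply cw').sub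
      (((cdK'.clm_apply cw).clm_apply (cβ v)).clm_apply cw')).add
      ((cK'.clm_apply (cβ v)).clm_apply ((cK'.clm_apply cw).clm_apply cw')) |>.sub
      ((cK'.clm_apply cw).clm_apply ((cK'.clm_apply (cβ v)).clm_apply cw')))).clm_apply (cβ v')
  · simp only [curv_eq, smul_apply, map_smul, LinearMap.smul_apply, smul_eq_mul]
    ring

/-- The local form of the differential inequality for the tangential energy density. -/
theorem IsTenseOn.exists_bound (hT : IsTenseOn G D U) (hH : IsMetricOn H V) (hI : IsTimeDomain T)
    (hu : ContDiffOn ℝ ∞ (fun p : ℝ × Euc d => u p.1 p.2) (T ×ˢ U))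
    (huV : ∀ s ∈ T, ∀ y ∈ U, u s y ∈ V) (ht : t ∈ T) (hz : z ∈ U) :
    ∃ C : ℝ, ∀ᶠ p : ℝ × Euc d in nhdsWithin (t, z) (T ×ˢ U),
      Coord.eellsSampsonTerm G D H (u p.1) p.2 ≤ C * Coord.energy G D H (u p.1) p.2 := by
  have cH : ContinuousOn (fun p : ℝ × Euc d => H (u p.1 p.2)) (T ×ˢ U) := fun p hp =>
    ContinuousAt.comp_continuousWithinAt (f := fun p : ℝ × Euc d => u p.1 p.2)
      (hH.smooth _ (huV _ hp.1 _ hp.2)).continuousAt (hu.continuousOn p hp)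
  have q2 : IsQuad (T ×ˢ U) fun x : (ℝ × Euc d) × (Euc d →L[ℝ] Euc q) =>
      (1 / 2 : ℝ) * metricTrace (G x.1.2) fun v w => H (u x.1.1 x.1.2) (x.2 v) (x.2 w) :=
    IsQuad.mul (f := fun _ => (1 / 2 : ℝ)) continuousOn_const (IsQuad.trace hT.metric continuousOn_snd
      (fun p hp => hp.2) fun v w => IsQuad.bilinear cH continuousOn_const continuousOn_const)
  -- The energy form is positive on every nonzero linear map `β`, not only on those vanishing on the
  -- complement, so the comparison needs no constraint on `β`.
  obtain ⟨C, hC⟩ := (isQuad_quadTerm hT hH hI hu huV).exists_bound q2 (fun p hp β hβ =>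
    mul_pos one_half_pos (metricTrace_pos (hT.metric.inner _ hp.2)
      (hH.inner _ (huV _ hp.1 _ hp.2)) hβ)) (Set.mk_mem_prod ht hz)
  refine ⟨C, ?_⟩
  filter_upwards [hC, self_mem_nhdsWithin] with p hp hpm
  exact (hT.eellsSampsonTerm_le hpm.2 hH (contDiffAt_slice hT.metric.isOpen hu hpm.1 hpm.2)
    (huV _ hpm.1 _ hpm.2)).trans (hp _)

end Estimate

/-! ### Naturality under local isometries -/

section Chain

variable {E F W : Type*} [NormedAddCommGroup E] [NormedSpace ℝ E] [NormedAddCommGroup F]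
  [NormedSpace ℝ F] [NormedAddCommGroup W] [NormedSpace ℝ W]
  {Γ : E → E →L[ℝ] E →L[ℝ] E} {Γ' : F → F →L[ℝ] F →L[ℝ] F} {κ : F → F →L[ℝ] W →L[ℝ] W}
  {A : F → F →L[ℝ] W} {u : E → F} {z : E}

/-- The covariant derivative of the pull-back of a one-form. -/
theorem cov1_chain (hu : ContDiffAt ℝ ∞ u z) (hA : DifferentiableAt ℝ A (u z)) (w v : E) :
    cov1 Γ (fun y => (κ (u y)).comp (fderiv ℝ u y)) (fun y => (A (u y)).comp (fderiv ℝ u y)) z w v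
      = cov1 Γ' κ A (u z) (fderiv ℝ u z w) (fderiv ℝ u z v)
        + A (u z) (cov1 Γ (fun y => (Γ' (u y)).comp (fderiv ℝ u y)) (fderiv ℝ u) z w v) := by
  have h1 := ContDiffAt.diff hu
  have h2 := ContDiffAt.diff (ContDiffAt.fderiv_infty hu)
  have h3 : DifferentiableAt ℝ (fun y => A (u y)) z := hA.comp z h1
  have h4 : fderiv ℝ (fun y => A (u y)) z = (fderiv ℝ A (u z)).comp (fderiv ℝ u z) :=
    fderiv_comp z hA h1
  simp only [cov1_apply]
  rw [← fderiv_apply_const (h3.clm_comp h2)]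
  simp only [ContinuousLinearMap.comp_apply]
  rw [fderiv_apply₁ (F := fun y => A (u y)) (s := fun y => fderiv ℝ u y v) h3 (by fun_prop),
    fderiv_apply_const h2, h4]
  simp only [ContinuousLinearMap.comp_apply, map_add, map_sub]
  abel

end Chain

/-- The map `θ` from `U` to `U'` preserves the metrics `G` and `G'`. -/
structure IsIsom {d : ℕ} (G G' : Euc d → Euc d →L[ℝ] Euc d →L[ℝ] ℝ) (U U' : Set (Euc d))
    (θ : Euc d → Euc d) : Prop where
  source : IsMetricOn G U
  target : IsMetricOn G' U'
  smooth : ∀ z ∈ U, ContDiffAt ℝ ∞ θ z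
  maps : ∀ z ∈ U, θ z ∈ U'
  isom : ∀ z ∈ U, ∀ v w, G' (θ z) (fderiv ℝ θ z v) (fderiv ℝ θ z w) = G z v w

namespace IsIsom

variable {d q : ℕ} {G G' : Euc d → Euc d →L[ℝ] Euc d →L[ℝ] ℝ} {U U' : Set (Euc d)}
  {θ : Euc d → Euc d} {z : Euc d} {D D' : Euc d → Submodule ℝ (Euc d)}
  {H H' : Euc q → Euc q →L[ℝ] Euc q →L[ℝ] ℝ} {V V' : Set (Euc q)} {u : Euc d → Euc q}
  {Θ : Euc q → Euc q}

theorem surjective (h : IsIsom G G' U U' θ) (hz : z ∈ U) :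
    Function.Surjective (fderiv ℝ θ z) :=
  isometry_surjective (h.source.inner z hz) _ (h.isom z hz)

theorem injective (h : IsIsom G G' U U' θ) (hz : z ∈ U) :
    Function.Injective (fderiv ℝ θ z) := by
  rw [injective_iff_map_eq_zero]
  intro v hv
  by_contra hn
  have := (h.source.inner z hz).2 v hn
  rw [← h.isom z hz, hv, map_zero] at this
  exact this.false

/-- The second fundamental form of a local isometry vanishes. -/
theorem cov1_fderiv (h : IsIsom G G' U U' θ) (hz : z ∈ U) (w v : Euc d) :
    cov1 (chr G) (pull G' θ) (fderiv ℝ θ) z w v = 0 := by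
  have hθ := h.smooth z hz
  have hz' := h.maps z hz
  have d1 := ContDiffAt.diff (ContDiffAt.fderiv_infty hθ)
  have hp := pull_parallel h.target hθ hz'
  have hd : DifferentiableAt ℝ (fun y => G' (θ y)) z :=
    (h.target.diff hz').comp z (ContDiffAt.diff hθ)
  have e : G =ᶠ[nhds z] bil (fun y => G' (θ y)) (fderiv ℝ θ) (fderiv ℝ θ) := by
    filter_upwards [h.source.eventually hz] with y hy
    ext v w
    exact (h.isom y hy v w).symm
  have hs := cov1_fderiv_symm h.source hz h.target hθ hz'
  have hg := (h.target.inner _ hz').1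
  -- The derivative of G = θ*G', both metrics being parallel.
  have skew : ∀ w v v', G' (θ z) (cov1 (chr G) (pull G' θ) (fderiv ℝ θ) z w v) (fderiv ℝ θ z v')
      + G' (θ z) (cov1 (chr G) (pull G' θ) (fderiv ℝ θ) z w v') (fderiv ℝ θ z v) = 0 := by
    intro w v v'
    have h1 := h.source.isParallel hz w v v'
    have h2 := fderiv_bil_metric (Γ := chr G) hp hd d1 d1 w v v'
    rw [← e.fderiv_eq, h1, ← h.isom z hz, ← h.isom z hz] at h2
    simp only [map_add, add_apply] at h2
    rw [hg (fderiv ℝ θ z v) (cov1 (chr G) (pull G' θ) (fderiv ℝ θ) z w v')] at h2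
    linarith
  -- A trilinear form symmetric in its first two arguments and skew in its last two vanishes, as in
  -- the uniqueness of the Levi-Civita connection.
  have zero : ∀ v', G' (θ z) (cov1 (chr G) (pull G' θ) (fderiv ℝ θ) z w v)
      (fderiv ℝ θ z v') = 0 := by
    intro v'
    have a1 := skew w v v'
    have a2 := skew v v' w
    have a3 := skew v' w v
    rw [hs v' w] at a1
    rw [hs v v'] at a3
    have b := hs v w
    rw [b]
    rw [b] at a1
    linarith
  obtain ⟨v', hv'⟩ := h.surjective hz (cov1 (chr G) (pull G' θ) (fderiv ℝ θ) z w v)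
  by_contra hn
  have := (h.target.inner _ hz').2 _ hn
  have := zero v'
  rw [hv'] at this
  linarith

theorem fderiv_comp_eventually {W : Type*} [NormedAddCommGroup W] [NormedSpace ℝ W]
    (h : IsIsom G G' U U' θ) (hz : z ∈ U) {u : Euc d → W}
    (hu : ∀ y ∈ U', ContDiffAt ℝ ∞ u y) :
    fderiv ℝ (fun y => u (θ y)) =ᶠ[nhds z] fun y => (fderiv ℝ u (θ y)).comp (fderiv ℝ θ y) := by
  filter_upwards [h.source.eventually hz] with y hy
  exact fderiv_comp y (ContDiffAt.diff (hu _ (h.maps y hy))) (ContDiffAt.diff (h.smooth y hy))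

theorem cov1_congr {E W : Type*} [NormedAddCommGroup E] [NormedSpace ℝ E] [NormedAddCommGroup W]
    [NormedSpace ℝ W] {Γ : E → E →L[ℝ] E →L[ℝ] E} {κ κ' : E → E →L[ℝ] W →L[ℝ] W}
    {A A' : E → E →L[ℝ] W} {z : E} (hκ : κ z = κ' z) (hA : A =ᶠ[nhds z] A') :
    cov1 Γ κ A z = cov1 Γ κ' A' z := by
  simp only [cov1, hκ, hA.fderiv_eq, hA.self_of_nhds]

/-- The correction in `cov1_chain` is the second fundamental form of θ, which is zero: covariant
differentiation commutes with pull-back by an isometry. -/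
theorem cov1_comp_right (h : IsIsom G G' U U' θ) (hz : z ∈ U) {W : Type*} [NormedAddCommGroup W]
    [NormedSpace ℝ W] {A : Euc d → Euc d →L[ℝ] W} (hA : DifferentiableAt ℝ A (θ z))
    (κ : Euc d → Euc d →L[ℝ] W →L[ℝ] W) (w v : Euc d) :
    cov1 (chr G) (fun y => (κ (θ y)).comp (fderiv ℝ θ y))
        (fun y => (A (θ y)).comp (fderiv ℝ θ y)) z w v
      = cov1 (chr G') κ A (θ z) (fderiv ℝ θ z w) (fderiv ℝ θ z v) := by
  have h1 := cov1_chain (Γ := chr G) (Γ' := chr G') (κ := κ) (h.smooth z hz) hA w v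
  have h2 := h.cov1_fderiv hz w v
  unfold pull at h2
  rw [h1, h2, map_zero, add_zero]

theorem tension_comp (h : IsIsom G G' U U' θ) (hz : z ∈ U) (hH : IsMetricOn H V)
    (hu : ∀ y ∈ U', ContDiffAt ℝ ∞ u y) (huV : ∀ y ∈ U', u y ∈ V) :
    Coord.tension G H (fun y => u (θ y)) z = Coord.tension G' H u (θ z) := by
  have hz' := h.maps z hz
  have e := h.fderiv_comp_eventually hz hu
  rw [tension_eq h.source hz hH (u := fun y => u (θ y))
      ((hu _ hz').comp z (h.smooth z hz)) (huV _ hz'),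
    tension_eq h.target hz' hH (hu _ hz') (huV _ hz'),
    ← metricTrace_comp (h.source.inner z hz) (fderiv ℝ θ z) (h.isom z hz) (by
      constructor <;> intros <;> simp only [map_add, map_smul, add_apply, smul_apply])]
  congr 1
  funext v w
  rw [← h.cov1_comp_right hz (ContDiffAt.diff (ContDiffAt.fderiv_infty (hu _ hz')))]
  refine congrArg (fun L => L v w) (cov1_congr ?_ e)
  rw [pull, e.self_of_nhds]
  rfl

theorem laplacian_comp (h : IsIsom G G' U U' θ) (hz : z ∈ U) {φ : Euc d → ℝ}
    (hφ : ∀ y ∈ U', ContDiffAt ℝ ∞ φ y) :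
    Coord.laplacian G (fun y => φ (θ y)) z = Coord.laplacian G' φ (θ z) := by
  have hz' := h.maps z hz
  have e := h.fderiv_comp_eventually hz hφ
  have key : ∀ (G : Euc d → Euc d →L[ℝ] Euc d →L[ℝ] ℝ) (φ : Euc d → ℝ) z v w,
      fderiv ℝ (fderiv ℝ φ) z v w - fderiv ℝ φ z (chr G z v w)
        = cov1 (chr G) (0 : Euc d → Euc d →L[ℝ] ℝ →L[ℝ] ℝ) (fderiv ℝ φ) z v w := by
    intro G φ z v w
    simp [cov1_apply]
  rw [laplacian_eq h.source hz (φ := fun y => φ (θ y)) fun y hy => (hφ _ (h.maps y hy)).comp y (h.smooth y hy),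
    laplacian_eq h.target hz' hφ]
  simp only [key]
  rw [← metricTrace_comp (h.source.inner z hz) (fderiv ℝ θ z) (h.isom z hz) (by
      constructor <;> intros <;> simp only [map_add, map_smul, add_apply, smul_apply])]
  congr 2
  funext v w
  rw [← h.cov1_comp_right hz (ContDiffAt.diff (ContDiffAt.fderiv_infty (hφ _ hz')))]
  exact congrArg (fun L => L v w) (cov1_congr rfl e)

/-- As the second fundamental form of `Θ` vanishes, ∇d(Θ ∘ u) = dΘ ∘ ∇du, and traces commute with
dΘ. -/
theorem comp_tension (hΘ : IsIsom H H' V V' Θ) (hG : IsMetricOn G U) (hz : z ∈ U)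
    (hu : ∀ y ∈ U, ContDiffAt ℝ ∞ u y) (huV : ∀ y ∈ U, u y ∈ V) :
    Coord.tension G H' (fun y => Θ (u y)) z = fderiv ℝ Θ (u z) (Coord.tension G H u z) := by
  have hz' := huV z hz
  have e : fderiv ℝ (fun y => Θ (u y)) =ᶠ[nhds z]
      fun y => (fderiv ℝ Θ (u y)).comp (fderiv ℝ u y) := by
    filter_upwards [hG.eventually hz] with y hy
    exact fderiv_comp y (ContDiffAt.diff (hΘ.smooth _ (huV y hy))) (ContDiffAt.diff (hu y hy))
  rw [tension_eq hG hz hΘ.target (u := fun y => Θ (u y))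
      ((hΘ.smooth _ hz').comp z (hu z hz)) (hΘ.maps _ hz'),
    tension_eq hG hz hΘ.source (hu z hz) hz']
  refine Eq.trans ?_ (metricTrace_map (b := G z) (fderiv ℝ Θ (u z)).toLinearMap _).symm
  congr 1
  funext v w
  have h1 := cov1_chain (Γ := chr G) (Γ' := chr H) (κ := pull H' Θ) (hu z hz)
    (ContDiffAt.diff (ContDiffAt.fderiv_infty (hΘ.smooth _ hz'))) v w
  rw [hΘ.cov1_fderiv hz', zero_add] at h1
  refine Eq.trans (congrArg (fun L => L v w) (cov1_congr ?_ e)) h1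
  rw [pull, e.self_of_nhds]
  rfl

theorem fderiv_projD (h : IsIsom G G' U U' θ) (hD : ∀ y ∈ U, ∀ v, v ∈ D y ↔ fderiv ℝ θ y v ∈ D' (θ y))
    (hz : z ∈ U) (v : Euc d) :
    fderiv ℝ θ z (projD G D z v) = projD G' D' (θ z) (fderiv ℝ θ z v) :=
  (orthProj_comp (h.source.inner z hz) (h.target.inner _ (h.maps z hz)) _ (h.isom z hz)
    (h.surjective hz) (hD z hz) v).symm

/-- P = (dθ)⁻¹ P' dθ, and inversion of linear isomorphisms is smooth. -/
theorem smooth_projD (h : IsIsom G G' U U' θ)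
    (hD : ∀ y ∈ U, ∀ v, v ∈ D y ↔ fderiv ℝ θ y v ∈ D' (θ y)) (hz : z ∈ U)
    (hP : ContDiffAt ℝ ∞ (projD G' D') (θ z)) : ContDiffAt ℝ ∞ (projD G D) z := by
  let e : Euc d ≃L[ℝ] Euc d := (LinearEquiv.ofBijective (fderiv ℝ θ z).toLinearMap
    ⟨h.injective hz, h.surjective hz⟩).toContinuousLinearEquiv
  have he : (e : Euc d →L[ℝ] Euc d) = fderiv ℝ θ z := by
    ext1 v
    rfl
  have h1 := ContDiffAt.fderiv_infty (h.smooth z hz)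
  have h2 : ContDiffAt ℝ ∞ (ContinuousLinearMap.inverse ∘ fderiv ℝ θ) z :=
    ContDiffAt.comp z (by rw [← he]; exact contDiffAt_map_inverse e) h1
  refine ContDiffAt.congr_of_eventuallyEq
    (h2.clm_comp ((hP.comp z (h.smooth z hz)).clm_comp h1)) ?_
  filter_upwards [h.source.eventually hz] with y hy
  let e : Euc d ≃L[ℝ] Euc d := (LinearEquiv.ofBijective (fderiv ℝ θ y).toLinearMap
    ⟨h.injective hy, h.surjective hy⟩).toContinuousLinearEquiv
  have he : (e : Euc d →L[ℝ] Euc d) = fderiv ℝ θ y := by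
    ext1 v
    rfl
  ext1 v
  simp only [ContinuousLinearMap.comp_apply, Function.comp_apply]
  rw [← h.fderiv_projD hD hy, ← he, ContinuousLinearMap.inverse_equiv]
  exact (e.symm_apply_apply _).symm

/-- Differentiate dθ ∘ P = P' ∘ dθ, with dθ parallel. -/
theorem fderiv_covP (h : IsIsom G G' U U' θ) (hD : ∀ y ∈ U, ∀ v, v ∈ D y ↔ fderiv ℝ θ y v ∈ D' (θ y))
    (hz : z ∈ U) (hP : ContDiffAt ℝ ∞ (projD G' D') (θ z)) (w v : Euc d) :
    fderiv ℝ θ z (covP G D z w v) = covP G' D' (θ z) (fderiv ℝ θ z w) (fderiv ℝ θ z v) := by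
  have hθ := h.smooth z hz
  have e : (fun y => (fderiv ℝ θ y).comp (projD G D y)) =ᶠ[nhds z]
      fun y => (projD G' D' (θ y)).comp (fderiv ℝ θ y) := by
    filter_upwards [h.source.eventually hz] with y hy
    ext1 v
    exact h.fderiv_projD hD hy v
  have h1 := cov1_comp (Γ := chr G) (κ := pull G' θ)
    (ContDiffAt.diff (ContDiffAt.fderiv_infty hθ)) (ContDiffAt.diff (h.smooth_projD hD hz hP)) w v
  have h2 := h.cov1_comp_right hz (ContDiffAt.diff hP) (chr G') w v
  rw [h.cov1_fderiv hz, zero_add] at h1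
  rw [← h1, ← h2]
  exact congrArg (fun L => L w v) (cov1_congr rfl e)

theorem fderiv_meanCurvature (h : IsIsom G G' U U' θ)
    (hD : ∀ y ∈ U, ∀ v, v ∈ D y ↔ fderiv ℝ θ y v ∈ D' (θ y)) (hz : z ∈ U)
    (hP : ∀ y ∈ U', ContDiffAt ℝ ∞ (projD G' D') y) :
    fderiv ℝ θ z (Coord.meanCurvature G D z) = Coord.meanCurvature G' D' (θ z) := by
  have hz' := h.maps z hz
  rw [IsTenseOn.meanCurvature_eq h.source
      (fun y hy => h.smooth_projD hD hy (hP _ (h.maps y hy))) hz,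
    IsTenseOn.meanCurvature_eq h.target hP hz',
    ← metricTrace_comp (h.source.inner z hz) (fderiv ℝ θ z) (h.isom z hz)
      (B := fun v w => covP G' D' (θ z) (projD G' D' (θ z) v) (projD G' D' (θ z) w)) (by
      constructor <;> intros <;> simp only [map_add, map_smul, add_apply, smul_apply])]
  have h1 := metricTrace_map (b := G z) ((fderiv ℝ θ z : Euc d →L[ℝ] Euc d) : Euc d →ₗ[ℝ] Euc d)
    fun v w => covP G D z (projD G D z v) (projD G D z w)
  simp only [ContinuousLinearMap.coe_coe] at h1
  rw [h1]
  congr 1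
  funext v w
  rw [h.fderiv_covP hD hz (hP _ hz'), h.fderiv_projD hD hz, h.fderiv_projD hD hz]

theorem fderiv_nab (h : IsIsom G G' U U' θ) (hz : z ∈ U) {τ τ' : Euc d → Euc d}
    (hτ : DifferentiableAt ℝ τ z) (hτ' : DifferentiableAt ℝ τ' (θ z))
    (e : ∀ y ∈ U, fderiv ℝ θ y (τ y) = τ' (θ y)) (w : Euc d) :
    fderiv ℝ θ z (nab (chr G) τ z w) = nab (chr G') τ' (θ z) (fderiv ℝ θ z w) := by
  have hθ := h.smooth z hz
  have e' : (fun y => fderiv ℝ θ y (τ y)) =ᶠ[nhds z] τ' ∘ θ := by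
    filter_upwards [h.source.eventually hz] with y hy
    exact e y hy
  have h1 := DFunLike.congr_fun (Filter.EventuallyEq.fderiv_eq (𝕜 := ℝ) e') w
  rw [fderiv_apply₁ (ContDiffAt.diff (ContDiffAt.fderiv_infty hθ)) hτ,
    fderiv_comp z hτ' (ContDiffAt.diff hθ)] at h1
  have h2 := h.cov1_fderiv hz w (τ z)
  rw [cov1_apply, pull_apply] at h2
  simp only [ContinuousLinearMap.comp_apply] at h1
  rw [nab, nab, map_add, ← h1, ← e z hz, ← sub_eq_zero, ← neg_eq_zero]
  rw [← h2]
  abel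

theorem smooth_meanCurvature (hG : IsMetricOn G U) (hP : ∀ y ∈ U, ContDiffAt ℝ ∞ (projD G D) y)
    (hz : z ∈ U) : ContDiffAt ℝ ∞ (Coord.meanCurvature G D) z := by
  have h1 : ContDiffWithinAt ℝ ∞ (fun z => metricTrace (G z) fun v w =>
      covP G D z (projD G D z v) (projD G D z w)) Set.univ z := by
    refine hG.smooth_metricTrace contDiffWithinAt_id hz fun a b => ?_
    have h2 := contDiffAt_cov1 (hG.smooth_chr hz) (hG.smooth_chr hz) (hP z hz)
    exact ((h2.clm_apply ((hP z hz).clm_apply contDiffAt_const)).clm_apply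
      ((hP z hz).clm_apply contDiffAt_const)).contDiffWithinAt
  refine (h1.contDiffAt Filter.univ_mem).congr_of_eventuallyEq ?_
  filter_upwards [hG.eventually hz] with y hy
  exact IsTenseOn.meanCurvature_eq hG hP hy

end IsIsom

/-- The pointwise conditions in `IsTenseOn`. -/
structure IsTenseAt {d : ℕ} (G : Euc d → Euc d →L[ℝ] Euc d →L[ℝ] ℝ)
    (D : Euc d → Submodule ℝ (Euc d)) (z : Euc d) : Prop where
  invol : ∀ v w, covP G D z (projD G D z v) (projD G D z w)
    = covP G D z (projD G D z w) (projD G D z v)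
  bundle : ∀ v w, covP G D z (v - projD G D z v) (w - projD G D z w)
    = -covP G D z (w - projD G D z w) (v - projD G D z v)
  tense : ∀ v, projD G D z (nab (chr G) (Coord.meanCurvature G D) z (projD G D z v)
      - covP G D z (Coord.meanCurvature G D z) v)
    = nab (chr G) (Coord.meanCurvature G D) z (projD G D z v)
      - covP G D z (Coord.meanCurvature G D z) v

/-- The three conditions are equalities between vectors built naturally from metric and
distribution, so they can be checked after applying the injective map dθ. They can therefore be
verified one point at a time, each point in a chart of its own. -/
theorem IsIsom.isTenseAt {d : ℕ} {G G' : Euc d → Euc d →L[ℝ] Euc d →L[ℝ] ℝ} {U U' : Set (Euc d)}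
    {θ : Euc d → Euc d} {z : Euc d} {D D' : Euc d → Submodule ℝ (Euc d)}
    (h : IsIsom G G' U U' θ) (hD : ∀ y ∈ U, ∀ v, v ∈ D y ↔ fderiv ℝ θ y v ∈ D' (θ y)) (hz : z ∈ U)
    (hP : ∀ y ∈ U', ContDiffAt ℝ ∞ (projD G' D') y) (ht : IsTenseAt G' D' (θ z)) :
    IsTenseAt G D z := by
  have hz' := h.maps z hz
  have hP0 := hP _ hz'
  have hPs : ∀ y ∈ U, ContDiffAt ℝ ∞ (projD G D) y := fun y hy =>
    h.smooth_projD hD hy (hP _ (h.maps y hy))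
  have hn := h.fderiv_nab hz (ContDiffAt.diff (smooth_meanCurvature h.source hPs hz))
    (ContDiffAt.diff (smooth_meanCurvature h.target hP hz'))
    fun y hy => h.fderiv_meanCurvature hD hy hP
  have hQ : ∀ v, fderiv ℝ θ z (v - projD G D z v)
      = fderiv ℝ θ z v - projD G' D' (θ z) (fderiv ℝ θ z v) := fun v => by
    rw [map_sub, h.fderiv_projD hD hz]
  refine ⟨fun v w => h.injective hz ?_, fun v w => h.injective hz ?_,
    fun v => h.injective hz ?_⟩
  · simp only [h.fderiv_covP hD hz hP0, h.fderiv_projD hD hz]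
    exact ht.invol _ _
  · rw [map_neg, h.fderiv_covP hD hz hP0, h.fderiv_covP hD hz hP0, hQ, hQ]
    exact ht.bundle _ _
  · simp only [h.fderiv_covP hD hz hP0, h.fderiv_projD hD hz, map_sub, hn,
      h.fderiv_meanCurvature hD hz hP]
    have := ht.tense (fderiv ℝ θ z v)
    simpa only [map_sub] using this

/-! ### Parametrizations of manifolds -/

section Param

open Bundle

variable {d q : ℕ} {M : Type*} [TopologicalSpace M] [ChartedSpace (EuclideanSpace ℝ (Fin d)) M]
  {N : Type*} [TopologicalSpace N] [ChartedSpace (EuclideanSpace ℝ (Fin q)) N]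

theorem pullbackForm_apply (θ : M → N) (g : FormField q N) (x : M) (v w : TangentSpace (𝓡 d) x) :
    pullbackForm θ g x v w
      = g (θ x) (mfderiv (𝓡 d) (𝓡 q) θ x v) (mfderiv (𝓡 d) (𝓡 q) θ x w) := rfl

theorem mem_pullbackDistribution (θ : M → N) (D : Distribution q N) (x : M)
    (v : TangentSpace (𝓡 d) x) :
    v ∈ pullbackDistribution θ D x ↔ mfderiv (𝓡 d) (𝓡 q) θ x v ∈ D (θ x) := Iff.rfl

theorem pullbackForm_comp {r : ℕ} {P : Type*} [TopologicalSpace P]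
    [ChartedSpace (EuclideanSpace ℝ (Fin r)) P] {ψ : P → M} {θ : M → N} (g : FormField q N) {x : P}
    (hψ : MDifferentiableAt (𝓡 r) (𝓡 d) ψ x) (hθ : MDifferentiableAt (𝓡 d) (𝓡 q) θ (ψ x)) :
    pullbackForm (d := r) (q := d) ψ (pullbackForm (d := d) (q := q) θ g) x
      = pullbackForm (d := r) (q := q) (θ ∘ ψ) g x := by
  refine ContinuousLinearMap.ext fun v => ContinuousLinearMap.ext fun w => ?_
  rw [pullbackForm_apply, pullbackForm_apply, pullbackForm_apply, mfderiv_comp x hθ hψ]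
  rfl

theorem pullbackDistribution_comp {r : ℕ} {P : Type*} [TopologicalSpace P]
    [ChartedSpace (EuclideanSpace ℝ (Fin r)) P] {ψ : P → M} {θ : M → N} (D : Distribution q N)
    {x : P} (hψ : MDifferentiableAt (𝓡 r) (𝓡 d) ψ x)
    (hθ : MDifferentiableAt (𝓡 d) (𝓡 q) θ (ψ x)) :
    pullbackDistribution (d := r) (q := d) ψ (pullbackDistribution (d := d) (q := q) θ D) x
      = pullbackDistribution (d := r) (q := q) (θ ∘ ψ) D x := by
  ext v
  rw [mem_pullbackDistribution, mem_pullbackDistribution, mem_pullbackDistribution,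
    mfderiv_comp x hθ hψ]
  rfl

/-- The tangent spaces at `θ x` and `θ' x` are formally different types, so everything is read in
the common model space before rewriting. -/
theorem pullbackForm_congr {θ θ' : M → N} (g : FormField q N) {x : M} (h : θ =ᶠ[nhds x] θ') :
    pullbackForm (d := d) (q := q) θ g x = pullbackForm (d := d) (q := q) θ' g x := by
  have h1 := h.self_of_nhds
  have h2 : (mfderiv (𝓡 d) (𝓡 q) θ x : Euc d →L[ℝ] Euc q) = mfderiv (𝓡 d) (𝓡 q) θ' x :=
    h.mfderiv_eq
  have h3 : (g (θ x) : Euc q →L[ℝ] Euc q →L[ℝ] ℝ) = g (θ' x) := by rw [h1]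
  refine ContinuousLinearMap.ext fun v => ContinuousLinearMap.ext fun w => ?_
  change (g (θ x) : Euc q →L[ℝ] Euc q →L[ℝ] ℝ) ((mfderiv (𝓡 d) (𝓡 q) θ x : Euc d →L[ℝ] Euc q) v)
    ((mfderiv (𝓡 d) (𝓡 q) θ x : Euc d →L[ℝ] Euc q) w) = _
  rw [h2, h3]
  rfl

theorem pullbackDistribution_congr {θ θ' : M → N} (D : Distribution q N) {x : M}
    (h : θ =ᶠ[nhds x] θ') : pullbackDistribution (d := d) (q := q) θ D x
      = pullbackDistribution (d := d) (q := q) θ' D x := by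
  have h1 := h.self_of_nhds
  have h2 : (mfderiv (𝓡 d) (𝓡 q) θ x : Euc d →L[ℝ] Euc q) = mfderiv (𝓡 d) (𝓡 q) θ' x :=
    h.mfderiv_eq
  have h3 : (D (θ x) : Submodule ℝ (Euc q)) = D (θ' x) := by rw [h1]
  ext v
  change (mfderiv (𝓡 d) (𝓡 q) θ x : Euc d →L[ℝ] Euc q) v ∈ (D (θ x) : Submodule ℝ (Euc q)) ↔ _
  rw [h2, h3]
  rfl

/-- The coordinate expression of a form in a parametrization. -/
def coordForm (ψ : Euc d → M) (g : FormField d M) : Euc d → Euc d →L[ℝ] Euc d →L[ℝ] ℝ :=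
  pullbackForm (M := Euc d) ψ g

/-- The coordinate expression of a distribution in a parametrization. -/
def coordDist (ψ : Euc d → M) (D : Distribution d M) : Euc d → Submodule ℝ (Euc d) :=
  pullbackDistribution (M := Euc d) ψ D

/-- Immersed parametrizations of (open parts of) a manifold. -/
structure IsParam (ψ : Euc d → M) (U : Set (Euc d)) : Prop where
  isOpen : IsOpen U
  smooth : ∀ z ∈ U, ContMDiffAt (𝓡 d) (𝓡 d) ∞ ψ z
  inj : ∀ z ∈ U, Function.Injective (mfderiv (𝓡 d) (𝓡 d) ψ z)

namespace IsParam

variable {ψ : Euc d → M} {U : Set (Euc d)} {z : Euc d}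

theorem mdiff (h : IsParam ψ U) (hz : z ∈ U) : MDifferentiableAt (𝓡 d) (𝓡 d) ψ z :=
  (h.smooth z hz).mdifferentiableAt (by simp)

theorem surj (h : IsParam ψ U) (hz : z ∈ U) :
    Function.Surjective (mfderiv (𝓡 d) (𝓡 d) ψ z) := by
  let L : Euc d →ₗ[ℝ] Euc d := (mfderiv (𝓡 d) (𝓡 d) ψ z).toLinearMap
  exact LinearMap.surjective_of_injective (f := L) (h.inj z hz)

theorem comp (h : IsParam ψ U) {N : Type*} [TopologicalSpace N]
    [ChartedSpace (EuclideanSpace ℝ (Fin d)) N] {p : M → N} (hp : ContMDiff (𝓡 d) (𝓡 d) ∞ p)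
    (hi : ∀ x, Function.Injective (mfderiv (𝓡 d) (𝓡 d) p x)) : IsParam (p ∘ ψ) U := by
  refine ⟨h.isOpen, fun z hz => (hp _).comp z (h.smooth z hz), fun z hz => ?_⟩
  rw [mfderiv_comp z ((hp _).mdifferentiableAt (by simp)) (h.mdiff hz)]
  exact (hi _).comp (h.inj z hz)

variable [IsManifold (𝓡 d) ∞ M]

theorem chart (x : M) : IsParam (extChartAt (𝓡 d) x).symm (extChartAt (𝓡 d) x).target := by
  refine ⟨isOpen_extChartAt_target x, fun z hz => (contMDiffOn_extChartAt_symm x).contMDiffAt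
    ((isOpen_extChartAt_target x).mem_nhds hz), fun z hz => ?_⟩
  have := isInvertible_mfderivWithin_extChartAt_symm (I := 𝓡 d) hz
  rw [ModelWithCorners.range_eq_univ, mfderivWithin_univ] at this
  exact this.bijective.injective

/-- The field of tangent vectors along a parametrization defined by a field of vectors. -/
theorem smooth_tangent (h : IsParam ψ U) (hz : z ∈ U) {v : Euc d → Euc d}
    (hv : ContDiffAt ℝ ∞ v z) : ContMDiffAt (𝓡 d) (𝓡 d).tangent ∞
      (fun y => (⟨ψ y, mfderiv (𝓡 d) (𝓡 d) ψ y (v y)⟩ : TangentBundle (𝓡 d) M)) z := by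
  have h0 : ContMDiffOn (𝓡 d) (𝓡 d) ∞ ψ U := fun y hy => (h.smooth y hy).contMDiffWithinAt
  have h1 := h0.contMDiffOn_tangentMapWithin (m := ∞) (by simp) h.isOpen.uniqueMDiffOn
  have h2 : ContMDiffAt (𝓡 d) (𝓡 d).tangent ∞ (fun y : Euc d =>
      (⟨y, (v y : TangentSpace (𝓡 d) y)⟩ : TangentBundle (𝓡 d) (Euc d))) z := by
    exact contMDiffAt_vectorSpace_iff_contDiffAt.2 hv
  have h3 := ((h1 _ hz).comp_of_eq (x := z) (t := _ ⁻¹' U)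
    h2.contMDiffWithinAt (Set.mapsTo_preimage _ _) rfl).contMDiffAt (h.isOpen.mem_nhds hz)
  refine h3.congr_of_eventuallyEq ?_
  filter_upwards [h.isOpen.mem_nhds hz] with y hy
  simp only [Function.comp_apply, tangentMapWithin]
  rw [mfderivWithin_of_isOpen h.isOpen hy]

/-- The coordinate expression of the metric is smooth. -/
theorem isMetricOn (h : IsParam ψ U) (g : Metric d M) : IsMetricOn (coordForm ψ g.inner) U := by
  refine ⟨h.isOpen, fun z hz => ?_, fun z hz => ⟨fun v w => g.symm (ψ z) _ _, fun v hv =>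
    g.pos (ψ z) (mfderiv (𝓡 d) (𝓡 d) ψ z v) fun h0 => hv (h.inj z hz
      (h0.trans (map_zero (mfderiv (𝓡 d) (𝓡 d) ψ z)).symm))⟩⟩
  suffices ContDiffOn ℝ ∞ (coordForm ψ g.inner) U from this.contDiffAt (h.isOpen.mem_nhds hz)
  -- In finite dimension a field of linear maps is smooth as soon as its values on constant vectors
  -- are.
  refine contDiffOn_clm_apply.2 fun v => contDiffOn_clm_apply.2 fun w => fun y hy => ?_
  refine ContDiffAt.contDiffWithinAt ?_
  rw [← contMDiffAt_iff_contDiffAt]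
  have h1 : ContMDiffAt (𝓡 d) ((𝓡 d).prod 𝓘(ℝ)) ∞ (fun y => TotalSpace.mk' ℝ
      (E := Bundle.Trivial M ℝ) (ψ y) (g.inner (ψ y) (mfderiv (𝓡 d) (𝓡 d) ψ y v)
        (mfderiv (𝓡 d) (𝓡 d) ψ y w))) y := by
    apply ContMDiffAt.clm_bundle_apply₂ (F₁ := EuclideanSpace ℝ (Fin d))
      (F₂ := EuclideanSpace ℝ (Fin d))
    · exact ContMDiffAt.comp (g := fun b => TotalSpace.mk' (EuclideanSpace ℝ (Fin d) →L[ℝ]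
        EuclideanSpace ℝ (Fin d) →L[ℝ] ℝ) (E := fun x : M => TangentSpace (𝓡 d) x →L[ℝ]
        TangentSpace (𝓡 d) x →L[ℝ] ℝ) b (g.inner b)) y (g.contMDiff (ψ y)) (h.smooth y hy)
    · exact h.smooth_tangent hy contDiffAt_const
    · exact h.smooth_tangent hy contDiffAt_const
  rw [contMDiffAt_totalSpace] at h1
  exact h1.2

end IsParam

end Param

/-! ### Locality of the operators and change of parametrization. -/

section Germs

variable {d q : ℕ} (G : Euc d → Euc d →L[ℝ] Euc d →L[ℝ] ℝ)
  (H : Euc q → Euc q →L[ℝ] Euc q →L[ℝ] ℝ) {z : Euc d}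

theorem laplacian_congr {φ φ' : Euc d → ℝ} (e : φ =ᶠ[nhds z] φ') :
    Coord.laplacian G φ z = Coord.laplacian G φ' z := by
  have h1 : Coord.gradient G φ =ᶠ[nhds z] Coord.gradient G φ' := by
    filter_upwards [e.fderiv (𝕜 := ℝ)] with y hy
    rw [Coord.gradient, Coord.gradient, hy]
  simp only [Coord.laplacian, Coord.divergence, Coord.covDeriv, h1.fderiv_eq, h1.self_of_nhds]

theorem tension_congr {u u' : Euc d → Euc q} (e : u =ᶠ[nhds z] u') :
    Coord.tension G H u z = Coord.tension G H u' z := by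
  have h1 : ∀ v, (fun y => fderiv ℝ u y v) =ᶠ[nhds z] fun y => fderiv ℝ u' y v := by
    intro v
    filter_upwards [e.fderiv (𝕜 := ℝ)] with y hy
    rw [hy]
  simp only [Coord.tension, Coord.covDerivOneForm, Coord.pullbackCovDeriv, (h1 _).fderiv_eq,
    e.fderiv_eq, e.self_of_nhds]

end Germs

section Local

variable {d q : ℕ} {M : Type*} [TopologicalSpace M] [ChartedSpace (EuclideanSpace ℝ (Fin d)) M]
  {N : Type*} [TopologicalSpace N] [ChartedSpace (EuclideanSpace ℝ (Fin q)) N]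
  {g : FormField d M} {D : Distribution d M} {h : FormField q N} {f : M → N}
  {ψ : Euc d → M} {χ : Euc q → N} {u : Euc d → Euc q} {U : Set (Euc d)} {V : Set (Euc q)} {z : Euc d}

/-- The chain rule for the coordinate expression of a map. -/
theorem mfderiv_coord (hψ : MDifferentiableAt (𝓡 d) (𝓡 d) ψ z)
    (hχ : MDifferentiableAt (𝓡 q) (𝓡 q) χ (u z)) (hf : MDifferentiableAt (𝓡 d) (𝓡 q) f (ψ z))
    (hu : DifferentiableAt ℝ u z) (e : f ∘ ψ =ᶠ[nhds z] χ ∘ u) (v : Euc d) :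
    (mfderiv (𝓡 d) (𝓡 q) f (ψ z) (mfderiv (𝓡 d) (𝓡 d) ψ z v) : Euc q)
      = (mfderiv (𝓡 q) (𝓡 q) χ (u z) (fderiv ℝ u z v) : Euc q) := by
  have h1 := mfderiv_comp z hf hψ
  have h2 : mfderiv (𝓡 d) (𝓡 q) (χ ∘ u) z = _ := mfderiv_comp z hχ hu.mdifferentiableAt
  have h3 : (mfderiv (𝓡 d) (𝓡 q) (f ∘ ψ) z : Euc d →L[ℝ] Euc q)
      = mfderiv (𝓡 d) (𝓡 q) (χ ∘ u) z := e.mfderiv_eq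
  have h4 := DFunLike.congr_fun h3 v
  rw [h1, h2] at h4
  have h5 : (mfderiv (𝓡 d) (𝓡 q) u z : Euc d →L[ℝ] Euc q) = fderiv ℝ u z := mfderiv_eq_fderiv
  rw [← h5]
  exact h4

/-- The tangential energy density in arbitrary parametrizations. -/
theorem tangentialEnergy_eq (hψ : MDifferentiableAt (𝓡 d) (𝓡 d) ψ z)
    (hχ : MDifferentiableAt (𝓡 q) (𝓡 q) χ (u z)) (hf : MDifferentiableAt (𝓡 d) (𝓡 q) f (ψ z))
    (hu : DifferentiableAt ℝ u z) (e : f ∘ ψ =ᶠ[nhds z] χ ∘ u) (hb : IsInner (coordForm ψ g z))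
    (hb' : IsInner (d := d) (g (ψ z))) :
    tangentialEnergy g D h f (ψ z)
      = Coord.energy (coordForm ψ g) (coordDist ψ D) (coordForm χ h) u z := by
  have hL : ∀ v w, (g (ψ z) : Euc d →L[ℝ] Euc d →L[ℝ] ℝ)
      ((mfderiv (𝓡 d) (𝓡 d) ψ z : Euc d →L[ℝ] Euc d) v)
      ((mfderiv (𝓡 d) (𝓡 d) ψ z : Euc d →L[ℝ] Euc d) w) = coordForm ψ g z v w := fun v w => rfl
  have hs := isometry_surjective hb _ hL
  have hP : ∀ v, orthProj (d := d) (g (ψ z)) (D (ψ z))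
      ((mfderiv (𝓡 d) (𝓡 d) ψ z : Euc d →L[ℝ] Euc d) v)
      = (mfderiv (𝓡 d) (𝓡 d) ψ z : Euc d →L[ℝ] Euc d)
        (orthProj (coordForm ψ g z) (coordDist ψ D z) v) :=
    orthProj_comp hb hb' _ hL hs fun v => Iff.rfl
  have e0 : (h (f (ψ z)) : Euc q →L[ℝ] Euc q →L[ℝ] ℝ) = h (χ (u z)) := by
    rw [show f (ψ z) = χ (u z) from e.self_of_nhds]
  unfold tangentialEnergy Coord.energy
  congr 1
  refine (metricTrace_comp (b' := (g (ψ z) : Euc d →L[ℝ] Euc d →L[ℝ] ℝ)) hb _ hL ?_).symm.trans ?_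
  · let L : Euc d →ₗ[ℝ] Euc q := (mfderiv (𝓡 d) (𝓡 q) f (ψ z)).toLinearMap.comp
      (tangentProj g D (ψ z))
    let b : Euc q →L[ℝ] Euc q →L[ℝ] ℝ := h (f (ψ z))
    change Bilin fun v w => b (L v) (L w)
    constructor <;> intros <;> simp
  · congr 1
    funext v w
    have key : ∀ v, (tangentialDifferential g D f (ψ z)
        ((mfderiv (𝓡 d) (𝓡 d) ψ z : Euc d →L[ℝ] Euc d) v) : Euc q)
        = (mfderiv (𝓡 q) (𝓡 q) χ (u z) : Euc q →L[ℝ] Euc q)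
          (fderiv ℝ u z (orthProj (coordForm ψ g z) (coordDist ψ D z) v)) := by
      intro v
      refine Eq.trans ?_ (mfderiv_coord hψ hχ hf hu e _)
      exact congrArg (mfderiv (𝓡 d) (𝓡 q) f (ψ z)) (hP v)
    refine Eq.trans (congrArg₂ (fun a b => (h (f (ψ z)) : Euc q →L[ℝ] Euc q →L[ℝ] ℝ) a b)
      (key v) (key w)) ?_
    exact congrArg (fun b : Euc q →L[ℝ] Euc q →L[ℝ] ℝ => b _ _) e0

variable [IsManifold (𝓡 d) ∞ M] [IsManifold (𝓡 q) ∞ N]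

/-- The change of coordinates from a parametrization to a preferred chart. -/
theorem IsParam.exists_isIsom (hp : IsParam ψ U) (hz : z ∈ U) (hψ : IsMetricOn (coordForm ψ g) U)
    (hg : IsMetricOn (chartForm g (ψ z)) (extChartAt (𝓡 d) (ψ z)).target)
    {W : Set (Euc d)} (hW : W ∈ nhds z) :
    ∃ W' ⊆ U ∩ W, z ∈ W' ∧ (∀ y ∈ W', ψ y ∈ (extChartAt (𝓡 d) (ψ z)).source) ∧
      IsIsom (coordForm ψ g) (chartForm g (ψ z)) W' (extChartAt (𝓡 d) (ψ z)).target
        (extChartAt (𝓡 d) (ψ z) ∘ ψ) ∧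
      ∀ y ∈ W', ∀ v, v ∈ coordDist ψ D y ↔ fderiv ℝ (extChartAt (𝓡 d) (ψ z) ∘ ψ) y v
        ∈ chartDistribution D (ψ z) (extChartAt (𝓡 d) (ψ z) (ψ y)) := by
  have hc : ContinuousOn ψ U := fun y hy => (hp.smooth y hy).continuousAt.continuousWithinAt
  have hopen := hc.isOpen_inter_preimage hp.isOpen (isOpen_extChartAt_source (I := 𝓡 d) (ψ z))
  obtain ⟨W₁, hW₁, hW₁o, hzW₁⟩ := mem_nhds_iff.1 hW
  set φ := extChartAt (𝓡 d) (ψ z) with hφ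
  have hsub : (U ∩ ψ ⁻¹' φ.source) ∩ W₁ ⊆ U := fun y hy => hy.1.1
  have hsm : ∀ y ∈ (U ∩ ψ ⁻¹' φ.source) ∩ W₁, ContMDiffAt (𝓡 d) (𝓡 d) ∞ (φ ∘ ψ) y := by
    intro y hy
    exact (contMDiffAt_extChartAt' (by simpa [hφ] using hy.1.2)).comp y (hp.smooth y hy.1.1)
  have hinv : ∀ y ∈ (U ∩ ψ ⁻¹' φ.source) ∩ W₁, φ.symm ∘ (φ ∘ ψ) =ᶠ[nhds y] ψ := by
    intro y hy
    filter_upwards [hopen.mem_nhds hy.1] with y' hy'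
    exact φ.left_inv hy'.2
  have hchart := IsParam.chart (d := d) (ψ z)
  refine ⟨(U ∩ ψ ⁻¹' φ.source) ∩ W₁, fun y hy => ⟨hy.1.1, hW₁ hy.2⟩,
    ⟨⟨hz, mem_extChartAt_source _⟩, hzW₁⟩, fun y hy => hy.1.2,
    ⟨hψ.mono hsub (hopen.inter hW₁o), hg, fun y hy => contMDiffAt_iff_contDiffAt.1 (hsm y hy),
      fun y hy => φ.map_source hy.1.2, fun y hy v w => ?_⟩, fun y hy v => ?_⟩
  · have h1 := pullbackForm_comp (d := d) (q := d) (r := d) g (x := y)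
      ((hsm y hy).mdifferentiableAt (by simp))
      (hchart.mdiff (φ.map_source hy.1.2))
    have h2 := h1.trans (pullbackForm_congr (d := d) (q := d) g (hinv y hy))
    have h3 : (mfderiv (𝓡 d) (𝓡 d) (φ ∘ ψ) y : Euc d →L[ℝ] Euc d) = fderiv ℝ (φ ∘ ψ) y :=
      mfderiv_eq_fderiv
    rw [← h3]
    exact DFunLike.congr_fun (DFunLike.congr_fun h2 v) w
  · have h1 := pullbackDistribution_comp (d := d) (q := d) (r := d) D (x := y)
      ((hsm y hy).mdifferentiableAt (by simp))
      (hchart.mdiff (φ.map_source hy.1.2))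
    have h2 := h1.trans (pullbackDistribution_congr (d := d) (q := d) D (hinv y hy))
    have h3 : (mfderiv (𝓡 d) (𝓡 d) (φ ∘ ψ) y : Euc d →L[ℝ] Euc d) = fderiv ℝ (φ ∘ ψ) y :=
      mfderiv_eq_fderiv
    rw [← h3]
    exact (SetLike.ext_iff.1 h2 v).symm

/-- The Laplace–Beltrami operator in an arbitrary parametrization. -/
theorem laplaceBeltrami_eq (hp : IsParam ψ U) (hz : z ∈ U) (hψ : IsMetricOn (coordForm ψ g) U)
    (hg : IsMetricOn (chartForm g (ψ z)) (extChartAt (𝓡 d) (ψ z)).target) {φ : M → ℝ}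
    (hφ : ContMDiff (𝓡 d) 𝓘(ℝ, ℝ) ∞ φ) :
    laplaceBeltrami g φ (ψ z) = Coord.laplacian (coordForm ψ g) (φ ∘ ψ) z := by
  -- Only the metric matters here; the distribution `⊥` merely fills the slot.
  obtain ⟨W, hWU, hzW, hsrc, hi, -⟩ := hp.exists_isIsom (D := fun _ => ⊥) hz hψ hg Filter.univ_mem
  have hchart := IsParam.chart (d := d) (ψ z)
  have h1 := hi.laplacian_comp hzW (φ := φ ∘ (extChartAt (𝓡 d) (ψ z)).symm) fun y hy =>
    contMDiffAt_iff_contDiffAt.1 ((hφ _).comp y (hchart.smooth y hy))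
  refine h1.symm.trans (laplacian_congr _ ?_)
  filter_upwards [hi.source.isOpen.mem_nhds hzW] with y hy
  simp only [Function.comp_apply]
  rw [PartialEquiv.left_inv _ (hsrc y hy)]

/-- The differential of a parametrization read in the preferred chart at the base point. -/
theorem IsParam.fderiv_chart_comp (hp : IsParam ψ U) (hz : z ∈ U) (v : Euc d) :
    fderiv ℝ (extChartAt (𝓡 d) (ψ z) ∘ ψ) z v
      = (mfderiv (𝓡 d) (𝓡 d) ψ z : Euc d →L[ℝ] Euc d) v := by
  have h1 := mfderiv_comp z (mdifferentiableAt_extChartAt (I := 𝓡 d) (mem_chart_source _ (ψ z)))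
    (hp.mdiff hz)
  rw [mfderiv_extChartAt_self] at h1
  have h3 : (mfderiv (𝓡 d) (𝓡 d) (extChartAt (𝓡 d) (ψ z) ∘ ψ) z : Euc d →L[ℝ] Euc d)
      = fderiv ℝ (extChartAt (𝓡 d) (ψ z) ∘ ψ) z := mfderiv_eq_fderiv
  rw [← h3]
  exact DFunLike.congr_fun h1 v

/-- The tension field in arbitrary parametrizations. -/
theorem tensionField_eq (hp : IsParam ψ U) (hz : z ∈ U) (hψ : IsMetricOn (coordForm ψ g) U)
    (hg : IsMetricOn (chartForm g (ψ z)) (extChartAt (𝓡 d) (ψ z)).target)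
    (hq : IsParam χ V) (hχ : IsMetricOn (coordForm χ h) V)
    (hh : IsMetricOn (chartForm h (f (ψ z))) (extChartAt (𝓡 q) (f (ψ z))).target)
    (hf : ContMDiff (𝓡 d) (𝓡 q) ∞ f) (hu : ∀ y ∈ U, ContDiffAt ℝ ∞ u y)
    (huV : ∀ y ∈ U, u y ∈ V) (e : ∀ y ∈ U, f (ψ y) = χ (u y)) :
    (tensionField g h f (ψ z) : Euc q) = (mfderiv (𝓡 q) (𝓡 q) χ (u z) : Euc q →L[ℝ] Euc q)
      (Coord.tension (coordForm ψ g) (coordForm χ h) u z) := by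
  have hy := e z hz
  obtain ⟨V', hVV', hzV', hsrc', hi', -⟩ := hq.exists_isIsom (D := fun _ => ⊥) (huV z hz) hχ
    (by rwa [← hy]) Filter.univ_mem
  have hfd := hq.fderiv_chart_comp (huV z hz)
  rw [← hy] at hi' hsrc' hfd
  have huz := (hu z hz).continuousAt
  -- The source is shrunk so that `u` stays in `V'`, where the change of target coordinates is an
  -- isometry.
  have hW1 : u ⁻¹' V' ∈ nhds z := huz (hi'.source.isOpen.mem_nhds hzV')
  obtain ⟨W, hWU, hzW, hsrc, hi, -⟩ := hp.exists_isIsom (D := fun _ => ⊥) hz hψ hg hW1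
  set φ := extChartAt (𝓡 d) (ψ z) with hφ
  set η := extChartAt (𝓡 q) (f (ψ z)) with hη
  have hchart : IsParam φ.symm φ.target := IsParam.chart (d := d) (ψ z)
  have hc : ContinuousOn (f ∘ φ.symm) φ.target := fun y hy =>
    (((hf _).comp y (hchart.smooth y hy)).continuousAt).continuousWithinAt
  have hopen := hc.isOpen_inter_preimage hchart.isOpen (isOpen_extChartAt_source (I := 𝓡 q) (f (ψ z)))
  have hfη : ∀ y ∈ W, f (ψ y) ∈ η.source := fun y hy => by
    rw [e y (hWU hy).1]
    exact hsrc' _ (hWU hy).2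
  -- The range of the change of coordinates is cut down to the points that `f` sends into the target
  -- chart, where `f` written in charts is smooth.
  have hi2 : IsIsom (coordForm ψ g) (chartForm g (ψ z)) W
      (φ.target ∩ (f ∘ φ.symm) ⁻¹' η.source) (φ ∘ ψ) :=
    ⟨hi.source, hi.target.mono Set.inter_subset_left hopen, hi.smooth, fun y hy =>
      ⟨hi.maps y hy, by
        simp only [Set.mem_preimage, Function.comp_apply]
        rw [φ.left_inv (hsrc y hy)]
        exact hfη y hy⟩, hi.isom⟩
  have h1 := hi2.tension_comp hzW hh (u := η ∘ f ∘ φ.symm) (fun y hy => contMDiffAt_iff_contDiffAt.1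
    ((contMDiffAt_extChartAt' (by simpa [hη] using hy.2)).comp y
      ((hf _).comp y (hchart.smooth y hy.1)))) fun y hy => η.map_source hy.2
  have h2 : (fun y => (η ∘ f ∘ φ.symm) ((φ ∘ ψ) y)) =ᶠ[nhds z] fun y => (η ∘ χ) (u y) := by
    filter_upwards [hi.source.isOpen.mem_nhds hzW] with y hy
    simp only [Function.comp_apply]
    rw [φ.left_inv (hsrc y hy), e y (hWU hy).1]
  have h3 := hi'.comp_tension hi.source hzW (fun y hy => hu y (hWU hy).1) fun y hy => (hWU hy).2
  rw [hfd, ← tension_congr _ _ h2, h1] at h3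
  exact h3

end Local

/-! ### Foliations in coordinates -/

section Flat

variable {m n : ℕ} {ℓ : Euc (m + n) → Euc (m + n)} {W : Set (Euc (m + n))}
  {D : Euc (m + n) → Submodule ℝ (Euc (m + n))}
  {G : Euc (m + n) → Euc (m + n) →L[ℝ] Euc (m + n) →L[ℝ] ℝ} {z : Euc (m + n)}

/-- The map `ℓ` straightens the distribution `D` over `W`. -/
structure IsFlatOn (m n : ℕ) (ℓ : Euc (m + n) → Euc (m + n))
    (D : Euc (m + n) → Submodule ℝ (Euc (m + n))) (W : Set (Euc (m + n))) : Prop where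
  smooth : ∀ z ∈ W, ContDiffAt ℝ ∞ ℓ z
  inj : ∀ z ∈ W, Function.Injective (fderiv ℝ ℓ z)
  mem : ∀ z ∈ W, ∀ v, v ∈ D z ↔ ∀ j : Fin n, fderiv ℝ ℓ z v (Fin.natAdd m j) = 0

/-- The inclusion of the first factor of `ℝ^(m + n)`. -/
def leafIncl (m n : ℕ) : Euc m →L[ℝ] Euc (m + n) :=
  ∑ i, (EuclideanSpace.proj i : Euc m →L[ℝ] ℝ).smulRight
    (EuclideanSpace.single (Fin.castAdd n i) (1 : ℝ))

theorem leafIncl_castAdd (a : Euc m) (i : Fin m) : leafIncl m n a (Fin.castAdd n i) = a i := by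
  simp [leafIncl, Pi.single_apply]

theorem leafIncl_natAdd (a : Euc m) (j : Fin n) : leafIncl m n a (Fin.natAdd m j) = 0 := by
  have : ∀ i : Fin m, Fin.natAdd m j ≠ Fin.castAdd n i := fun i h => by
    have := congrArg Fin.val h
    simp at this
    omega
  simp [leafIncl, this]

theorem leafIncl_injective : Function.Injective (leafIncl m n) := by
  intro a b h
  ext i
  rw [← leafIncl_castAdd (n := n), h, leafIncl_castAdd]

theorem exists_leafIncl {w : Euc (m + n)} (h : ∀ j : Fin n, w (Fin.natAdd m j) = 0) :
    ∃ a, leafIncl m n a = w := by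
  refine ⟨WithLp.toLp 2 fun i => w (Fin.castAdd n i), ?_⟩
  ext k
  refine Fin.addCases (fun i => ?_) (fun j => ?_) k
  · rw [leafIncl_castAdd]
  · rw [leafIncl_natAdd, h]

namespace IsFlatOn

/-- The differential of the straightening map as an isomorphism. -/
def equiv (h : IsFlatOn m n ℓ D W) (hz : z ∈ W) : Euc (m + n) ≃L[ℝ] Euc (m + n) :=
  (LinearEquiv.ofInjectiveEndo (fderiv ℝ ℓ z).toLinearMap (h.inj z hz)).toContinuousLinearEquiv

theorem coe_equiv (h : IsFlatOn m n ℓ D W) (hz : z ∈ W) :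
    (h.equiv hz : Euc (m + n) →L[ℝ] Euc (m + n)) = fderiv ℝ ℓ z := by
  ext1 v
  rfl

/-- A smooth frame of the distribution. -/
def frame (m n : ℕ) (ℓ : Euc (m + n) → Euc (m + n)) (z : Euc (m + n)) : Euc m →L[ℝ] Euc (m + n) :=
  (fderiv ℝ ℓ z).inverse.comp (leafIncl m n)

theorem frame_apply (h : IsFlatOn m n ℓ D W) (hz : z ∈ W) (a : Euc m) :
    frame m n ℓ z a = (h.equiv hz).symm (leafIncl m n a) := by
  rw [frame, ← h.coe_equiv hz, ContinuousLinearMap.inverse_equiv]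
  rfl

theorem fderiv_frame (h : IsFlatOn m n ℓ D W) (hz : z ∈ W) (a : Euc m) :
    fderiv ℝ ℓ z (frame m n ℓ z a) = leafIncl m n a := by
  rw [h.frame_apply hz, ← h.coe_equiv hz]
  exact (h.equiv hz).apply_symm_apply _

theorem frame_mem (h : IsFlatOn m n ℓ D W) (hz : z ∈ W) (a : Euc m) : frame m n ℓ z a ∈ D z := by
  rw [h.mem z hz]
  intro j
  rw [h.fderiv_frame hz, leafIncl_natAdd]

theorem exists_frame (h : IsFlatOn m n ℓ D W) (hz : z ∈ W) {v : Euc (m + n)} (hv : v ∈ D z) :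
    ∃ a, frame m n ℓ z a = v := by
  obtain ⟨a, ha⟩ := exists_leafIncl ((h.mem z hz v).1 hv)
  exact ⟨a, h.inj z hz (by rw [h.fderiv_frame hz, ha])⟩

theorem frame_injective (h : IsFlatOn m n ℓ D W) (hz : z ∈ W) :
    Function.Injective (frame m n ℓ z) := fun a b hab =>
  leafIncl_injective (n := n) (by rw [← h.fderiv_frame hz, hab, h.fderiv_frame hz])

theorem smooth_frame (h : IsFlatOn m n ℓ D W) (hz : z ∈ W) :
    ContDiffAt ℝ ∞ (frame m n ℓ) z := by
  have h1 : ContDiffAt ℝ ∞ (ContinuousLinearMap.inverse ∘ fderiv ℝ ℓ) z :=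
    ContDiffAt.comp z (by
      rw [← h.coe_equiv hz]
      exact contDiffAt_map_inverse _) (ContDiffAt.fderiv_infty (h.smooth z hz))
  exact h1.clm_comp contDiffAt_const

/-- The metric in the smooth frame. -/
def frameForm (G : Euc (m + n) → Euc (m + n) →L[ℝ] Euc (m + n) →L[ℝ] ℝ)
    (ℓ : Euc (m + n) → Euc (m + n)) (z : Euc (m + n)) : Euc m →L[ℝ] Euc m →L[ℝ] ℝ :=
  (G z).bilinearComp (frame m n ℓ z) (frame m n ℓ z)

theorem isInner_frameForm (h : IsFlatOn m n ℓ D W) (hG : IsMetricOn G W) (hz : z ∈ W) :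
    IsInner (frameForm G ℓ z) := by
  refine ⟨fun a b => (hG.inner z hz).1 _ _, fun a ha => (hG.inner z hz).2 _ fun h0 => ha ?_⟩
  exact h.frame_injective hz ((show frame m n ℓ z a = 0 from h0).trans (map_zero _).symm)

/-- The normal equations of the projection, solved in the local frame. Every ingredient of the
right-hand side is smooth in `z`, which gives `smooth_projD`. -/
theorem projD_eq (h : IsFlatOn m n ℓ D W) (hG : IsMetricOn G W) (hz : z ∈ W) (v : Euc (m + n)) :
    projD G D z v = frame m n ℓ z (sharp (frameForm G ℓ z) fun a => G z (frame m n ℓ z a) v) := by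
  refine orthProj_unique (hG.inner z hz) (h.frame_mem hz _) fun w hw => ?_
  obtain ⟨a, rfl⟩ := h.exists_frame hz hw
  let l : Euc m →L[ℝ] ℝ := ((G z).flip v).comp (frame m n ℓ z)
  have h1 := inner_sharp (h.isInner_frameForm hG hz) l a
  rw [(h.isInner_frameForm hG hz).1] at h1
  rw [map_sub, sub_eq_zero]
  exact h1.symm

theorem smooth_projD (h : IsFlatOn m n ℓ D W) (hG : IsMetricOn G W) (hz : z ∈ W) :
    ContDiffAt ℝ ∞ (projD G D) z := by
  suffices ContDiffOn ℝ ∞ (projD G D) W from this.contDiffAt (hG.isOpen.mem_nhds hz)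
  refine contDiffOn_clm_apply.2 fun v => ?_
  refine ContDiffOn.congr (f := fun z => frame m n ℓ z (sharp (frameForm G ℓ z) fun a =>
    G z (frame m n ℓ z a) v)) (fun y hy => ContDiffAt.contDiffWithinAt ?_)
    fun y hy => h.projD_eq hG hy v
  have hS := h.smooth_frame hy
  have hg := hG.smooth y hy
  have hM : ∀ i j, ContDiffAt ℝ ∞ (fun y => (gramMatrix (frameForm G ℓ y))⁻¹ i j) y :=
    contDiffAt_matrix_inv (M := fun y => gramMatrix (frameForm G ℓ y))
      (fun k l => (hg.clm_apply (hS.clm_apply contDiffAt_const)).clm_apply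
        (hS.clm_apply contDiffAt_const)) (isUnit_det_gram (h.isInner_frameForm hG hy))
  have hs : ContDiffAt ℝ ∞ (fun z => sharp (frameForm G ℓ z) fun a => G z (frame m n ℓ z a) v) y := by
    have h1 : ∀ j : Fin m, ContDiffAt ℝ ∞ (fun z => G z (frame m n ℓ z
        (EuclideanSpace.single j (1 : ℝ))) v) y := fun j =>
      (hg.clm_apply (hS.clm_apply contDiffAt_const)).clm_apply contDiffAt_const
    simp only [sharp, metricTrace]
    exact ContDiffAt.sum fun i _ => ContDiffAt.sum fun j _ => (hM i j).fun_smul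
      ((h1 j).fun_smul (contDiffAt_const (c := EuclideanSpace.single i (1 : ℝ))))
  exact hS.clm_apply hs

/-- The distribution is the common kernel of the exact forms dℓ_j. Differentiating dℓ_j(P y) = 0 and
using the symmetry of D²ℓ shows that the difference of the two sides is tangential; since ∇P sends
tangential vectors to normal ones, it is also normal, hence zero. -/
theorem invol (h : IsFlatOn m n ℓ D W) (hG : IsMetricOn G W) (hz : z ∈ W) (v w : Euc (m + n)) :
    covP G D z (projD G D z v) (projD G D z w) = covP G D z (projD G D z w) (projD G D z v) := by
  have hP : ∀ y ∈ W, ContDiffAt ℝ ∞ (projD G D) y := fun y hy => h.smooth_projD hG hy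
  have hi := fun v => IsTenseOn.proj_idem (D := D) hG hz v
  have dP := ContDiffAt.diff (hP z hz)
  have dL := ContDiffAt.diff (ContDiffAt.fderiv_infty (h.smooth z hz))
  have zero : ∀ x, projD G D z (covP G D z x (projD G D z w)) = 0 ∧
      projD G D z (covP G D z x (projD G D z v)) = 0 := fun x => by
    have h1 := IsTenseOn.covP_eq hG hP hz x (projD G D z w)
    have h2 := IsTenseOn.covP_eq hG hP hz x (projD G D z v)
    rw [hi] at h1 h2
    exact ⟨left_eq_add.1 h1, left_eq_add.1 h2⟩
  have deriv : ∀ x y, ∀ j : Fin n, fderiv ℝ (fderiv ℝ ℓ) z x (projD G D z y) (Fin.natAdd m j)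
      + fderiv ℝ ℓ z (fderiv ℝ (projD G D) z x y) (Fin.natAdd m j) = 0 := by
    intro x y j
    have e : (fun p => (EuclideanSpace.proj (Fin.natAdd m j) : Euc (m + n) →L[ℝ] ℝ)
        (((fderiv ℝ ℓ p).comp (projD G D p)) y)) =ᶠ[nhds z] fun _ => 0 := by
      filter_upwards [hG.eventually hz] with p hp
      exact (h.mem p hp _).1 (orthProj_mem (hG.inner p hp) y) j
    have h1 := DFunLike.congr_fun (Filter.EventuallyEq.fderiv_eq (𝕜 := ℝ) e) x
    rw [fderiv_const_apply] at h1
    have d1 : DifferentiableAt ℝ (fun p => fderiv ℝ ℓ p (projD G D p y)) z := by fun_prop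
    have h2 := fderiv_comp z ((EuclideanSpace.proj (Fin.natAdd m j) :
      Euc (m + n) →L[ℝ] ℝ)).differentiableAt d1
    rw [ContinuousLinearMap.fderiv] at h2
    have h3 := fderiv_apply₁ (F := fderiv ℝ ℓ) (s := fun p => projD G D p y) dL (by fun_prop) x
    rw [fderiv_apply_const dP] at h3
    have h4 := (DFunLike.congr_fun h2 x).symm.trans h1
    rw [ContinuousLinearMap.comp_apply, h3] at h4
    exact h4
  set Δ := fderiv ℝ (projD G D) z (projD G D z v) (projD G D z w)
    - fderiv ℝ (projD G D) z (projD G D z w) (projD G D z v) with hΔ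
  have hΔD : Δ ∈ D z := by
    rw [h.mem z hz]
    intro j
    have h1 := deriv (projD G D z v) (projD G D z w) j
    have h2 := deriv (projD G D z w) (projD G D z v) j
    rw [hi] at h1 h2
    rw [fderiv_fderiv_symm (h.smooth z hz)] at h1
    rw [hΔ, map_sub, PiLp.sub_apply]
    linarith
  have hcov : covP G D z (projD G D z v) (projD G D z w)
      - covP G D z (projD G D z w) (projD G D z v) = Δ := by
    rw [covP, cov1_apply, cov1_apply, hi, hi, hG.chr_symm hz (projD G D z w), hΔ]
    abel
  have h0 : projD G D z Δ = Δ := orthProj_of_mem (hG.inner z hz) hΔD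
  rw [← sub_eq_zero, hcov, ← h0, ← hcov, map_sub, (zero _).1, (zero _).2, sub_zero]

end IsFlatOn

end Flat

section Manifold

variable {m n : ℕ} {M : Type*} [TopologicalSpace M]
  [ChartedSpace (EuclideanSpace ℝ (Fin (m + n))) M] {D : Distribution (m + n) M}
  {ψ : Euc (m + n) → M} {U : Set (Euc (m + n))} {z : Euc (m + n)}

/-- A foliation is locally straightened in any parametrization. -/
theorem IsParam.exists_isFlatOn (hD : IsFoliation m n D) (hp : IsParam ψ U) (hz : z ∈ U) :
    ∃ ℓ W, IsOpen W ∧ z ∈ W ∧ W ⊆ U ∧ IsFlatOn m n ℓ (coordDist ψ D) W := by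
  obtain ⟨Φ, hΦ, hzΦ, hmem⟩ := hD (ψ z)
  have hc : ContinuousOn ψ U := fun y hy => (hp.smooth y hy).continuousAt.continuousWithinAt
  have hopen := hc.isOpen_inter_preimage hp.isOpen Φ.open_source
  have hs : ∀ y ∈ U ∩ ψ ⁻¹' Φ.source, ContMDiffAt (𝓡 (m + n)) (𝓡 (m + n)) ∞ (Φ ∘ ψ) y :=
    fun y hy => (contMDiffAt_of_mem_maximalAtlas hΦ hy.2).comp y (hp.smooth y hy.1)
  have hd : ∀ y ∈ U ∩ ψ ⁻¹' Φ.source, ∀ v, fderiv ℝ (Φ ∘ ψ) y v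
      = (mfderiv (𝓡 (m + n)) (𝓡 (m + n)) Φ (ψ y)
        (mfderiv (𝓡 (m + n)) (𝓡 (m + n)) ψ y v) : Euc (m + n)) := by
    intro y hy v
    have h1 := mfderiv_comp y ((contMDiffAt_of_mem_maximalAtlas hΦ hy.2).mdifferentiableAt
      (by simp)) (hp.mdiff hy.1)
    have h3 : (mfderiv (𝓡 (m + n)) (𝓡 (m + n)) (Φ ∘ ψ) y : Euc (m + n) →L[ℝ] Euc (m + n))
      = fderiv ℝ (Φ ∘ ψ) y := mfderiv_eq_fderiv
    rw [← h3]
    exact DFunLike.congr_fun h1 v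
  have hΦ' : Φ.MDifferentiable (𝓡 (m + n)) (𝓡 (m + n)) :=
    ⟨(contMDiffOn_of_mem_maximalAtlas hΦ).mdifferentiableOn (by simp),
      (contMDiffOn_symm_of_mem_maximalAtlas hΦ).mdifferentiableOn (by simp)⟩
  refine ⟨Φ ∘ ψ, U ∩ ψ ⁻¹' Φ.source, hopen, ⟨hz, hzΦ⟩, Set.inter_subset_left,
    fun y hy => contMDiffAt_iff_contDiffAt.1 (hs y hy), fun y hy v w hvw => ?_, fun y hy v => ?_⟩
  · rw [hd y hy, hd y hy] at hvw
    exact hp.inj y hy.1 (hΦ'.mfderiv_injective hy.2 hvw)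
  · rw [hd y hy]
    exact hmem (ψ y) hy.2 (mfderiv (𝓡 (m + n)) (𝓡 (m + n)) ψ y v)

theorem IsParam.smooth_projD {G : Euc (m + n) → Euc (m + n) →L[ℝ] Euc (m + n) →L[ℝ] ℝ}
    (hD : IsFoliation m n D) (hp : IsParam ψ U) (hG : IsMetricOn G U) (hz : z ∈ U) :
    ContDiffAt ℝ ∞ (projD G (coordDist ψ D)) z := by
  obtain ⟨ℓ, W, hW, hzW, hWU, hℓ⟩ := hp.exists_isFlatOn hD hz
  exact hℓ.smooth_projD (hG.mono hWU hW) hzW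

theorem IsParam.invol {G : Euc (m + n) → Euc (m + n) →L[ℝ] Euc (m + n) →L[ℝ] ℝ}
    (hD : IsFoliation m n D) (hp : IsParam ψ U) (hG : IsMetricOn G U) (hz : z ∈ U)
    (v w : Euc (m + n)) :
    covP G (coordDist ψ D) z (projD G (coordDist ψ D) z v) (projD G (coordDist ψ D) z w)
      = covP G (coordDist ψ D) z (projD G (coordDist ψ D) z w) (projD G (coordDist ψ D) z v) := by
  obtain ⟨ℓ, W, hW, hzW, hWU, hℓ⟩ := hp.exists_isFlatOn hD hz
  exact hℓ.invol (hG.mono hWU hW) hzW v w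

end Manifold

/-! ### Vector fields in the preferred charts -/

section Fields

variable {d : ℕ} {M : Type*} [TopologicalSpace M] [ChartedSpace (EuclideanSpace ℝ (Fin d)) M]
  [IsManifold (𝓡 d) ∞ M] {x : M}

theorem mfderiv_extChartAt_symm_self (x : M) :
    (mfderiv (𝓡 d) (𝓡 d) (extChartAt (𝓡 d) x).symm (extChartAt (𝓡 d) x x) : Euc d →L[ℝ] Euc d)
      = ContinuousLinearMap.id ℝ (Euc d) := by
  have h := mfderivWithin_range_extChartAt_symm (I := 𝓡 d) (x := x)
  rw [ModelWithCorners.range_eq_univ, mfderivWithin_univ] at h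
  exact h

theorem chartForm_self (g : FormField d M) (x : M) :
    chartForm g x (extChartAt (𝓡 d) x x) = (g x : Euc d →L[ℝ] Euc d →L[ℝ] ℝ) := by
  refine ContinuousLinearMap.ext fun v => ContinuousLinearMap.ext fun w => ?_
  change (g ((extChartAt (𝓡 d) x).symm (extChartAt (𝓡 d) x x)) : Euc d →L[ℝ] Euc d →L[ℝ] ℝ)
    ((mfderiv (𝓡 d) (𝓡 d) (extChartAt (𝓡 d) x).symm (extChartAt (𝓡 d) x x)
      : Euc d →L[ℝ] Euc d) v)
    ((mfderiv (𝓡 d) (𝓡 d) (extChartAt (𝓡 d) x).symm (extChartAt (𝓡 d) x x)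
      : Euc d →L[ℝ] Euc d) w) = _
  rw [mfderiv_extChartAt_symm_self, extChartAt_to_inv]
  rfl

theorem chartDistribution_self (D : Distribution d M) (x : M) :
    chartDistribution D x (extChartAt (𝓡 d) x x) = (D x : Submodule ℝ (Euc d)) := by
  ext v
  change (mfderiv (𝓡 d) (𝓡 d) (extChartAt (𝓡 d) x).symm (extChartAt (𝓡 d) x x)
    : Euc d →L[ℝ] Euc d) v ∈ (D ((extChartAt (𝓡 d) x).symm (extChartAt (𝓡 d) x x))
      : Submodule ℝ (Euc d)) ↔ _
  rw [mfderiv_extChartAt_symm_self, extChartAt_to_inv]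
  rfl

/-- The vector field `V` has the coordinate expression `Vc` near the centre of the preferred chart
at `x`. -/
def HasCoord (x : M) (V : ∀ y : M, TangentSpace (𝓡 d) y) (Vc : Euc d → Euc d) : Prop :=
  ∀ᶠ y in nhds (extChartAt (𝓡 d) x x), (V ((extChartAt (𝓡 d) x).symm y) : Euc d)
    = (mfderiv (𝓡 d) (𝓡 d) (extChartAt (𝓡 d) x).symm y : Euc d →L[ℝ] Euc d) (Vc y)

theorem HasCoord.self {V : ∀ y : M, TangentSpace (𝓡 d) y} {Vc : Euc d → Euc d}
    (h : HasCoord x V Vc) : (V x : Euc d) = Vc (extChartAt (𝓡 d) x x) := by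
  have h1 := h.self_of_nhds
  rw [mfderiv_extChartAt_symm_self, extChartAt_to_inv] at h1
  exact h1

/-- A vector field in coordinates extends, from a neighbourhood of the centre of the chart. -/
theorem exists_hasCoord [T2Space M] (x : M) {Vc : Euc d → Euc d}
    (hV : ∀ y ∈ (extChartAt (𝓡 d) x).target, ContDiffAt ℝ ∞ Vc y) :
    ∃ V : ∀ y : M, TangentSpace (𝓡 d) y, IsSmoothField V ∧ HasCoord x V Vc ∧
      ∀ D : Distribution d M, (∀ y ∈ (extChartAt (𝓡 d) x).target, Vc y ∈ chartDistribution D x y) →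
        ∀ y, V y ∈ D y := by
  obtain ⟨χ⟩ : Nonempty (SmoothBumpFunction (𝓡 d) x) := inferInstance
  set φ := extChartAt (𝓡 d) x with hφ
  have hchart : IsParam φ.symm φ.target := IsParam.chart (d := d) x
  let s : ∀ y : M, TangentSpace (𝓡 d) y := fun y =>
    (mfderiv (𝓡 d) (𝓡 d) φ.symm (φ y) : Euc d →L[ℝ] Euc d) (Vc (φ y))
  have hs : ContMDiffOn (𝓡 d) (𝓡 d).tangent ∞
      (fun y => (⟨y, s y⟩ : TangentBundle (𝓡 d) M)) φ.source := by
    intro y hy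
    have h1 := (hchart.smooth_tangent (φ.map_source hy) (hV _ (φ.map_source hy))).comp y
      (contMDiffAt_extChartAt' (n := ∞) (by simpa [hφ] using hy))
    refine (h1.congr_of_eventuallyEq ?_).contMDiffWithinAt
    filter_upwards [(isOpen_extChartAt_source (I := 𝓡 d) x).mem_nhds hy] with y' hy'
    have key : ∀ (a b : M) (_ : a = b) (v : Euc d), (⟨a, v⟩ : TangentBundle (𝓡 d) M) = ⟨b, v⟩ := by
      rintro a _ rfl v
      rfl
    exact key _ _ (φ.left_inv hy').symm _
  -- The bump function is 1 near `x` and supported in the chart domain, so the product extends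
  -- smoothly by zero and stays in any distribution containing `Vc`.
  refine ⟨(χ : M → ℝ) • s, ?_, ?_, fun D hD y => ?_⟩
  · exact ContMDiffOn.smul_section_of_tsupport (χ.contMDiff.contMDiffOn) (isOpen_extChartAt_source x)
      χ.tsupport_subset_extChartAt_source hs
  · have hc : ContinuousAt φ.symm (φ x) := continuousAt_extChartAt_symm x
    have h0 : ∀ᶠ y in nhds (φ.symm (φ x)), χ y = 1 := by
      rw [hφ, extChartAt_to_inv]
      exact χ.eventuallyEq_one
    have h1 := hc.eventually h0
    filter_upwards [h1, (isOpen_extChartAt_target (I := 𝓡 d) x).mem_nhds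
      (mem_extChartAt_target x)] with y hy hyt
    change χ (φ.symm y) • (mfderiv (𝓡 d) (𝓡 d) φ.symm (φ (φ.symm y)) : Euc d →L[ℝ] Euc d)
      (Vc (φ (φ.symm y))) = _
    rw [hy, one_smul, φ.right_inv hyt]
  · change χ y • s y ∈ D y
    by_cases hy : y ∈ φ.source
    · refine Submodule.smul_mem _ _ ?_
      have h1 : (mfderiv (𝓡 d) (𝓡 d) φ.symm (φ y) : Euc d →L[ℝ] Euc d) (Vc (φ y))
          ∈ (D (φ.symm (φ y)) : Submodule ℝ (Euc d)) := hD _ (φ.map_source hy)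
      rw [φ.left_inv hy] at h1
      exact h1
    · have : χ y = 0 := image_eq_zero_of_notMem_tsupport fun h =>
        hy (χ.tsupport_subset_extChartAt_source h)
      rw [this, zero_smul]
      exact Submodule.zero_mem _

/-- The bracket is computed by pulling back to the chart, where the fields have the germs `Vc` and
`Wc`; at its own centre the preferred chart has identity differential. -/
theorem mlieBracket_eq {V W : ∀ y : M, TangentSpace (𝓡 d) y} {Vc Wc : Euc d → Euc d}
    (hV : HasCoord x V Vc) (hW : HasCoord x W Wc) :
    (VectorField.mlieBracket (𝓡 d) V W x : Euc d)
      = fderiv ℝ Wc (extChartAt (𝓡 d) x x) (Vc (extChartAt (𝓡 d) x x))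
        - fderiv ℝ Vc (extChartAt (𝓡 d) x x) (Wc (extChartAt (𝓡 d) x x)) := by
  have key : ∀ {V : ∀ y : M, TangentSpace (𝓡 d) y} {Vc : Euc d → Euc d}, HasCoord x V Vc →
      (VectorField.mpullbackWithin 𝓘(ℝ, Euc d) (𝓡 d) (extChartAt (𝓡 d) x).symm V
        (Set.range (𝓡 d)) : Euc d → Euc d) =ᶠ[nhds (extChartAt (𝓡 d) x x)] Vc := by
    intro V Vc h
    filter_upwards [h, (isOpen_extChartAt_target (I := 𝓡 d) x).mem_nhds
      (mem_extChartAt_target x)] with y hy hyt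
    have hi := isInvertible_mfderivWithin_extChartAt_symm (I := 𝓡 d) hyt
    rw [ModelWithCorners.range_eq_univ, mfderivWithin_univ] at hi
    rw [VectorField.mpullbackWithin_apply, ModelWithCorners.range_eq_univ, mfderivWithin_univ]
    exact hi.inverse_apply_eq.2 hy
  rw [VectorField.mlieBracket, VectorField.mlieBracketWithin_apply, mfderiv_extChartAt_self,
    Set.preimage_univ, Set.univ_inter, ModelWithCorners.range_eq_univ]
  have h1 := Filter.EventuallyEq.lieBracket_vectorField_eq (𝕜 := ℝ) (key hV) (key hW)
  rw [ModelWithCorners.range_eq_univ] at h1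
  exact (DFunLike.congr_fun (ContinuousLinearMap.inverse_id (R := ℝ) (M := Euc d)) _).trans
    ((congrFun (VectorField.lieBracketWithin_univ (𝕜 := ℝ) (E := Euc d)) _).trans h1)

end Fields

/-! ### The bundle-like and tense conditions read in charts. -/

section Tense

variable {d : ℕ} {M : Type*} [TopologicalSpace M] [ChartedSpace (EuclideanSpace ℝ (Fin d)) M]
  {D : Distribution d M} {ψ : Euc d → M} {U : Set (Euc d)} {z : Euc d}

/-- The projection onto the distribution in a parametrization. -/
theorem IsParam.tangentProj_eq (hp : IsParam ψ U) (hz : z ∈ U) {g : FormField d M}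
    (hψ : IsMetricOn (coordForm ψ g) U) (hg : IsInner (d := d) (g (ψ z))) (v : Euc d) :
    (tangentProj g D (ψ z) ((mfderiv (𝓡 d) (𝓡 d) ψ z : Euc d →L[ℝ] Euc d) v) : Euc d)
      = (mfderiv (𝓡 d) (𝓡 d) ψ z : Euc d →L[ℝ] Euc d)
        (projD (coordForm ψ g) (coordDist ψ D) z v) :=
  orthProj_comp (hψ.inner z hz) hg _ (fun _ _ => rfl) (hp.surj hz) (fun _ => Iff.rfl) v

variable [IsManifold (𝓡 d) ∞ M]

/-- The inner product of a Riemannian metric at a point. -/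
theorem isInner_metric (g : Metric d M) (x : M) : IsInner (d := d) (g.inner x) :=
  ⟨g.symm x, g.pos x⟩

theorem isMetricOn_chartForm (g : Metric d M) (x : M) :
    IsMetricOn (chartForm g.inner x) (extChartAt (𝓡 d) x).target :=
  (IsParam.chart (d := d) x).isMetricOn g

/-- The mean curvature in a parametrization. -/
theorem IsParam.meanCurvature_eq (hp : IsParam ψ U) (hz : z ∈ U) {g : FormField d M}
    (hψ : IsMetricOn (coordForm ψ g) U)
    (hg : IsMetricOn (chartForm g (ψ z)) (extChartAt (𝓡 d) (ψ z)).target)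
    (hP : ∀ y ∈ (extChartAt (𝓡 d) (ψ z)).target,
      ContDiffAt ℝ ∞ (projD (chartForm g (ψ z)) (chartDistribution D (ψ z))) y) :
    (meanCurvature g D (ψ z) : Euc d) = (mfderiv (𝓡 d) (𝓡 d) ψ z : Euc d →L[ℝ] Euc d)
      (Coord.meanCurvature (coordForm ψ g) (coordDist ψ D) z) := by
  obtain ⟨W, hWU, hzW, hsrc, hi, hD⟩ := hp.exists_isIsom (D := D) hz hψ hg Filter.univ_mem
  rw [← hp.fderiv_chart_comp hz]
  exact (hi.fderiv_meanCurvature hD hzW hP).symm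

/-- The condition of being bundle-like in the preferred chart. -/
theorem IsBundleLike.chart [T2Space M] {g : Metric d M} (hg : IsBundleLike g.inner D) (x : M)
    (hP : ∀ y ∈ (extChartAt (𝓡 d) x).target,
      ContDiffAt ℝ ∞ (projD (chartForm g.inner x) (chartDistribution D x)) y) (v w : Euc d) :
    let G := chartForm g.inner x
    let Dc := chartDistribution D x
    let z := extChartAt (𝓡 d) x x
    covP G Dc z (v - projD G Dc z v) (w - projD G Dc z w)
      = -covP G Dc z (w - projD G Dc z w) (v - projD G Dc z v) := by
  intro G Dc z
  set U := (extChartAt (𝓡 d) x).target with hU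
  have hG : IsMetricOn G U := isMetricOn_chartForm g x
  have hz : z ∈ U := mem_extChartAt_target x
  have hp : IsParam (extChartAt (𝓡 d) x).symm U := IsParam.chart (d := d) x
  have hQ : ∀ y ∈ U, ContDiffAt ℝ ∞ (IsTenseOn.projN G Dc) y := fun y hy =>
    contDiffAt_const.sub (hP y hy)
  have dP := ContDiffAt.diff (hP z hz)
  have dQ := ContDiffAt.diff (hQ z hz)
  have idem : ∀ v, projD G Dc z (projD G Dc z v) = projD G Dc z v := fun v =>
    IsTenseOn.proj_idem hG hz v
  have symm : ∀ v w, G z (projD G Dc z v) w = G z v (projD G Dc z w) := fun v w =>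
    IsTenseOn.proj_symm hG hz v w
  have csymm : ∀ e v w, G z (covP G Dc z e v) w = G z v (covP G Dc z e w) := fun e v w => by
    refine cov1_selfAdjoint (hG.isParallel hz) (hG.diff hz) dP ?_ e v w
    filter_upwards [hG.eventually hz] with y hy v v'
    exact IsTenseOn.proj_symm hG hy v v'
  -- By self-adjointness of ∇P and positivity of the metric, it suffices to test against every `a`;
  -- the field P a then plays the role of the tangential direction.
  suffices key : ∀ a, G z (covP G Dc z (v - projD G Dc z v) a) (w - projD G Dc z w)
      + G z (v - projD G Dc z v) (covP G Dc z (w - projD G Dc z w) a) = 0 by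
    rw [← add_eq_zero_iff_eq_neg]
    by_contra h0
    refine ((hG.inner z hz).2 _ h0).ne' ?_
    have h1 := key (covP G Dc z (v - projD G Dc z v) (w - projD G Dc z w)
      + covP G Dc z (w - projD G Dc z w) (v - projD G Dc z v))
    rw [csymm, (hG.inner z hz).1 (v - _), csymm, ← map_add] at h1
    exact h1
  intro a
  obtain ⟨A, hA, hA', hAD⟩ := exists_hasCoord x (Vc := fun y => projD G Dc y a)
    fun y hy => (hP y hy).clm_apply contDiffAt_const
  have field : ∀ b, ∃ B : ∀ y : M, TangentSpace (𝓡 d) y, IsSmoothField B ∧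
      HasCoord x B fun y => IsTenseOn.projN G Dc y b := fun b => by
    obtain ⟨B, hB, hB', -⟩ := exists_hasCoord x (Vc := fun y => IsTenseOn.projN G Dc y b)
      fun y hy => (hQ y hy).clm_apply contDiffAt_const
    exact ⟨B, hB, hB'⟩
  obtain ⟨B, hB, hB'⟩ := field v
  obtain ⟨C, hC, hC'⟩ := field w
  have hbl := hg A B C hA hB hC (hAD D fun y hy => orthProj_mem (hG.inner y hy) a) x
  set s : Euc d → ℝ := fun y => G y (IsTenseOn.projN G Dc y v) (IsTenseOn.projN G Dc y w) with hs
  have Qidem : ∀ y ∈ U, ∀ v, IsTenseOn.projN G Dc y (IsTenseOn.projN G Dc y v)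
      = IsTenseOn.projN G Dc y v := fun y hy v => by
    rw [IsTenseOn.projN_apply, IsTenseOn.projN_apply, map_sub, IsTenseOn.proj_idem hG hy, sub_self,
      sub_zero]
  have Qsymm : ∀ v w, G z (IsTenseOn.projN G Dc z v) w = G z v (IsTenseOn.projN G Dc z w) :=
    fun v w => by
    rw [IsTenseOn.projN_apply, IsTenseOn.projN_apply, map_sub, map_sub, sub_apply, symm]
  have e1 : ∀ᶠ y in nhds z, transverseForm g.inner D ((extChartAt (𝓡 d) x).symm y)
      (B ((extChartAt (𝓡 d) x).symm y)) (C ((extChartAt (𝓡 d) x).symm y)) = s y := by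
    filter_upwards [hB', hC', hG.eventually hz] with y hBy hCy hy
    have h1 : ∀ b, (normalProj g.inner D ((extChartAt (𝓡 d) x).symm y)
        ((mfderiv (𝓡 d) (𝓡 d) (extChartAt (𝓡 d) x).symm y : Euc d →L[ℝ] Euc d)
          (IsTenseOn.projN G Dc y b)) : Euc d)
        = (mfderiv (𝓡 d) (𝓡 d) (extChartAt (𝓡 d) x).symm y : Euc d →L[ℝ] Euc d)
          (IsTenseOn.projN G Dc y b) := fun b => by
      have h2 := hp.tangentProj_eq (D := D) hy hG (isInner_metric g _) (IsTenseOn.projN G Dc y b)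
      have h3 : projD G Dc y (IsTenseOn.projN G Dc y b) = 0 := by
        rw [IsTenseOn.projN_apply, map_sub, IsTenseOn.proj_idem hG hy, sub_self]
      let L : Euc d →L[ℝ] Euc d := mfderiv (𝓡 d) (𝓡 d) (extChartAt (𝓡 d) x).symm y
      refine (congrArg (fun u : Euc d => L (IsTenseOn.projN G Dc y b) - u) (h2.trans
        ((congrArg _ h3).trans (map_zero _)))).trans (sub_zero _)
    rw [transverseForm, hBy, hCy]
    exact congrArg₂ (fun a b : Euc d => (g.inner ((extChartAt (𝓡 d) x).symm y)
      : Euc d →L[ℝ] Euc d →L[ℝ] ℝ) a b) (h1 v) (h1 w)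
  have e2 : (fun y => transverseForm g.inner D y (B y) (C y)) =ᶠ[nhds x]
      s ∘ extChartAt (𝓡 d) x := by
    filter_upwards [(continuousAt_extChartAt x).eventually e1,
      (isOpen_extChartAt_source (I := 𝓡 d) x).mem_nhds (mem_extChartAt_source x)] with y hy hy'
    rw [(extChartAt (𝓡 d) x).left_inv hy'] at hy
    exact hy
  have ds : DifferentiableAt ℝ s z := by
    have := hG.diff hz
    fun_prop
  have e3 : (mfderiv (𝓡 d) 𝓘(ℝ, ℝ) (fun y => transverseForm g.inner D y (B y) (C y)) x (A x) : ℝ)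
      = fderiv ℝ s z (projD G Dc z a) := by
    have h1 : mfderiv (𝓡 d) 𝓘(ℝ, ℝ) (s ∘ extChartAt (𝓡 d) x) x
        = (mfderiv (𝓡 d) 𝓘(ℝ, ℝ) s z).comp (mfderiv (𝓡 d) (𝓡 d) (extChartAt (𝓡 d) x) x) :=
      mfderiv_comp x ds.mdifferentiableAt (mdifferentiableAt_extChartAt (I := 𝓡 d) (mem_chart_source _ x))
    rw [mfderiv_extChartAt_self] at h1
    rw [e2.mfderiv_eq, h1, ← hA'.self]
    have h3 : (mfderiv (𝓡 d) 𝓘(ℝ, ℝ) s z : Euc d →L[ℝ] ℝ) = fderiv ℝ s z := mfderiv_eq_fderiv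
    exact DFunLike.congr_fun h3 _
  have e4 : ∀ v w : TangentSpace (𝓡 d) x, transverseForm g.inner D x v w
      = G z (IsTenseOn.projN G Dc z (v : Euc d))
        (IsTenseOn.projN G Dc z (w : Euc d)) := fun v w => by
    have h1 : orthProj (G z) (Dc z) = orthProj (d := d) (g.inner x) (D x) := by
      rw [← chartForm_self g.inner x, ← chartDistribution_self D x]
    let v' : Euc d := v
    let w' : Euc d := w
    change _ = (chartForm g.inner x (extChartAt (𝓡 d) x x)) (v' - orthProj (G z) (Dc z) v')
      (w' - orthProj (G z) (Dc z) w')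
    rw [chartForm_self, h1]
    rfl
  -- The bracket of P a with the normal field built from `b`. The last summand is tangential, hence
  -- invisible to the transverse form.
  have e5 : ∀ b, fderiv ℝ (fun y => IsTenseOn.projN G Dc y b) z (projD G Dc z a)
        - fderiv ℝ (fun y => projD G Dc y a) z (IsTenseOn.projN G Dc z b)
      = nab (chr G) (fun y => IsTenseOn.projN G Dc y b) z (projD G Dc z a)
        - covP G Dc z (IsTenseOn.projN G Dc z b) a
        - projD G Dc z (chr G z (IsTenseOn.projN G Dc z b) a) := fun b => by
    have h1 := nab_form (κ := chr G) (Γ := chr G) dP (IsTenseOn.projN G Dc z b) a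
    rw [sub_sub, ← h1, nab, nab, hG.chr_symm hz (IsTenseOn.projN G Dc z b)]
    abel
  have e6 : ∀ b, IsTenseOn.projN G Dc z (projD G Dc z b) = 0 := fun b => by
    rw [IsTenseOn.projN_apply, idem, sub_self]
  have e7 : ∀ b : Euc d, G z (IsTenseOn.projN G Dc z b) (IsTenseOn.projN G Dc z
      (IsTenseOn.projN G Dc z w)) = G z b (IsTenseOn.projN G Dc z w) := fun b => by
    rw [Qidem z hz, Qsymm, Qidem z hz]
  have e8 : ∀ b : Euc d, G z (IsTenseOn.projN G Dc z (IsTenseOn.projN G Dc z v))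
      (IsTenseOn.projN G Dc z b) = G z (IsTenseOn.projN G Dc z v) b := fun b => by
    rw [Qidem z hz, ← Qsymm, Qidem z hz]
  have e9 := (e4 _ _).trans (congrArg₂ (fun a b : Euc d => G z (IsTenseOn.projN G Dc z a)
    (IsTenseOn.projN G Dc z b)) ((mlieBracket_eq hA' hB').trans (e5 v)) hC'.self)
  have e10 := (e4 _ _).trans (congrArg₂ (fun a b : Euc d => G z (IsTenseOn.projN G Dc z a)
    (IsTenseOn.projN G Dc z b)) hB'.self ((mlieBracket_eq hA' hC').trans (e5 w)))
  have e11 := (e3.symm.trans hbl).trans (congrArg₂ (· + ·) (e9.trans (e7 _)) (e10.trans (e8 _)))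
  have e12 : ∀ b c : Euc d, G z (IsTenseOn.projN G Dc z b) (projD G Dc z c) = 0 := fun b c => by
    rw [Qsymm, e6, map_zero]
  have e13 : ∀ b c : Euc d, G z (projD G Dc z c) (IsTenseOn.projN G Dc z b) = 0 := fun b c => by
    rw [(hG.inner z hz).1, e12]
  -- Metric compatibility: the derivatives of the two normal fields cancel against those in the
  -- brackets, and only the terms in ∇P survive.
  rw [hs, fderiv_metric (hG.isParallel hz) (hG.diff hz) (by fun_prop) (by fun_prop)] at e11
  simp only [map_sub, sub_apply, e12, e13] at e11
  have e14 : ∀ p q r s : ℝ, p + q = p - r - 0 + (q - s - 0) → r + s = 0 := by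
    intros
    linarith
  exact e14 _ _ _ _ e11

/-- The condition of being tense in the preferred chart. -/
theorem IsFoliatedField.chart [T2Space M] {g : Metric d M}
    (hg : IsFoliatedField D (meanCurvature g.inner D))
    (hP : ∀ x : M, ∀ y ∈ (extChartAt (𝓡 d) x).target,
      ContDiffAt ℝ ∞ (projD (chartForm g.inner x) (chartDistribution D x)) y) (x : M) (v : Euc d) :
    let G := chartForm g.inner x
    let Dc := chartDistribution D x
    let z := extChartAt (𝓡 d) x x
    projD G Dc z (nab (chr G) (Coord.meanCurvature G Dc) z (projD G Dc z v)
        - covP G Dc z (Coord.meanCurvature G Dc z) v)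
      = nab (chr G) (Coord.meanCurvature G Dc) z (projD G Dc z v)
        - covP G Dc z (Coord.meanCurvature G Dc z) v := by
  intro G Dc z
  set U := (extChartAt (𝓡 d) x).target with hU
  have hG : IsMetricOn G U := isMetricOn_chartForm g x
  have hz : z ∈ U := mem_extChartAt_target x
  have hp : IsParam (extChartAt (𝓡 d) x).symm U := IsParam.chart (d := d) x
  obtain ⟨A, hA, hA', hAD⟩ := exists_hasCoord x (Vc := fun y => projD G Dc y v)
    fun y hy => (hP x y hy).clm_apply contDiffAt_const
  have hτ : HasCoord x (meanCurvature g.inner D) (Coord.meanCurvature G Dc) := by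
    filter_upwards [hG.eventually hz] with y hy
    exact hp.meanCurvature_eq hy hG (isMetricOn_chartForm g _) (hP _)
  have h1 := hg A hA (hAD D fun y hy => orthProj_mem (hG.inner y hy) v) x
  have h2 : fderiv ℝ (Coord.meanCurvature G Dc) z (projD G Dc z v)
      - fderiv ℝ (fun y => projD G Dc y v) z (Coord.meanCurvature G Dc z) ∈ Dc z := by
    have h3 : (Dc z : Submodule ℝ (Euc d)) = D x := chartDistribution_self D x
    rw [h3]
    rw [mlieBracket_eq hA' hτ] at h1
    exact h1
  have h4 := nab_form (κ := chr G) (Γ := chr G) (ContDiffAt.diff (hP x z hz))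
    (Coord.meanCurvature G Dc z) v
  refine orthProj_of_mem (hG.inner z hz) ?_
  -- The expression differs by a tangential vector from the bracket of P v with the mean curvature.
  have h5 : nab (chr G) (Coord.meanCurvature G Dc) z (projD G Dc z v)
        - covP G Dc z (Coord.meanCurvature G Dc z) v
      = (fderiv ℝ (Coord.meanCurvature G Dc) z (projD G Dc z v)
      - fderiv ℝ (fun y => projD G Dc y v) z (Coord.meanCurvature G Dc z))
      + projD G Dc z (chr G z (Coord.meanCurvature G Dc z) v) := by
    rw [← sub_eq_iff_eq_add, sub_sub, ← h4, nab, nab, hG.chr_symm hz (Coord.meanCurvature G Dc z)]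
    abel
  rw [h5]
  exact Submodule.add_mem _ h2 (orthProj_mem (hG.inner z hz) _)

end Tense

section Foliation

variable {m n : ℕ} {M : Type*} [TopologicalSpace M]
  [ChartedSpace (EuclideanSpace ℝ (Fin (m + n))) M] [IsManifold (𝓡 (m + n)) ∞ M]
  {D : Distribution (m + n) M}

theorem isTenseAt_chart [T2Space M] (hD : IsFoliation m n D) {g : Metric (m + n) M}
    (hg : IsBundleLike g.inner D) (ht : IsFoliatedField D (meanCurvature g.inner D)) (x : M) :
    IsTenseAt (chartForm g.inner x) (chartDistribution D x) (extChartAt (𝓡 (m + n)) x x) := by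
  have hP : ∀ x : M, ∀ y ∈ (extChartAt (𝓡 (m + n)) x).target,
      ContDiffAt ℝ ∞ (projD (chartForm g.inner x) (chartDistribution D x)) y := fun x y hy =>
    (IsParam.chart (d := m + n) x).smooth_projD hD (isMetricOn_chartForm g x) hy
  exact ⟨(IsParam.chart (d := m + n) x).invol hD (isMetricOn_chartForm g x)
    (mem_extChartAt_target x), hg.chart x (hP x), ht.chart hP x⟩

/-- A bundle-like tense metric in any parametrization. -/
theorem IsParam.isTenseOn [T2Space M] {ψ : Euc (m + n) → M} {U : Set (Euc (m + n))}
    (hp : IsParam ψ U) (hD : IsFoliation m n D) {g : Metric (m + n) M}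
    (hg : IsBundleLike g.inner D) (ht : IsFoliatedField D (meanCurvature g.inner D)) :
    IsTenseOn (coordForm ψ g.inner) (coordDist ψ D) U := by
  -- The conditions are available at the centres of preferred charts; each point is brought there by
  -- a change of coordinates.
  have key : ∀ z ∈ U, IsTenseAt (coordForm ψ g.inner) (coordDist ψ D) z := fun z hz => by
    obtain ⟨W, -, hzW, -, hi, hiD⟩ := hp.exists_isIsom (D := D) hz (hp.isMetricOn g)
      (isMetricOn_chartForm g _) Filter.univ_mem
    exact hi.isTenseAt hiD hzW (fun y hy => (IsParam.chart (d := m + n) (ψ z)).smooth_projD hD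
      (isMetricOn_chartForm g _) hy) (isTenseAt_chart hD hg ht _)
  exact ⟨hp.isMetricOn g, fun z hz => hp.smooth_projD hD (hp.isMetricOn g) hz,
    fun z hz => (key z hz).invol, fun z hz => (key z hz).bundle, fun z hz => (key z hz).tense⟩

end Foliation

/-! ### Local coordinates for the heat flow -/

section Pullback

variable {d : ℕ}

theorem IsMetricOn.congr {G G' : Euc d → Euc d →L[ℝ] Euc d →L[ℝ] ℝ} {U : Set (Euc d)}
    (h : IsMetricOn G U) (e : ∀ y ∈ U, G' y = G y) : IsMetricOn G' U :=
  ⟨h.isOpen, fun z hz => (h.smooth z hz).congr_of_eventuallyEq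
    (Filter.eventually_of_mem (h.isOpen.mem_nhds hz) e), fun z hz => by
      rw [e z hz]
      exact h.inner z hz⟩

/-- The identity is an isometry between the two structures, so naturality applies. -/
theorem IsTenseOn.congr {G G' : Euc d → Euc d →L[ℝ] Euc d →L[ℝ] ℝ}
    {D D' : Euc d → Submodule ℝ (Euc d)} {U : Set (Euc d)} (h : IsTenseOn G D U)
    (e : ∀ y ∈ U, G' y = G y) (eD : ∀ y ∈ U, D' y = D y) : IsTenseOn G' D' U := by
  have hi : IsIsom G' G U U id := ⟨h.metric.congr e, h.metric, fun _ _ => contDiffAt_id,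
    fun z hz => hz, fun z hz v w => by simp [e z hz]⟩
  have hD : ∀ y ∈ U, ∀ v, v ∈ D' y ↔ fderiv ℝ id y v ∈ D (id y) := fun y hy v => by
    simp [eD y hy]
  have key : ∀ z ∈ U, IsTenseAt G' D' z := fun z hz => hi.isTenseAt hD hz h.smooth
    ⟨h.invol z hz, h.bundle z hz, h.tense z hz⟩
  exact ⟨hi.source, fun z hz => hi.smooth_projD hD hz (h.smooth z hz), fun z hz => (key z hz).invol,
    fun z hz => (key z hz).bundle, fun z hz => (key z hz).tense⟩

variable {M N : Type*} [TopologicalSpace M] [ChartedSpace (EuclideanSpace ℝ (Fin d)) M]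
  [TopologicalSpace N] [ChartedSpace (EuclideanSpace ℝ (Fin d)) N]
  {p : M → N} {ψ : Euc d → M} {U : Set (Euc d)}

theorem IsParam.coordForm_pullback (hψ : IsParam ψ U) (hp : ContMDiff (𝓡 d) (𝓡 d) ∞ p)
    (g : FormField d N) {y : Euc d} (hy : y ∈ U) :
    coordForm ψ (pullbackForm (d := d) (q := d) p g) y = coordForm (p ∘ ψ) g y :=
  pullbackForm_comp (d := d) (q := d) (r := d) g (hψ.mdiff hy)
    ((hp _).mdifferentiableAt (by simp))

theorem IsParam.coordDist_pullback (hψ : IsParam ψ U) (hp : ContMDiff (𝓡 d) (𝓡 d) ∞ p)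
    (D : Distribution d N) {y : Euc d} (hy : y ∈ U) :
    coordDist ψ (pullbackDistribution (d := d) (q := d) p D) y = coordDist (p ∘ ψ) D y :=
  pullbackDistribution_comp (d := d) (q := d) (r := d) D (hψ.mdiff hy)
    ((hp _).mdifferentiableAt (by simp))

theorem isInner_of_chart [IsManifold (𝓡 d) ∞ M] {g : FormField d M} {x : M}
    (hg : IsMetricOn (chartForm g x) (extChartAt (𝓡 d) x).target) : IsInner (d := d) (g x) := by
  have h1 := hg.inner _ (mem_extChartAt_target x)
  rw [chartForm_self] at h1
  exact h1

end Pullback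

theorem IsTimeDomain.inter {T J : Set ℝ} (hT : IsTimeDomain T) (hJ : IsOpen J) :
    IsTimeDomain (T ∩ J) := by
  refine ⟨hT.unique.inter hJ, fun s hs => ?_⟩
  rw [interior_inter, hJ.interior_eq, Set.inter_comm]
  exact hJ.inter_closure ⟨hs.2, hT.subset hs.1⟩

theorem isTimeDomain_Icc {a b : ℝ} (h : a < b) : IsTimeDomain (Set.Icc a b) := by
  refine ⟨uniqueDiffOn_Icc h, ?_⟩
  rw [interior_Icc, closure_Ioo h.ne]

section Flow

variable {d q : ℕ} {M : Type*} [TopologicalSpace M] [ChartedSpace (EuclideanSpace ℝ (Fin d)) M]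
  {N : Type*} [TopologicalSpace N] [ChartedSpace (EuclideanSpace ℝ (Fin q)) N]
  {g : FormField d M} {D : Distribution d M} {h : FormField q N} {T : Set ℝ} {f : ℝ → M → N}
  {t s : ℝ} {x : M} {y : Euc d}

/-- `f` is a harmonic map heat flow over `T`, for a tense bundle-like metric on the source. -/
structure IsHeatFlow (g : FormField d M) (D : Distribution d M) (h : FormField q N) (T : Set ℝ)
    (f : ℝ → M → N) : Prop where
  time : IsTimeDomain T
  tense : ∀ x, IsTenseOn (chartForm g x) (chartDistribution D x) (extChartAt (𝓡 d) x).target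
  target : ∀ y, IsMetricOn (chartForm h y) (extChartAt (𝓡 q) y).target
  smooth : ContMDiffOn (𝓘(ℝ, ℝ).prod (𝓡 d)) (𝓡 q) ∞ (fun z : ℝ × M => f z.1 z.2)
    (T ×ˢ Set.univ)
  flow : ∀ t ∈ T, ∀ x : M, mfderivWithin 𝓘(ℝ, ℝ) (𝓡 q) (fun s => f s x) T t (1 : ℝ)
    = tensionField g h (f t) x

/-- The coordinate expression of the flow near `(t, x)`. -/
def flowCoord (q : ℕ) {N : Type*} [TopologicalSpace N]
    [ChartedSpace (EuclideanSpace ℝ (Fin q)) N] (f : ℝ → M → N) (t : ℝ) (x : M) (s : ℝ) (y : Euc d) : Euc q :=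
  extChartAt (𝓡 q) (f t x) (f s ((extChartAt (𝓡 d) x).symm y))

/-- Over `J × U` the flow stays in the preferred charts at `x` and `f t x`. -/
structure IsFlowBox (q : ℕ) {N : Type*} [TopologicalSpace N]
    [ChartedSpace (EuclideanSpace ℝ (Fin q)) N] (f : ℝ → M → N) (T : Set ℝ) (t : ℝ) (x : M)
    (J : Set ℝ) (U : Set (Euc d)) : Prop where
  openTime : IsOpen J
  memTime : t ∈ J
  openSpace : IsOpen U
  memSpace : extChartAt (𝓡 d) x x ∈ U
  subset : U ⊆ (extChartAt (𝓡 d) x).target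
  source : ∀ s ∈ T ∩ J, ∀ y ∈ U,
    f s ((extChartAt (𝓡 d) x).symm y) ∈ (extChartAt (𝓡 q) (f t x)).source

namespace IsHeatFlow

theorem smooth_slice (hF : IsHeatFlow g D h T f) (ht : t ∈ T) :
    ContMDiff (𝓡 d) (𝓡 q) ∞ (f t) := by
  rw [← contMDiffOn_univ]
  exact hF.smooth.comp (t := T ×ˢ Set.univ) (f := fun x : M => (t, x))
    (contMDiff_const.prodMk contMDiff_id).contMDiffOn fun x _ => ⟨ht, trivial⟩

variable [IsManifold (𝓡 d) ∞ M]

theorem smooth_chart (hF : IsHeatFlow g D h T f) (x : M) :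
    ContMDiffOn (𝓘(ℝ, ℝ).prod (𝓡 d)) (𝓡 q) ∞
      (fun z : ℝ × Euc d => f z.1 ((extChartAt (𝓡 d) x).symm z.2))
      (T ×ˢ (extChartAt (𝓡 d) x).target) := by
  refine hF.smooth.comp (f := fun z : ℝ × Euc d => (z.1, (extChartAt (𝓡 d) x).symm z.2))
    (contMDiff_fst.contMDiffOn.prodMk ((contMDiffOn_extChartAt_symm x).comp
      contMDiff_snd.contMDiffOn fun z hz => hz.2)) fun z hz => ⟨hz.1, trivial⟩

/-- Continuity of the flow on `T` times the chart. `J` is open in ℝ and only its trace on `T` is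
constrained, which lets `t` be an endpoint. -/
theorem exists_isFlowBox (hF : IsHeatFlow g D h T f) (ht : t ∈ T) (x : M) :
    ∃ (J : Set ℝ) (U : Set (Euc d)), IsFlowBox q f T t x J U := by
  have hz := mem_extChartAt_target (I := 𝓡 d) x
  have h1 := (hF.smooth_chart x).continuousOn (t, extChartAt (𝓡 d) x x) ⟨ht, hz⟩
  have h2 : (extChartAt (𝓡 q) (f t x)).source
      ∈ nhds (f t ((extChartAt (𝓡 d) x).symm (extChartAt (𝓡 d) x x))) := by
    rw [extChartAt_to_inv]
    exact extChartAt_source_mem_nhds _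
  obtain ⟨O, hO, hzO, hsub⟩ := mem_nhdsWithin.1 (h1 h2)
  obtain ⟨J, U, hJ, hU, htJ, hzU, hJU⟩ := isOpen_prod_iff.1 hO _ _ hzO
  exact ⟨J, U ∩ (extChartAt (𝓡 d) x).target, hJ, htJ, hU.inter (isOpen_extChartAt_target x),
    ⟨hzU, hz⟩, Set.inter_subset_right, fun s hs y hy => hsub (a := (s, y))
      ⟨hJU ⟨hs.2, hy.1⟩, hs.1, hy.2⟩⟩

end IsHeatFlow

namespace IsFlowBox

variable {J : Set ℝ} {U : Set (Euc d)}

theorem isTenseOn (hB : IsFlowBox q f T t x J U) (hF : IsHeatFlow g D h T f) :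
    IsTenseOn (chartForm g x) (chartDistribution D x) U :=
  have := hF.tense x
  ⟨this.metric.mono hB.subset hB.openSpace, fun z hz => this.smooth z (hB.subset hz),
    fun z hz => this.invol z (hB.subset hz), fun z hz => this.bundle z (hB.subset hz),
    fun z hz => this.tense z (hB.subset hz)⟩

theorem flowCoord_mem (hB : IsFlowBox q f T t x J U) (hs : s ∈ T ∩ J) (hy : y ∈ U) :
    flowCoord q f t x s y ∈ (extChartAt (𝓡 q) (f t x)).target :=
  (extChartAt (𝓡 q) (f t x)).map_source (hB.source s hs y hy)

theorem symm_flowCoord (hB : IsFlowBox q f T t x J U) (hs : s ∈ T ∩ J) (hy : y ∈ U) :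
    f s ((extChartAt (𝓡 d) x).symm y)
      = (extChartAt (𝓡 q) (f t x)).symm (flowCoord q f t x s y) :=
  ((extChartAt (𝓡 q) (f t x)).left_inv (hB.source s hs y hy)).symm

variable [IsManifold (𝓡 d) ∞ M]

theorem isParam (hB : IsFlowBox q f T t x J U) : IsParam (extChartAt (𝓡 d) x).symm U :=
  ⟨hB.openSpace, fun z hz => (IsParam.chart (d := d) x).smooth z (hB.subset hz),
    fun z hz => (IsParam.chart (d := d) x).inj z (hB.subset hz)⟩

variable [IsManifold (𝓡 q) ∞ N]

theorem smooth (hB : IsFlowBox q f T t x J U) (hF : IsHeatFlow g D h T f) :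
    ContDiffOn ℝ ∞ (fun p : ℝ × Euc d => flowCoord q f t x p.1 p.2) ((T ∩ J) ×ˢ U) := by
  have h1 : ContMDiffOn (𝓘(ℝ, ℝ).prod (𝓡 d)) (𝓡 q) ∞
      (fun p : ℝ × Euc d => flowCoord q f t x p.1 p.2) ((T ∩ J) ×ˢ U) :=
    (contMDiffOn_extChartAt (I := 𝓡 q) (x := f t x)).comp ((hF.smooth_chart x).mono
      (Set.prod_mono Set.inter_subset_left hB.subset)) fun p hp => by
        simpa using hB.source _ hp.1 _ hp.2
  rw [← contMDiffOn_iff_contDiffOn, modelWithCornersSelf_prod, ← chartedSpaceSelf_prod]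
  exact h1

/-- Applying the injective differential of the inverse target chart gives the flow equation on the
manifold; restricting times to `T ∩ J` does not change the derivative at `s`. -/
theorem flow (hB : IsFlowBox q f T t x J U) (hF : IsHeatFlow g D h T f) (hs : s ∈ T ∩ J)
    (hy : y ∈ U) : derivWithin (fun r => flowCoord q f t x r y) (T ∩ J) s
      = Coord.tension (chartForm g x) (chartForm h (f t x)) (flowCoord q f t x s) y := by
  have hq := IsParam.chart (d := q) (f t x)
  have hV := hB.flowCoord_mem hs hy
  have hu := fun z hz => contDiffAt_slice hB.openSpace (hB.smooth hF) hs (z := z) hz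
  have h1 := tensionField_eq hB.isParam hy (hB.isTenseOn hF).metric (hF.tense _).metric hq
    (hF.target (f t x)) (hF.target _) (hF.smooth_slice hs.1) hu (fun z hz => hB.flowCoord_mem hs hz)
    fun z hz => hB.symm_flowCoord hs hz
  have hd := hasDerivWithinAt_slice (hB.smooth hF) hs hy
  have hq' := hq.mdiff hV
  set T' := T ∩ J with hT'
  set φ := extChartAt (𝓡 d) x with hφ
  set χ := (extChartAt (𝓡 q) (f t x)).symm with hχ
  have h2 : (mfderivWithin 𝓘(ℝ, ℝ) (𝓡 q) (fun r => f r (φ.symm y)) T' s : ℝ →L[ℝ] Euc q)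
      = mfderivWithin 𝓘(ℝ, ℝ) (𝓡 q) (fun r => f r (φ.symm y)) T s :=
    mfderivWithin_inter (hB.openTime.mem_nhds hs.2)
  have h3 : (mfderivWithin 𝓘(ℝ, ℝ) (𝓡 q) (fun r => f r (φ.symm y)) T' s : ℝ →L[ℝ] Euc q)
      = mfderivWithin 𝓘(ℝ, ℝ) (𝓡 q) (χ ∘ fun r => flowCoord q f t x r y) T' s :=
    mfderivWithin_congr (fun r hr => hB.symm_flowCoord hr hy) (hB.symm_flowCoord hs hy)
  have huniq := (hF.time.inter hB.openTime).unique s hs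
  have h4 := mfderiv_comp_mfderivWithin s hq' hd.differentiableWithinAt.mdifferentiableWithinAt
    huniq.uniqueMDiffWithinAt
  have h5 : (mfderivWithin 𝓘(ℝ, ℝ) (𝓡 q) (fun r => flowCoord q f t x r y) T' s : ℝ →L[ℝ] Euc q)
      = fderivWithin ℝ (fun r => flowCoord q f t x r y) T' s := mfderivWithin_eq_fderivWithin
  refine hq.inj _ hV ?_
  refine Eq.trans ?_ h1
  refine Eq.trans ?_ (hF.flow s hs.1 (φ.symm y))
  refine Eq.trans ?_ (DFunLike.congr_fun h2 1)
  refine Eq.trans ?_ (DFunLike.congr_fun h3 1).symm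
  refine Eq.trans ?_ (DFunLike.congr_fun h4 1).symm
  exact congrArg (fun L : ℝ →L[ℝ] Euc q => (mfderiv (𝓡 q) (𝓡 q) χ (flowCoord q f t x s y)
    : Euc q →L[ℝ] Euc q) (L 1)) h5.symm

/-- The tangential energy density in coordinates. -/
theorem energy_eq (hB : IsFlowBox q f T t x J U) (hF : IsHeatFlow g D h T f) (hs : s ∈ T ∩ J)
    (hy : y ∈ U) : tangentialEnergy g D h (f s) ((extChartAt (𝓡 d) x).symm y)
      = Coord.energy (chartForm g x) (chartDistribution D x) (chartForm h (f t x))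
        (flowCoord q f t x s) y := by
  have hu := contDiffAt_slice hB.openSpace (hB.smooth hF) hs hy
  refine tangentialEnergy_eq (hB.isParam.mdiff hy)
    ((IsParam.chart (d := q) (f t x)).mdiff (hB.flowCoord_mem hs hy))
    ((hF.smooth_slice hs.1 _).mdifferentiableAt (by simp)) (ContDiffAt.diff hu) ?_
    ((hB.isTenseOn hF).metric.inner y hy) (isInner_of_chart (hF.tense _).metric)
  filter_upwards [hB.openSpace.mem_nhds hy] with y' hy'
  exact hB.symm_flowCoord hs hy'

theorem smooth_energy (hB : IsFlowBox q f T t x J U) (hF : IsHeatFlow g D h T f) :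
    ContDiffOn ℝ ∞ (fun p : ℝ × Euc d => tangentialEnergy g D h (f p.1)
      ((extChartAt (𝓡 d) x).symm p.2)) ((T ∩ J) ×ˢ U) :=
  (contDiffOn_energy (hB.isTenseOn hF).metric (hB.isTenseOn hF).smooth (hF.target (f t x))
    (hF.time.inter hB.openTime) (hB.smooth hF) fun _ hs _ hy => hB.flowCoord_mem hs hy).congr
    fun _ hp => hB.energy_eq hF hp.1 hp.2

end IsFlowBox

end Flow

section Flow

variable {d q : ℕ} {M : Type*} [TopologicalSpace M] [ChartedSpace (EuclideanSpace ℝ (Fin d)) M]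
  [IsManifold (𝓡 d) ∞ M]
  {N : Type*} [TopologicalSpace N] [ChartedSpace (EuclideanSpace ℝ (Fin q)) N]
  [IsManifold (𝓡 q) ∞ N]
  {g : FormField d M} {D : Distribution d M} {h : FormField q N} {T : Set ℝ} {f : ℝ → M → N}
  {t s : ℝ} {x : M} {y : Euc d}

/-- The right-hand side of the Eells–Sampson type formula at the centre of the charts. -/
theorem eellsSampsonTerm_eq (D : Distribution d M) {k : M → N}
    (hk : MDifferentiableAt (𝓡 d) (𝓡 q) k x) :
    eellsSampsonTerm g D h k x = Coord.eellsSampsonTerm (chartForm g x) (chartDistribution D x)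
      (chartForm h (k x)) (writtenInExtChartAt (𝓡 d) (𝓡 q) x k) (extChartAt (𝓡 d) x x) := by
  set u := writtenInExtChartAt (𝓡 d) (𝓡 q) x k with hu
  set z := extChartAt (𝓡 d) x x with hz
  have e0 : extChartAt (𝓡 q) (k x) (k x) = u z := by
    rw [hu, hz, writtenInExtChartAt, Function.comp_apply, Function.comp_apply, extChartAt_to_inv]
  have e1 : (g x : Euc d →L[ℝ] Euc d →L[ℝ] ℝ) = chartForm g x z := (chartForm_self g x).symm
  have e2 : (D x : Submodule ℝ (Euc d)) = chartDistribution D x z :=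
    (chartDistribution_self D x).symm
  have e3 : (h (k x) : Euc q →L[ℝ] Euc q →L[ℝ] ℝ) = chartForm h (k x) (u z) := by
    rw [← e0]
    exact (chartForm_self h (k x)).symm
  have e4 : (mfderiv (𝓡 d) (𝓡 q) k x : Euc d →L[ℝ] Euc q) = fderiv ℝ u z := by
    have h1 := hk.mfderiv
    rw [ModelWithCorners.range_eq_univ, fderivWithin_univ] at h1
    exact h1
  -- The right-hand side as a function of the source form, subspace, target form, differential and
  -- target point, all in model spaces, so that the five equalities can be substituted together.
  let Φ : (Euc d →L[ℝ] Euc d →L[ℝ] ℝ) → Submodule ℝ (Euc d) → (Euc q →L[ℝ] Euc q →L[ℝ] ℝ) →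
      (Euc d →L[ℝ] Euc q) → Euc q → ℝ := fun b S c L w =>
    let P := orthProj b S
    let Q := LinearMap.id - P
    let B := Coord.covDerivTangential (chartForm g x) (chartForm h (k x)) u
      (chartDistribution D x) z
    (metricTrace b fun v v' => metricTrace b fun a a' =>
        c (Coord.curvature (chartForm h (k x)) w (L (P v)) (L a) (L a')) (L (P v')))
      - (metricTrace b fun v v' => metricTrace b fun a a' =>
        Coord.ricci (chartForm g x) z v a * c (L (P v')) (L (P a')))
      - normSq₂ b c (fun v a => B (P a) (Q v) + B (Q v) (P a))
      - normSq₂ b c (fun v a => B (P v) (P a))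
      + normSq₂ b c (fun v a => B (Q v) (Q a))
      + 2 * normSq₂ b c (fun v a => B (Q v) (P a))
  have key : ∀ b b' S S' c c' L L' w w', b = b' → S = S' → c = c' → L = L' → w = w' →
      Φ b S c L w = Φ b' S' c' L' w' := by
    rintro b _ S _ c _ L _ w _ rfl rfl rfl rfl rfl
    rfl
  exact key (g x) (chartForm g x z) (D x) _ (h (k x)) _ (mfderiv (𝓡 d) (𝓡 q) k x) _
    (extChartAt (𝓡 q) (k x) (k x)) _ e1 e2 e3 e4 e0

namespace IsHeatFlow

/-- The tangential energy density is smooth. -/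
theorem smooth_energy (hF : IsHeatFlow g D h T f) :
    ContMDiffOn (𝓘(ℝ, ℝ).prod (𝓡 d)) 𝓘(ℝ, ℝ) ∞
      (fun z : ℝ × M => tangentialEnergy g D h (f z.1) z.2) (T ×ˢ Set.univ) := by
  rintro ⟨t, x⟩ ⟨ht, -⟩
  obtain ⟨J, U, hB⟩ := hF.exists_isFlowBox ht x
  set φ := extChartAt (𝓡 d) x with hφ
  have h1 : ContMDiffOn (𝓘(ℝ, ℝ).prod (𝓡 d)) 𝓘(ℝ, ℝ) ∞ (fun p : ℝ × Euc d =>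
      tangentialEnergy g D h (f p.1) (φ.symm p.2)) ((T ∩ J) ×ˢ U) := by
    have h0 := hB.smooth_energy hF
    rw [← contMDiffOn_iff_contDiffOn, modelWithCornersSelf_prod, ← chartedSpaceSelf_prod] at h0
    exact h0
  have hO : IsOpen (φ.source ∩ φ ⁻¹' U) :=
    (continuousOn_extChartAt x).isOpen_inter_preimage (isOpen_extChartAt_source x) hB.openSpace
  have h2 : ContMDiffOn (𝓘(ℝ, ℝ).prod (𝓡 d)) (𝓘(ℝ, ℝ).prod (𝓡 d)) ∞
      (fun z : ℝ × M => (z.1, φ z.2)) (Set.univ ×ˢ φ.source) :=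
    contMDiff_fst.contMDiffOn.prodMk ((contMDiffOn_extChartAt (x := x)).comp
      contMDiff_snd.contMDiffOn fun z hz => by simpa [hφ] using hz.2)
  have h3 := h1.comp (f := fun z : ℝ × M => (z.1, φ z.2))
    (s := (T ∩ J) ×ˢ (φ.source ∩ φ ⁻¹' U))
    (h2.mono (Set.prod_mono (Set.subset_univ _) Set.inter_subset_left))
    fun z hz => ⟨hz.1, hz.2.2⟩
  have h4 : ContMDiffOn (𝓘(ℝ, ℝ).prod (𝓡 d)) 𝓘(ℝ, ℝ) ∞
      (fun z : ℝ × M => tangentialEnergy g D h (f z.1) z.2)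
      ((T ∩ J) ×ˢ (φ.source ∩ φ ⁻¹' U)) := h3.congr fun z hz => by
    simp only [Function.comp_apply]
    rw [φ.left_inv hz.2.1]
  have h5 : (T ∩ J) ×ˢ (φ.source ∩ φ ⁻¹' U)
      = (T ×ˢ Set.univ) ∩ (J ×ˢ (φ.source ∩ φ ⁻¹' U)) := by
    ext z
    simp only [Set.mem_prod, Set.mem_inter_iff, Set.mem_univ, and_true]
    tauto
  have h6 : J ×ˢ (φ.source ∩ φ ⁻¹' U) ∈ nhds (t, x) :=
    (hB.openTime.prod hO).mem_nhds ⟨hB.memTime, mem_extChartAt_source x, hB.memSpace⟩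
  have h7 := h4 (t, x) ⟨⟨ht, hB.memTime⟩, mem_extChartAt_source x, hB.memSpace⟩
  rw [h5] at h7
  exact (contMDiffWithinAt_inter h6).1 h7

theorem smooth_energy_slice (hF : IsHeatFlow g D h T f) (ht : t ∈ T) :
    ContMDiff (𝓡 d) 𝓘(ℝ, ℝ) ∞ (tangentialEnergy g D h (f t)) := by
  rw [← contMDiffOn_univ]
  exact hF.smooth_energy.comp (t := T ×ˢ Set.univ) (f := fun x : M => (t, x))
    (contMDiff_const.prodMk contMDiff_id).contMDiffOn fun x _ => ⟨ht, trivial⟩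

/-- The heat operator applied to the tangential energy density, in a flow box. -/
theorem heat_energy (hF : IsHeatFlow g D h T f) {J : Set ℝ} {U : Set (Euc d)}
    (hB : IsFlowBox q f T t x J U) (hs : s ∈ T ∩ J) (hy : y ∈ U) :
    derivWithin (fun r => tangentialEnergy g D h (f r) ((extChartAt (𝓡 d) x).symm y)) T s
        + laplaceBeltrami g (tangentialEnergy g D h (f s)) ((extChartAt (𝓡 d) x).symm y)
      = Coord.eellsSampsonTerm (chartForm g x) (chartDistribution D x) (chartForm h (f t x))
        (flowCoord q f t x s) y := by
  rw [← (hB.isTenseOn hF).heat_bochner (hF.target (f t x)) (hF.time.inter hB.openTime)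
    (hB.smooth hF) (fun _ hs _ hy => hB.flowCoord_mem hs hy)
    (fun _ hs _ hy => hB.flow hF hs hy) hs hy]
  congr 1
  · rw [← derivWithin_inter (hB.openTime.mem_nhds hs.2)]
    exact derivWithin_congr (fun r hr => hB.energy_eq hF hr hy) (hB.energy_eq hF hs hy)
  · refine (laplaceBeltrami_eq hB.isParam hy (hB.isTenseOn hF).metric (hF.tense _).metric
      (hF.smooth_energy_slice hs.1)).trans (laplacian_congr _ ?_)
    filter_upwards [hB.openSpace.mem_nhds hy] with y' hy'
    exact hB.energy_eq hF hs hy'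

/-- The Eells–Sampson type formula for the tangential energy density. -/
theorem eellsSampson (hF : IsHeatFlow g D h T f) (ht : t ∈ T) (x : M) :
    derivWithin (fun s => tangentialEnergy g D h (f s) x) T t
        + laplaceBeltrami g (tangentialEnergy g D h (f t)) x
      = eellsSampsonTerm g D h (f t) x := by
  obtain ⟨J, U, hB⟩ := hF.exists_isFlowBox ht x
  have h1 := hF.heat_energy hB ⟨ht, hB.memTime⟩ hB.memSpace
  rw [extChartAt_to_inv] at h1
  rw [h1, eellsSampsonTerm_eq D ((hF.smooth_slice ht x).mdifferentiableAt (by simp))]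
  rfl

/-- Locally, the heat operator applied to the tangential energy density is bounded by
a multiple of this density. -/
theorem exists_bound (hF : IsHeatFlow g D h T f) (ht : t ∈ T) (x : M) :
    ∃ C : ℝ, ∀ᶠ p : ℝ × M in nhdsWithin (t, x) (T ×ˢ Set.univ),
      derivWithin (fun s => tangentialEnergy g D h (f s) p.2) T p.1
          + laplaceBeltrami g (tangentialEnergy g D h (f p.1)) p.2
        ≤ C * tangentialEnergy g D h (f p.1) p.2 := by
  obtain ⟨J, U, hB⟩ := hF.exists_isFlowBox ht x
  set φ := extChartAt (𝓡 d) x with hφ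
  obtain ⟨C, hC⟩ := (hB.isTenseOn hF).exists_bound (hF.target (f t x))
    (hF.time.inter hB.openTime) (hB.smooth hF) (fun _ hs _ hy => hB.flowCoord_mem hs hy)
    ⟨ht, hB.memTime⟩ hB.memSpace
  refine ⟨C, ?_⟩
  have hO : IsOpen (φ.source ∩ φ ⁻¹' U) :=
    (continuousOn_extChartAt x).isOpen_inter_preimage (isOpen_extChartAt_source x) hB.openSpace
  have h6 : J ×ˢ (φ.source ∩ φ ⁻¹' U) ∈ nhds (t, x) :=
    (hB.openTime.prod hO).mem_nhds ⟨hB.memTime, mem_extChartAt_source x, hB.memSpace⟩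
  have h7 : Filter.Tendsto (fun p : ℝ × M => (p.1, φ p.2)) (nhdsWithin (t, x) (T ×ˢ Set.univ))
      (nhdsWithin (t, φ x) ((T ∩ J) ×ˢ U)) := by
    refine tendsto_nhdsWithin_iff.2 ⟨?_, ?_⟩
    · refine Filter.Tendsto.mono_left ?_ nhdsWithin_le_nhds
      exact continuous_fst.continuousAt.prodMk ((continuousAt_extChartAt x).comp
        (f := Prod.snd) (x := (t, x)) continuous_snd.continuousAt)
    · filter_upwards [self_mem_nhdsWithin, nhdsWithin_le_nhds h6] with p hp hp'
      exact ⟨⟨hp.1, hp'.1⟩, hp'.2.2⟩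
  filter_upwards [h7.eventually hC, self_mem_nhdsWithin, nhdsWithin_le_nhds h6] with p hp hp1 hp2
  have hs : p.1 ∈ T ∩ J := ⟨hp1.1, hp2.1⟩
  have h8 := hF.heat_energy hB hs hp2.2.2
  have h9 := hB.energy_eq hF hs hp2.2.2
  rw [φ.left_inv hp2.2.1] at h8 h9
  rw [h8, h9]
  exact hp

end IsHeatFlow

end Flow

/-! ### Coverings -/

section Covering

variable {E X : Type*} [TopologicalSpace E] [TopologicalSpace X] {p : E → X}

/-- A path in the base is lifted from any chosen point of the covering space. -/
theorem surjective_of_isCoveringMap (hp : IsCoveringMap p) [Nonempty E] [PathConnectedSpace X] :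
    Function.Surjective p := by
  intro x
  obtain ⟨e⟩ := ‹Nonempty E›
  let γ := PathConnectedSpace.somePath (p e) x
  obtain ⟨Γ, hΓ, -⟩ := hp.exists_path_lifts γ e γ.source
  exact ⟨Γ 1, (congrFun hΓ 1).trans γ.target⟩

/-- The group of deck transformations of a simply connected covering is transitive on fibres. -/
theorem exists_deckGroup_apply_eq (hp : IsCoveringMap p) [SimplyConnectedSpace E]
    [LocallyPathConnectedSpace E] {a b : E} (hab : p a = p b) :
    ∃ γ ∈ deckGroup p, γ a = b := by
  -- Simple connectedness lifts `p` through itself with prescribed base points; by uniqueness of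
  -- lifts the two lifts so obtained are mutually inverse.
  have lift : ∀ a b : E, p a = p b → ∃ F : C(E, E), F a = b ∧ p ∘ F = p := fun a b hab => by
    obtain ⟨F, hF, -⟩ := hp.existsUnique_continuousMap_lifts ⟨p, hp.continuous⟩ a b hab.symm
    exact ⟨F, hF⟩
  have unique : ∀ (a : E) (F : C(E, E)), F a = a → p ∘ F = p → ∀ y, F y = y := by
    intro a F h1 h2 y
    obtain ⟨F', -, hF'⟩ := hp.existsUnique_continuousMap_lifts ⟨p, hp.continuous⟩ a a rfl
    rw [hF' F ⟨h1, h2⟩, ← hF' (ContinuousMap.id E) ⟨rfl, rfl⟩]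
    rfl
  obtain ⟨F, hF, hpF⟩ := lift a b hab
  obtain ⟨F', hF', hpF'⟩ := lift b a hab.symm
  refine ⟨⟨⟨F, F', unique a (F'.comp F) ?_ ?_, unique b (F.comp F') ?_ ?_⟩, F.continuous,
    F'.continuous⟩, fun x => congrFun hpF x, hF⟩
  · rw [ContinuousMap.comp_apply, hF, hF']
  · rw [ContinuousMap.coe_comp, ← Function.comp_assoc, hpF', hpF]
  · rw [ContinuousMap.comp_apply, hF', hF]
  · rw [ContinuousMap.coe_comp, ← Function.comp_assoc, hpF, hpF']

/-- Local upper bounds over `S × E` that are invariant under deck transformations are global, if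
`S` and the base of the covering are compact. -/
theorem exists_forall_of_deckGroup (hp : IsCoveringMap p) [SimplyConnectedSpace E]
    [LocallyPathConnectedSpace E] [PathConnectedSpace X] [CompactSpace X] {S : Set ℝ}
    (hS : IsCompact S) {P : ℝ → ℝ × E → Prop}
    (mono : ∀ C C' z, z.1 ∈ S → C ≤ C' → P C z → P C' z)
    (inv : ∀ C t x, t ∈ S → ∀ γ ∈ deckGroup p, P C (t, x) → P C (t, γ x))
    (loc : ∀ t ∈ S, ∀ x, ∃ C, ∀ᶠ z in nhdsWithin (t, x) (S ×ˢ Set.univ), P C z) :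
    ∃ C, 0 < C ∧ ∀ t ∈ S, ∀ x, P C (t, x) := by
  have h1 : ∀ x : E, ∃ C, ∀ᶠ y in nhds x, ∀ t ∈ S, P C (t, y) := by
    intro x
    -- The induction runs over arbitrary sets of times, hence the repeated condition `t ∈ S`, which
    -- `mono` requires.
    have key : ∃ C, ∀ᶠ y in nhds x, ∀ t ∈ S, t ∈ S → P C (t, y) := by
      refine hS.induction_on (p := fun A => ∃ C, ∀ᶠ y in nhds x, ∀ t ∈ A, t ∈ S → P C (t, y))
        ⟨0, by simp⟩ ?_ ?_ ?_
      · rintro A B hAB ⟨C, hC⟩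
        exact ⟨C, hC.mono fun y hy t ht => hy t (hAB ht)⟩
      · rintro A B ⟨C, hC⟩ ⟨C', hC'⟩
        refine ⟨max C C', ?_⟩
        filter_upwards [hC, hC'] with y hy hy' t ht htS
        rcases ht with ht | ht
        · exact mono _ _ _ htS (le_max_left _ _) (hy t ht htS)
        · exact mono _ _ _ htS (le_max_right _ _) (hy' t ht htS)
      · intro t ht
        obtain ⟨C, hC⟩ := loc t ht x
        rw [nhdsWithin_prod_eq, nhdsWithin_univ] at hC
        obtain ⟨pa, ha, pb, hb, hab⟩ := Filter.eventually_prod_iff.1 hC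
        exact ⟨{s | pa s}, ha, C, hb.mono fun y hy s hs _ => hab hs hy⟩
    obtain ⟨C, hC⟩ := key
    exact ⟨C, hC.mono fun y hy t ht => hy t ht ht⟩
  -- The induction runs over sets of base points above which one constant serves on whole fibres. As
  -- `p` is open and each fibre is a single orbit, a bound near one point of the fibre suffices.
  have h2 : ∃ C, ∀ x, p x ∈ Set.univ → ∀ t ∈ S, P C (t, x) := by
    refine isCompact_univ.induction_on (p := fun A => ∃ C, ∀ x, p x ∈ A → ∀ t ∈ S, P C (t, x))
      ⟨0, by simp⟩ ?_ ?_ ?_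
    · rintro A B hAB ⟨C, hC⟩
      exact ⟨C, fun x hx => hC x (hAB hx)⟩
    · rintro A B ⟨C, hC⟩ ⟨C', hC'⟩
      refine ⟨max C C', fun x hx t ht => ?_⟩
      rcases hx with hx | hx
      · exact mono _ _ _ ht (le_max_left _ _) (hC x hx t ht)
      · exact mono _ _ _ ht (le_max_right _ _) (hC' x hx t ht)
    · rintro x -
      obtain ⟨e, rfl⟩ := surjective_of_isCoveringMap hp x
      obtain ⟨C, hC⟩ := h1 e
      refine ⟨p '' {y | ∀ t ∈ S, P C (t, y)}, mem_nhdsWithin_of_mem_nhds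
        (hp.isLocalHomeomorph.isOpenMap.image_mem_nhds hC), C, ?_⟩
      rintro y ⟨w, hw, hwy⟩ t ht
      obtain ⟨γ, hγ, rfl⟩ := exists_deckGroup_apply_eq hp hwy
      exact inv C t w ht γ hγ (hw t ht)
  obtain ⟨C, hC⟩ := h2
  exact ⟨max C 1, lt_max_of_lt_right one_pos, fun t ht x =>
    mono _ _ _ ht (le_max_left _ _) (hC x trivial t ht)⟩

end Covering

/-! ### Smoothness and differentials of deck transformations. -/

section Deck

variable {d : ℕ} {M N : Type*} [TopologicalSpace M] [ChartedSpace (EuclideanSpace ℝ (Fin d)) M]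
  [TopologicalSpace N] [ChartedSpace (EuclideanSpace ℝ (Fin d)) N] {p : M → N}

/-- Deck transformations of a local diffeomorphism are smooth. -/
theorem contMDiff_of_mem_deckGroup (hp : IsLocalDiffeomorph (𝓡 d) (𝓡 d) ∞ p) {γ : M ≃ₜ M}
    (hγ : γ ∈ deckGroup p) : ContMDiff (𝓡 d) (𝓡 d) ∞ γ := by
  intro x
  have h1 := (hp (γ x)).localInverse_contMDiffAt
  rw [hγ x] at h1
  refine (h1.comp x (hp.contMDiff x)).congr_of_eventuallyEq ?_
  filter_upwards [γ.continuous.continuousAt.eventually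
    (hp (γ x)).localInverse_eventuallyEq_left] with y hy
  have h2 : (hp (γ x)).localInverse (p (γ y)) = γ y := hy
  rw [hγ y] at h2
  exact h2.symm

theorem injective_mfderiv (hp : IsLocalDiffeomorph (𝓡 d) (𝓡 d) ∞ p) (x : M) :
    Function.Injective (mfderiv (𝓡 d) (𝓡 d) p x) :=
  ((hp x).mfderivToContinuousLinearEquiv (by simp)).injective

theorem injective_mfderiv_of_mem_deckGroup (hp : IsLocalDiffeomorph (𝓡 d) (𝓡 d) ∞ p) {γ : M ≃ₜ M}
    (hγ : γ ∈ deckGroup p) (x : M) : Function.Injective (mfderiv (𝓡 d) (𝓡 d) γ x) := by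
  have h1 : p ∘ γ = p := funext hγ
  have h2 := mfderiv_comp x ((hp.contMDiff (γ x)).mdifferentiableAt (by simp))
    ((contMDiff_of_mem_deckGroup hp hγ x).mdifferentiableAt (by simp))
  intro v w hvw
  refine injective_mfderiv hp x ?_
  have h3 : (mfderiv (𝓡 d) (𝓡 d) (p ∘ γ) x : Euc d →L[ℝ] Euc d) = mfderiv (𝓡 d) (𝓡 d) p x := by
    rw [h1]
  have h4 : ∀ v, (mfderiv (𝓡 d) (𝓡 d) p x : Euc d →L[ℝ] Euc d) v
      = mfderiv (𝓡 d) (𝓡 d) p (γ x) (mfderiv (𝓡 d) (𝓡 d) γ x v) := fun v => by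
    rw [← h3, h2]
    rfl
  exact (h4 v).trans ((congrArg _ hvw).trans (h4 w).symm)

end Deck

/-! ### Invariance under deck transformations -/

section Invariance

variable {d q : ℕ} {M B N : Type*} [TopologicalSpace M] [ChartedSpace (EuclideanSpace ℝ (Fin d)) M]
  [IsManifold (𝓡 d) ∞ M] [TopologicalSpace B] [ChartedSpace (EuclideanSpace ℝ (Fin d)) B]
  [TopologicalSpace N] [ChartedSpace (EuclideanSpace ℝ (Fin q)) N]
  {p : M → B} {γ : M ≃ₜ M} {g : FormField d B}

/-- The preferred chart followed by a deck transformation is a parametrization in which the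
pull-back metric has the same expression. -/
theorem isParam_deck (hp : IsLocalDiffeomorph (𝓡 d) (𝓡 d) ∞ p) (hγ : γ ∈ deckGroup p) (x : M) :
    IsParam (γ ∘ (extChartAt (𝓡 d) x).symm) (extChartAt (𝓡 d) x).target :=
  (IsParam.chart (d := d) x).comp (contMDiff_of_mem_deckGroup hp hγ)
    (injective_mfderiv_of_mem_deckGroup hp hγ)

theorem coordForm_deck (hp : IsLocalDiffeomorph (𝓡 d) (𝓡 d) ∞ p) (hγ : γ ∈ deckGroup p) (x : M)
    (g : FormField d B) {y : Euc d} (hy : y ∈ (extChartAt (𝓡 d) x).target) :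
    coordForm (γ ∘ (extChartAt (𝓡 d) x).symm) (pullbackForm (d := d) (q := d) p g) y
      = chartForm (pullbackForm (d := d) (q := d) p g) x y := by
  refine ((isParam_deck hp hγ x).coordForm_pullback hp.contMDiff g hy).trans ?_
  rw [← Function.comp_assoc, show p ∘ γ = p from funext hγ]
  exact ((IsParam.chart (d := d) x).coordForm_pullback hp.contMDiff g hy).symm

theorem coordDist_deck (hp : IsLocalDiffeomorph (𝓡 d) (𝓡 d) ∞ p) (hγ : γ ∈ deckGroup p) (x : M)
    (D : Distribution d B) {y : Euc d} (hy : y ∈ (extChartAt (𝓡 d) x).target) :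
    coordDist (γ ∘ (extChartAt (𝓡 d) x).symm) (pullbackDistribution (d := d) (q := d) p D) y
      = chartDistribution (pullbackDistribution (d := d) (q := d) p D) x y := by
  refine ((isParam_deck hp hγ x).coordDist_pullback hp.contMDiff D hy).trans ?_
  rw [← Function.comp_assoc, show p ∘ γ = p from funext hγ]
  exact ((IsParam.chart (d := d) x).coordDist_pullback hp.contMDiff D hy).symm

/-- At γx the Laplacian is computed in the chart at x followed by γ, where the pulled-back metric
and the invariant function have the same expressions as in the chart at x. -/
theorem laplaceBeltrami_deck (hp : IsLocalDiffeomorph (𝓡 d) (𝓡 d) ∞ p) (hγ : γ ∈ deckGroup p)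
    (hg : ∀ x, IsMetricOn (chartForm (pullbackForm (d := d) (q := d) p g) x)
      (extChartAt (𝓡 d) x).target) {φ : M → ℝ} (hφ : ContMDiff (𝓡 d) 𝓘(ℝ, ℝ) ∞ φ)
    (inv : ∀ x, φ (γ x) = φ x) (x : M) :
    laplaceBeltrami (pullbackForm (d := d) (q := d) p g) φ (γ x)
      = laplaceBeltrami (pullbackForm (d := d) (q := d) p g) φ x := by
  have hz := mem_extChartAt_target (I := 𝓡 d) x
  have hm := (hg x).congr fun y hy => coordForm_deck hp hγ x g hy
  have h1 := laplaceBeltrami_eq (isParam_deck hp hγ x) hz hm (hg _) hφ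
  have hi : IsIsom (coordForm (γ ∘ (extChartAt (𝓡 d) x).symm)
      (pullbackForm (d := d) (q := d) p g)) (chartForm (pullbackForm (d := d) (q := d) p g) x)
      (extChartAt (𝓡 d) x).target (extChartAt (𝓡 d) x).target id :=
    ⟨hm, hg x, fun _ _ => contDiffAt_id, fun z hz => hz, fun z hz v w => by
      rw [fderiv_id]
      exact (DFunLike.congr_fun (DFunLike.congr_fun (coordForm_deck hp hγ x g hz) v) w).symm⟩
  have h2 := hi.laplacian_comp hz (φ := φ ∘ (extChartAt (𝓡 d) x).symm) fun y hy =>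
    contMDiffAt_iff_contDiffAt.1 ((hφ _).comp y ((IsParam.chart (d := d) x).smooth y hy))
  have h3 : φ ∘ γ ∘ (extChartAt (𝓡 d) x).symm = φ ∘ (extChartAt (𝓡 d) x).symm := by
    funext y
    exact inv _
  rw [Function.comp_apply, extChartAt_to_inv, h3] at h1
  exact h1.trans h2

/-- Composing the source chart with γ and the target chart with r, the map `k` has near γx the
coordinate expression `u` that it has near x. The coordinate metrics and distribution also agree,
because γ covers the identity and r is an isometry. -/
theorem tangentialEnergy_deck [IsManifold (𝓡 q) ∞ N] (hp : IsLocalDiffeomorph (𝓡 d) (𝓡 d) ∞ p)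
    (hγ : γ ∈ deckGroup p)
    (hg : ∀ x, IsMetricOn (chartForm (pullbackForm (d := d) (q := d) p g) x)
      (extChartAt (𝓡 d) x).target) (D : Distribution d B) {h : FormField q N} {r : N ≃ₜ N}
    (hr : r ∈ isometryGroup h) {k : M → N} (hk : ContMDiff (𝓡 d) (𝓡 q) ∞ k)
    (equiv : ∀ x, k (γ x) = r (k x)) (x : M) :
    tangentialEnergy (pullbackForm (d := d) (q := d) p g)
        (pullbackDistribution (d := d) (q := d) p D) h k (γ x)
      = tangentialEnergy (pullbackForm (d := d) (q := d) p g)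
        (pullbackDistribution (d := d) (q := d) p D) h k x := by
  set φ := extChartAt (𝓡 d) x with hφ
  set η := extChartAt (𝓡 q) (k x) with hη
  have hz : φ x ∈ φ.target := mem_extChartAt_target x
  have hψ0 : IsParam φ.symm φ.target := IsParam.chart (d := d) x
  have hψ : IsParam (γ ∘ φ.symm) φ.target := isParam_deck hp hγ x
  have hχ0 : IsParam η.symm η.target := IsParam.chart (d := q) (k x)
  have hx : φ.symm (φ x) = x := extChartAt_to_inv x
  set u : Euc d → Euc q := η ∘ k ∘ φ.symm with hu
  have huz : u (φ x) ∈ η.target := by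
    rw [hu, Function.comp_apply, Function.comp_apply, hx]
    exact mem_extChartAt_target _
  have ck : ContMDiffAt (𝓡 d) (𝓡 q) ∞ (k ∘ φ.symm) (φ x) := (hk _).comp _ (hψ0.smooth _ hz)
  have hsrc : ∀ᶠ y in nhds (φ x), k (φ.symm y) ∈ η.source := by
    refine ck.continuousAt.eventually_mem ?_
    rw [Function.comp_apply, hx]
    exact extChartAt_source_mem_nhds _
  have du : DifferentiableAt ℝ u (φ x) := by
    refine ContDiffAt.diff (contMDiffAt_iff_contDiffAt.1 (ContMDiffAt.comp (φ x) ?_ ck))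
    refine contMDiffAt_extChartAt' ?_
    rw [Function.comp_apply, hx]
    exact mem_chart_source _ _
  have e0 : k ∘ φ.symm =ᶠ[nhds (φ x)] η.symm ∘ u := by
    filter_upwards [hsrc] with y hy
    exact (η.left_inv hy).symm
  have e1 : k ∘ γ ∘ φ.symm =ᶠ[nhds (φ x)] (r ∘ η.symm) ∘ u := by
    filter_upwards [e0] with y hy
    exact (equiv _).trans (congrArg r hy)
  have hr' : MDifferentiableAt (𝓡 q) (𝓡 q) (r ∘ η.symm) (u (φ x)) :=
    ((hr.1 _).comp _ (hχ0.smooth _ huz)).mdifferentiableAt (by simp)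
  have eG := coordForm_deck hp hγ x g hz
  have eD := coordDist_deck hp hγ x D hz
  have eH : coordForm (r ∘ η.symm) h (u (φ x)) = coordForm η.symm h (u (φ x)) := by
    rw [← hχ0.coordForm_pullback hr.1 h huz]
    have h1 : pullbackForm (d := q) (q := q) r h = h := by
      funext y
      exact ContinuousLinearMap.ext fun v => ContinuousLinearMap.ext fun w => hr.2.2 y v w
    rw [h1]
  have h1 := tangentialEnergy_eq (D := pullbackDistribution (d := d) (q := d) p D) (h := h)
    (hψ.mdiff hz) hr' ((hk _).mdifferentiableAt (by simp)) du e1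
    (eG ▸ (hg x).inner _ hz) (isInner_of_chart (hg _))
  have h2 := tangentialEnergy_eq (D := pullbackDistribution (d := d) (q := d) p D) (h := h)
    (hψ0.mdiff hz) (hχ0.mdiff huz) ((hk _).mdifferentiableAt (by simp)) du e0
    ((hg x).inner _ hz) (isInner_of_chart (hg _))
  rw [hx] at h2
  rw [Function.comp_apply, hx] at h1
  rw [h1, h2]
  simp only [Coord.energy]
  rw [eG, eD, eH]
  rfl

end Invariance

section Nonneg

variable {d q : ℕ} {M N : Type*} [TopologicalSpace M] [ChartedSpace (EuclideanSpace ℝ (Fin d)) M]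
  [TopologicalSpace N] [ChartedSpace (EuclideanSpace ℝ (Fin q)) N]

theorem tangentialEnergy_nonneg {g : FormField d M} {h : FormField q N} {k : M → N} {x : M}
    (D : Distribution d M) (hg : IsInner (d := d) (g x)) (hh : IsInner (d := q) (h (k x))) :
    0 ≤ tangentialEnergy g D h k x := by
  let β : Euc d →L[ℝ] Euc q := (mfderiv (𝓡 d) (𝓡 q) k x : Euc d →L[ℝ] Euc q).comp
    (LinearMap.toContinuousLinearMap (tangentProj g D x : Euc d →ₗ[ℝ] Euc d))
  have h1 : 0 ≤ metricTrace (d := d) (g x) fun v w =>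
      (h (k x) : Euc q →L[ℝ] Euc q →L[ℝ] ℝ) (β v) (β w) := by
    by_cases h0 : β = 0
    · have h2 : ∀ v w, (h (k x) : Euc q →L[ℝ] Euc q →L[ℝ] ℝ) (β v) (β w) = 0 := fun v w => by
        rw [h0]
        exact map_zero _
      simp only [h2, metricTrace, smul_zero, Finset.sum_const_zero, le_refl]
    · exact (metricTrace_pos hg hh h0).le
  exact mul_nonneg (by norm_num) h1

end Nonneg

/-! ### From the base to its universal cover. -/

section Cover

variable {m n q : ℕ} {X X' Y : Type*} [TopologicalSpace X] [T2Space X]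
  [ChartedSpace (EuclideanSpace ℝ (Fin (m + n))) X] [IsManifold (𝓡 (m + n)) ∞ X]
  [TopologicalSpace X'] [ChartedSpace (EuclideanSpace ℝ (Fin (m + n))) X']
  [IsManifold (𝓡 (m + n)) ∞ X']
  {D : Distribution (m + n) X} {g : Metric (m + n) X} {p : X' → X}

/-- A chart of the cover followed by `p` parametrizes `X` and gives the same coordinate metric and
distribution, so no vector fields on the cover need be considered. -/
theorem isTenseOn_cover (hD : IsFoliation m n D) (hg : IsBundleLike g.inner D)
    (htense : IsFoliatedField D (meanCurvature g.inner D))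
    (hp : IsLocalDiffeomorph (𝓡 (m + n)) (𝓡 (m + n)) ∞ p) (x : X') :
    IsTenseOn (chartForm (pullbackForm (d := m + n) (q := m + n) p g.inner) x)
      (chartDistribution (pullbackDistribution (d := m + n) (q := m + n) p D) x)
      (extChartAt (𝓡 (m + n)) x).target := by
  have hψ := IsParam.chart (d := m + n) x
  exact ((hψ.comp hp.contMDiff (injective_mfderiv hp)).isTenseOn hD hg htense).congr
    (fun y hy => hψ.coordForm_pullback hp.contMDiff _ hy)
    fun y hy => hψ.coordDist_pullback hp.contMDiff _ hy

end Cover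

end TangentialEnergy

end

/-! ### The theorem. -/

open TangentialEnergy in
theorem mainTheorem6 (m n q : ℕ)
    -- the compact foliated manifold with its tense bundle-like metric
    (X : Type*) [TopologicalSpace X] [T2Space X] [CompactSpace X] [ConnectedSpace X]
    [ChartedSpace (EuclideanSpace ℝ (Fin (m + n))) X] [IsManifold (𝓡 (m + n)) ∞ X]
    (D : Distribution (m + n) X) (hD : IsFoliation m n D)
    (g : Metric (m + n) X) (hg : IsBundleLike g.inner D)
    (htense : IsFoliatedField D (meanCurvature g.inner D))
    -- its universal cover
    (X' : Type*) [TopologicalSpace X'] [T2Space X'] [SimplyConnectedSpace X']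
    [ChartedSpace (EuclideanSpace ℝ (Fin (m + n))) X'] [IsManifold (𝓡 (m + n)) ∞ X']
    (p : X' → X) (hp : IsCoveringMap p) (hp' : IsLocalDiffeomorph (𝓡 (m + n)) (𝓡 (m + n)) ∞ p)
    -- the target
    (Y : Type*) [TopologicalSpace Y] [T2Space Y]
    [ChartedSpace (EuclideanSpace ℝ (Fin q)) Y] [IsManifold (𝓡 q) ∞ Y] (h : Metric q Y)
    (ρ : deckGroup p →* isometryGroup h.inner)
    -- the equivariant solution of the harmonic map heat flow
    (t₀ : ℝ) (ht₀ : 0 < t₀) (f : ℝ → X' → Y)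
    (hf : ContMDiffOn (𝓘(ℝ, ℝ).prod (𝓡 (m + n))) (𝓡 q) ∞ (fun z : ℝ × X' => f z.1 z.2)
      (Set.Icc 0 t₀ ×ˢ Set.univ))
    (hequiv : ∀ t ∈ Set.Icc 0 t₀, ∀ (γ : deckGroup p) (x : X'),
      f t ((γ : X' ≃ₜ X') x) = (ρ γ : Y ≃ₜ Y) (f t x))
    (hflow : ∀ t ∈ Set.Icc 0 t₀, ∀ x : X',
      mfderivWithin 𝓘(ℝ, ℝ) (𝓡 q) (fun s => f s x) (Set.Icc 0 t₀) t (1 : ℝ)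
        = tensionField (d := m + n) (q := q) (pullbackForm p g.inner) h.inner (f t) x) :
    let g' : FormField (m + n) X' := pullbackForm p g.inner
    let D' : Distribution (m + n) X' := pullbackDistribution p D
    let e : ℝ → X' → ℝ := fun t x => tangentialEnergy g' D' h.inner (f t) x
    ContMDiffOn (𝓘(ℝ, ℝ).prod (𝓡 (m + n))) 𝓘(ℝ, ℝ) ∞ (fun z : ℝ × X' => e z.1 z.2)
      (Set.Icc 0 t₀ ×ˢ Set.univ) ∧
    (∃ C : ℝ, 0 < C ∧ ∀ t ∈ Set.Icc 0 t₀, ∀ x : X',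
      derivWithin (fun s => e s x) (Set.Icc 0 t₀) t + laplaceBeltrami g' (e t) x ≤ C * e t x) ∧
    (∀ t ∈ Set.Icc 0 t₀, ∀ x : X',
      derivWithin (fun s => e s x) (Set.Icc 0 t₀) t + laplaceBeltrami g' (e t) x
        = eellsSampsonTerm g' D' h.inner (f t) x) := by
  intro g' D' e
  -- Lifting maps through the covering requires local path connectedness, inherited from the model
  -- space.
  have := ChartedSpace.locallyPathConnectedSpace (EuclideanSpace ℝ (Fin (m + n))) X
  have := ChartedSpace.locallyPathConnectedSpace (EuclideanSpace ℝ (Fin (m + n))) X'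
  have : PathConnectedSpace X := pathConnectedSpace_iff_connectedSpace.2 inferInstance
  have hF : IsHeatFlow g' D' h.inner (Set.Icc 0 t₀) f :=
    ⟨isTimeDomain_Icc ht₀, isTenseOn_cover hD hg htense hp', isMetricOn_chartForm h, hf, hflow⟩
  have hmet := fun x => (hF.tense x).metric
  -- Nonnegativity is what allows the constant to be enlarged.
  have hpos : ∀ t x, 0 ≤ e t x := fun t x =>
    tangentialEnergy_nonneg D' (isInner_of_chart (hmet x)) (isInner_metric h _)
  have hinv : ∀ t ∈ Set.Icc 0 t₀, ∀ γ (hγ : γ ∈ deckGroup p) (x : X'), e t (γ x) = e t x :=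
    fun t ht γ hγ x => tangentialEnergy_deck hp' hγ hmet D (ρ ⟨γ, hγ⟩).2 (hF.smooth_slice ht)
      (hequiv t ht ⟨γ, hγ⟩) x
  refine ⟨hF.smooth_energy, ?_, fun t ht => hF.eellsSampson ht⟩
  refine exists_forall_of_deckGroup hp (isCompact_Icc (a := 0) (b := t₀))
    (P := fun C z => derivWithin (fun s => e s z.2) (Set.Icc 0 t₀) z.1
      + laplaceBeltrami g' (e z.1) z.2 ≤ C * e z.1 z.2) (fun C C' z hz hC hle => ?_)
    (fun C t x ht γ hγ hle => ?_) (fun t ht x => hF.exists_bound ht x)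
  · exact hle.trans (mul_le_mul_of_nonneg_right hC (hpos _ _))
  · have h1 := laplaceBeltrami_deck hp' hγ hmet (hF.smooth_energy_slice ht) (hinv t ht γ hγ) x
    have h2 : derivWithin (fun s => e s (γ x)) (Set.Icc 0 t₀) t
        = derivWithin (fun s => e s x) (Set.Icc 0 t₀) t :=
      derivWithin_congr (fun s hs => hinv s hs γ hγ x) (hinv t ht γ hγ x)
    have h3 := hinv t ht γ hγ x
    change derivWithin (fun s => e s (γ x)) (Set.Icc 0 t₀) t
      + laplaceBeltrami g' (e t) (γ x) ≤ C * e t (γ x)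
    rw [h2, h3]
    exact (congrArg (_ + ·) h1).trans_le hle
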